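/- **Setting.** Let $X$ be a smooth manifold of dimension $n$ (Hausdorff, second countable, without boundary) and let $J^2(X)\to X$ be its bundle of 2-jets of real functions. There is a canonical splitting $J^2(X)=\mathbf R\oplus J^2_{\rm red}(X)$ (value of the function, reduced 2-jet), and $\mathrm{Sym}^2(T^*X)\subset J^2_{\rm red}(X)$. A chart on $U\subset X$ induces a trivialization $J^2(U)=U\times\mathbf J^2$, where $\mathbf J^2=\mathbf R\times(\mathbf R^n)^*\times \mathrm{Sym}^2((\mathbf R^n)^*)$, by $J^2_xu=(u,Du,D^2u)$. *Subequations.* A *subequation* on $X$ is a closed set $F\subset J^2(X)$ such that, fibrewise, $F+\mathcal P\subset F$, where $\mathcal P=\{A\in \mathrm{Sym}^2(T^*X): A\ge 0\}$, and $F+\mathcal N\subset F$, where $\mathcal N$ is the set of 2-jets of constant functions $\le 0$, and such that $F=\overline{\mathrm{Int}\,F}$, $F_x=\overline{\mathrm{Int}\,F_x}$ and $\mathrm{Int}\,F_x=(\mathrm{Int}\,F)_x$ for all $x\in X$. Its *dual* is $\widetilde F=-(\sim\mathrm{Int}\,F)$. A *constant coefficient subequation* is a closed set $\mathbf F\subset\mathbf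 J^2$ with $\emptyset\ne\mathbf F\neq\mathbf J^2$, $\mathbf F+(0,0,A)\subset\mathbf F$ for all $A\geq0$, $\mathbf F+(r,0,0)\subset\mathbf F$ for all $r\le0$, and $\mathbf F=\overline{\mathrm{Int}\,\mathbf F}$. A *monotonicity cone* for $F$ is a subequation $M$ on $X$ each of whose fibres is a convex cone with vertex at the origin and which satisfies $F+M\subset F$ (fibrewise sum). A function $\psi\in C^2(X)$ is *strictly $M$-subharmonic* if $J^2_x\psi\in\mathrm{Int}\,M_x$ for all $x\in X$. *Jet-equivalence.* $F$ is *locally affinely jet-equivalent to the constant coefficient subequation* $\mathbf F$ if every point of $X$ has a coordinate neighbourhood $U$ on which there are smooth maps $g,h:U\to \mathrm{GL}((\mathbf R^n)^*)$, $L:U\to\mathrm{Hom}((\mathbf R^n)^*,\mathrm{Sym}^2((\mathbf R^n)^*))$ and $S:U\to\mathbf J^2$ such that, in the trivialization $J^2(U)=U\times\mathbf J^2$, the maps $\Psi_x(r,p,A)=(r,\,g_xp,\,h_xAh_x^t+L_x(p))+S_x$ satisfy $\Psi_x(F_x)=\mathbf F$ for all $x\in U$. *Harmonic functions.* For $\Omega\subset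 X$ open, an upper semicontinuous function $u:\Omega\to[-\infty,\infty)$ is *$F$-subharmonic* on $\Omega$ if $J^2_x\varphi\in F$ for every $x\in\Omega$ and every $C^2$ function $\varphi$ defined near $x$ with $u\le\varphi$ near $x$ and $u(x)=\varphi(x)$. It is *$F$-harmonic* on $\Omega$ if $u$ is $F$-subharmonic and $-u$ is $\widetilde F$-subharmonic on $\Omega$. *Boundary convexity.* Let $\Omega\subset X$ be open. A *defining function* for $\partial\Omega$ on an open set $U$ is a $C^\infty$ function $\rho$ on $U$ with $\partial\Omega\cap U=\{\rho=0\}$, $d\rho\ne0$ on $\partial\Omega\cap U$ and $\rho<0$ on $\Omega\cap U$; $\partial\Omega$ is *smooth* if each of its points has a neighbourhood with such a function. For $\lambda\in\mathbf R$ put $F_\lambda=\{J\in J^2_{\rm red}(X):(\lambda,J)\in F\}$, and let the *asymptotic interior* $\vec F_\lambda$ be the set of those $J\in J^2_{\rm red}(X)$ that have a neighbourhood $\mathcal N(J)$ in the total space of $J^2_{\rm red}(X)$ and a number $t_0>0$ such that $t\cdot\mathcal N(J)\subset F_\lambda$ for all $t\ge t_0$. The boundary $\partial\Omega$ is *strictly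 $F$-convex* if for all $x\in\partial\Omega$ and all $\lambda\in\mathbf R$ there is a defining function $\rho$ for $\partial\Omega$ on a neighbourhood $U$ of $x$ with $J^2_{{\rm red},y}\rho\in\vec F_\lambda$ for all $y\in U$. **Theorem.** Let $F$ be a subequation on $X$ with a monotonicity cone $M$. Suppose that (i) $F$ is locally affinely jet-equivalent to some constant coefficient subequation, and (ii) $X$ carries a $C^2$ strictly $M$-subharmonic function. Let $\Omega\subset X$ be an open set (not necessarily connected) with compact closure and smooth boundary such that $\partial\Omega$ is both strictly $F$-convex and strictly $\widetilde F$-convex. Then for every $\varphi\in C(\partial\Omega)$ there exists a unique $u\in C(\overline\Omega)$ such that $u|_\Omega$ is $F$-harmonic on $\Omega$ and $u|_{\partial\Omega}=\varphi$. -/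

import Mathlib

open scoped Manifold ContDiff Topology

namespace DirichletDuality

noncomputable section

/-- Euclidean space `ℝⁿ`. -/
abbrev Rn (n : ℕ) : Type := EuclideanSpace ℝ (Fin n)

/-! ### The constant fibre `𝐉² = ℝ × (ℝⁿ)* × Sym²((ℝⁿ)*)` -/

/-- Bilinear forms on `ℝⁿ`. -/
abbrev Bil (n : ℕ) : Type := Rn n →L[ℝ] Rn n →L[ℝ] ℝ

/-- The space of symmetric bilinear forms on `ℝⁿ`. -/
def symForms (n : ℕ) : Submodule ℝ (Bil n) where
  carrier := {B | ∀ v w, B v w = B w v}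
  add_mem' := by
    intro a b ha hb v w
    simp [ha v w, hb v w]
  zero_mem' := by
    intro v w
    simp
  smul_mem' := by
    intro c a ha v w
    simp [ha v w]

instance symFormsNormedAddCommGroup (n : ℕ) : NormedAddCommGroup (symForms n) :=
  @Submodule.normedAddCommGroup ℝ (Bil n) _ _ _ (symForms n)

instance symFormsNormedSpace (n : ℕ) : NormedSpace ℝ (symForms n) :=
  @Submodule.normedSpace ℝ ℝ _ _ _ (Bil n) _ _ _ _ (symForms n)

/-- Symmetric bilinear forms on `ℝⁿ`, with the norm of `Bil n`. -/
def SymForm (n : ℕ) : Type := symForms n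

instance (n : ℕ) : NormedAddCommGroup (SymForm n) := symFormsNormedAddCommGroup n

instance (n : ℕ) : NormedSpace ℝ (SymForm n) := symFormsNormedSpace n

/-- The bilinear form underlying a symmetric form. -/
def SymForm.bil {n : ℕ} (A : SymForm n) : Bil n := Subtype.val (p := (· ∈ symForms n)) A

/-- A symmetric bilinear form, as an element of `SymForm n`. -/
def SymForm.mk {n : ℕ} (B : Bil n) (h : ∀ v w, B v w = B w v) : SymForm n :=
  (⟨B, h⟩ : symForms n)

theorem SymForm.bil_symm {n : ℕ} (A : SymForm n) (v w : Rn n) : A.bil v w = A.bil w v :=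
  Subtype.property (p := (· ∈ symForms n)) A v w

/-- The symmetric part of a bilinear form; it is the form itself when that is symmetric, as for the
second derivative of a `C²` function. -/
def SymForm.ofBilin {n : ℕ} (B : Bil n) : SymForm n :=
  SymForm.mk ((2⁻¹ : ℝ) • (B + B.flip)) (by
    intro v w
    change (2⁻¹ : ℝ) * (B v w + B w v) = (2⁻¹ : ℝ) * (B w v + B v w)
    ring)

/-- `A ≥ 0`. -/
def SymForm.Nonneg {n : ℕ} (A : SymForm n) : Prop := ∀ v, 0 ≤ A.bil v v

/-- The form `(v, w) ↦ A (k v, k w)`. With `k = hᵗ` this is `h A hᵗ`. -/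
def SymForm.pull {n : ℕ} (k : Rn n →L[ℝ] Rn n) (A : SymForm n) : SymForm n :=
  SymForm.mk (A.bil.bilinearComp k k) (by
    intro v w
    simpa using A.bil_symm (k v) (k w))

/-- Reduced 2-jets `(p, A)` at a point of `ℝⁿ`. -/
abbrev RedJet (n : ℕ) : Type := (Rn n →L[ℝ] ℝ) × SymForm n

/-- 2-jets `(r, p, A)` at a point of `ℝⁿ`. -/
abbrev Jet (n : ℕ) : Type := ℝ × RedJet n

/-- The polynomial `v ↦ r + p v + A (v, v) / 2`, whose 2-jet at the origin is `(r, p, A)`. -/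
def Jet.poly {n : ℕ} (j : Jet n) (v : Rn n) : ℝ :=
  j.1 + j.2.1 v + 2⁻¹ * j.2.2.bil v v

/-- Conditions (P) and (N) for a set of jets at one point. -/
def PosNeg {n : ℕ} (F : Set (Jet n)) : Prop :=
  (∀ j ∈ F, ∀ A : SymForm n, A.Nonneg → j + (0, 0, A) ∈ F) ∧
  (∀ j ∈ F, ∀ r : ℝ, r ≤ 0 → j + (r, 0, 0) ∈ F)

/-- Constant coefficient subequations: proper (neither empty nor everything) closed sets
satisfying (P), (N) and (T). -/
structure IsConstSubequation {n : ℕ} (F : Set (Jet n)) : Prop where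
  nonempty : F.Nonempty
  ne_univ : F ≠ Set.univ
  isClosed : IsClosed F
  posNeg : PosNeg F
  closure_interior : F = closure (interior F)

/-! ### The 2-jet bundle of a manifold -/

/-- Points of the 2-jet bundle `J²(X)`. As for Mathlib's tangent bundle, the fibre over `x` is
identified with the model fibre through the preferred chart `chartAt _ x`. -/
structure JetBundle (n : ℕ) (X : Type*) where
  /-- the base point -/
  base : X
  /-- the coordinates of the jet in the preferred chart at the base point -/
  fib : Jet n

/-- Points of the reduced 2-jet bundle `J²_red(X)`, where `J²(X) = ℝ ⊕ J²_red(X)`. -/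
structure RedJetBundle (n : ℕ) (X : Type*) where
  /-- the base point -/
  base : X
  /-- the coordinates of the jet in the preferred chart at the base point -/
  fib : RedJet n

section Manifold

variable {n : ℕ} {X : Type*} [TopologicalSpace X] [ChartedSpace (Rn n) X]

/-- The 2-jet of `f` at `x`, an element of the fibre over `x`: value, first and second derivative
of `f` in the preferred chart at `x`. -/
def jetAt (n : ℕ) {X : Type*} [TopologicalSpace X] [ChartedSpace (Rn n) X]
    (x : X) (f : X → ℝ) : Jet n :=
  (f x,
   fderiv ℝ (f ∘ (chartAt (Rn n) x).symm) (chartAt (Rn n) x x),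
   SymForm.ofBilin
    (fderiv ℝ (fderiv ℝ (f ∘ (chartAt (Rn n) x).symm)) (chartAt (Rn n) x x)))

/-- The jet over the point with coordinates `y` in the chart `e` whose coordinates in the
trivialization of the jet bundle given by `e` are `j`: it is the 2-jet of the function that in the
chart `e` is the quadratic polynomial `j` centred at `y`. -/
def ofChart (e : OpenPartialHomeomorph X (Rn n)) (y : Rn n) (j : Jet n) : JetBundle n X :=
  ⟨e.symm y, jetAt n (e.symm y) (fun z => j.poly (e z - y))⟩

/-- The topology of `J²(X)`: a set is open iff it is open in the trivialization
`J²(U) = U × 𝐉²` of every smooth chart. -/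
instance : TopologicalSpace (JetBundle n X) :=
  ⨆ e : IsManifold.maximalAtlas 𝓘(ℝ, Rn n) ∞ X,
    TopologicalSpace.coinduced
      (fun q : e.1.target × Jet n => ofChart e.1 (q.1 : Rn n) q.2) inferInstance

/-- The topology of `J²_red(X)`, as the subbundle `{0} ⊕ J²_red(X)` of `J²(X)`. -/
instance : TopologicalSpace (RedJetBundle n X) :=
  TopologicalSpace.induced (fun J => (⟨J.base, (0, J.fib)⟩ : JetBundle n X)) inferInstance

/-! ### Subequations -/

/-- The fibre `F_x`. -/
def fibre (F : Set (JetBundle n X)) (x : X) : Set (Jet n) := {j | (⟨x, j⟩ : JetBundle n X) ∈ F}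

/-- Subequations on `X`. -/
structure IsSubequation (F : Set (JetBundle n X)) : Prop where
  isClosed : IsClosed F
  posNeg : ∀ x, PosNeg (fibre F x)
  closure_interior : F = closure (interior F)
  fibre_closure_interior : ∀ x, fibre F x = closure (interior (fibre F x))
  interior_fibre : ∀ x, interior (fibre F x) = fibre (interior F) x

/-- The dual subequation `F̃ = ∼(-Int F)`. -/
def dual (F : Set (JetBundle n X)) : Set (JetBundle n X) :=
  {J | (⟨J.base, -J.fib⟩ : JetBundle n X) ∉ interior F}

/-- `M` is a monotonicity cone for `F`: a subequation whose fibres are convex cones with vertex at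
the origin, with `F + M ⊆ F` (fibrewise sum). -/
structure IsMonotonicityCone (M F : Set (JetBundle n X)) : Prop where
  isSubequation : IsSubequation M
  convex : ∀ x, Convex ℝ (fibre M x)
  cone : ∀ x, ∀ j ∈ fibre M x, ∀ t : ℝ, 0 < t → t • j ∈ fibre M x
  add_mem : ∀ x, ∀ j ∈ fibre F x, ∀ m ∈ fibre M x, j + m ∈ fibre F x

/-- `ψ` is a `C²` strictly `M`-subharmonic function on `X`. -/
def IsStrictlySubharmonic (M : Set (JetBundle n X)) (ψ : X → ℝ) : Prop :=
  ContMDiff 𝓘(ℝ, Rn n) 𝓘(ℝ, ℝ) 2 ψ ∧ ∀ x, jetAt n x ψ ∈ interior (fibre M x)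

/-- A smooth family, over a set `V` of coordinates, of affine automorphisms of `𝐉²`,
`Ψ_y (r, p, A) = (r, g p, h A hᵗ + L p) + S`, with `k = hᵗ`. -/
structure AffineJetAut (n : ℕ) (V : Set (Rn n)) where
  /-- the bundle automorphism `g` of the cotangent bundle -/
  g : Rn n → ((Rn n →L[ℝ] ℝ) ≃L[ℝ] (Rn n →L[ℝ] ℝ))
  /-- the transpose of the bundle automorphism `h` of the cotangent bundle -/
  k : Rn n → (Rn n ≃L[ℝ] Rn n)
  /-- the section `L` of `Hom(T*X, Sym² T*X)` -/
  L : Rn n → ((Rn n →L[ℝ] ℝ) →L[ℝ] SymForm n)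
  /-- the translation -/
  S : Rn n → Jet n
  smooth_g : ContDiffOn ℝ ∞
    (fun y => (g y : (Rn n →L[ℝ] ℝ) →L[ℝ] (Rn n →L[ℝ] ℝ))) V
  smooth_k : ContDiffOn ℝ ∞ (fun y => (k y : Rn n →L[ℝ] Rn n)) V
  smooth_L : ContDiffOn ℝ ∞ L V
  smooth_S : ContDiffOn ℝ ∞ S V

/-- The action of an affine automorphism on the fibre over `y`. -/
def AffineJetAut.act {V : Set (Rn n)} (Ψ : AffineJetAut n V) (y : Rn n) (j : Jet n) : Jet n :=
  (j.1, Ψ.g y j.2.1, SymForm.pull (Ψ.k y : Rn n →L[ℝ] Rn n) j.2.2 + Ψ.L y j.2.1) + Ψ.S y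

/-- `F` is locally affinely jet-equivalent to the constant coefficient subequation `F₀`. -/
def LocallyAffinelyJetEquivalent (F : Set (JetBundle n X)) (F₀ : Set (Jet n)) : Prop :=
  ∀ x : X, ∃ e ∈ IsManifold.maximalAtlas 𝓘(ℝ, Rn n) ∞ X, x ∈ e.source ∧
    ∃ Ψ : AffineJetAut n e.target, ∀ y ∈ e.target,
      Ψ.act y '' {j | ofChart e y j ∈ F} = F₀

/-! ### Subharmonic and harmonic functions -/

/-- `F(Ω)`: upper semicontinuous functions `u : Ω → [-∞, ∞)` such that the 2-jet at `x` of every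
`C²` test function for `u` at `x` lies in `F`, for all `x ∈ Ω` (`Ω` is open). -/
def IsSubharmonic (F : Set (JetBundle n X)) (Ω : Set X) (u : Ω → EReal) : Prop :=
  UpperSemicontinuous u ∧ (∀ x, u x < ⊤) ∧
  ∀ (x : Ω) (φ : X → ℝ), ContMDiffAt 𝓘(ℝ, Rn n) 𝓘(ℝ, ℝ) 2 φ (x : X) →
    (∀ᶠ y : Ω in 𝓝 x, u y ≤ (φ y : EReal)) → u x = (φ x : EReal) →
    jetAt n (x : X) φ ∈ fibre F x

/-- `u` is `F`-harmonic on the open set `Ω`. -/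
def IsHarmonic (F : Set (JetBundle n X)) (Ω : Set X) (u : Ω → EReal) : Prop :=
  IsSubharmonic F Ω u ∧ IsSubharmonic (dual F) Ω (fun x => -u x)

/-- `u ∈ C(Ω̄)` solves the Dirichlet problem for `F`-harmonic functions on `Ω` with boundary
data `φ ∈ C(∂Ω)`. -/
def SolvesDirichlet (F : Set (JetBundle n X)) (Ω : Set X) (φ : C(frontier Ω, ℝ))
    (u : C(closure Ω, ℝ)) : Prop :=
  IsHarmonic F Ω (fun x => ((u ⟨x, subset_closure x.2⟩ : ℝ) : EReal)) ∧
  ∀ x : frontier Ω, u ⟨x, frontier_subset_closure x.2⟩ = φ x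

/-! ### Boundary convexity -/

/-- `ρ` is a (smooth) defining function for `∂Ω` on the open set `U`. -/
structure IsDefiningFunction (n : ℕ) {X : Type*} [TopologicalSpace X] [ChartedSpace (Rn n) X]
    (Ω U : Set X) (ρ : X → ℝ) : Prop where
  isOpen : IsOpen U
  smooth : ContMDiffOn 𝓘(ℝ, Rn n) 𝓘(ℝ, ℝ) ∞ ρ U
  frontier_iff : ∀ x ∈ U, x ∈ frontier Ω ↔ ρ x = 0
  mfderiv_ne_zero : ∀ x ∈ U, x ∈ frontier Ω → mfderiv 𝓘(ℝ, Rn n) 𝓘(ℝ, ℝ) ρ x ≠ 0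
  neg : ∀ x ∈ U, x ∈ Ω → ρ x < 0

/-- The boundary of `Ω` is smooth. -/
def HasSmoothBoundary (n : ℕ) {X : Type*} [TopologicalSpace X] [ChartedSpace (Rn n) X]
    (Ω : Set X) : Prop :=
  ∀ x ∈ frontier Ω, ∃ (U : Set X) (ρ : X → ℝ), x ∈ U ∧ IsDefiningFunction n Ω U ρ

/-- The slice `F_λ ⊆ J²_red(X)` obtained by fixing the value of the jet to be `l`. -/
def slice (F : Set (JetBundle n X)) (l : ℝ) : Set (RedJetBundle n X) :=
  {J | (⟨J.base, (l, J.fib)⟩ : JetBundle n X) ∈ F}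

/-- The asymptotic interior of `G ⊆ J²_red(X)`. -/
def asymptoticInterior (G : Set (RedJetBundle n X)) : Set (RedJetBundle n X) :=
  {J | ∃ N ∈ 𝓝 J, ∃ t₀ : ℝ, 0 < t₀ ∧ ∀ t : ℝ, t₀ ≤ t →
    ∀ K ∈ N, (⟨K.base, t • K.fib⟩ : RedJetBundle n X) ∈ G}

/-- `∂Ω` is strictly `G`-convex at `x`, for `G ⊆ J²_red(X)`. -/
def StrictlyConvexAtRed (G : Set (RedJetBundle n X)) (Ω : Set X) (x : X) : Prop :=
  ∃ (U : Set X) (ρ : X → ℝ), x ∈ U ∧ IsDefiningFunction n Ω U ρ ∧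
    ∀ y ∈ U, (⟨y, (jetAt n y ρ).2⟩ : RedJetBundle n X) ∈ asymptoticInterior G

/-- `∂Ω` is strictly `F`-convex at each of its points. -/
def StrictlyConvexBoundary (F : Set (JetBundle n X)) (Ω : Set X) : Prop :=
  ∀ x ∈ frontier Ω, ∀ l : ℝ, StrictlyConvexAtRed (slice F l) Ω x

end Manifold

end

end DirichletDuality

/-! Uniqueness and the decisive step of existence are one comparison statement: if `u` is a
subsolution for `F`, `v` a subsolution for the dual, and `u + v ≤ 0` on `∂Ω`, then `u + v ≤ 0` on
the closure of `Ω`.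

Suppose `u + v` is positive somewhere. Adding a small multiple of `ψ`, and then a small negative
quadratic in a chart, produces a strict local maximum with positive value. Because `F + M ⊆ F` and
the jet of `ψ` is interior to `M`, the upper jets of the modified `u` lie a fixed distance inside
`F`. Doubling the variables and the theorem on sums give upper jets of the two summands at nearby
points `x`, `y`, with almost opposite gradients and Hessians whose sum is almost nonpositive. The
jet equivalence carries both fibres to the same set `F₀`; its variation between `x` and `y` costs
errors governed by `‖x - y‖ * ‖p‖` and `σ * ‖x - y‖ ^ 2`, both small. Hence the negated jet of `v`
is carried to a jet interior to `F₀`, plus a nonnegative Hessian and a nonpositive value; so it is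
interior, against the definition of the dual (`local_comparison`, `no_positive_local_max`,
`comparison`).

The theorem on sums comes from sup-convolution and Jensen's lemma. For the latter, the gradient of a
concave majorant is Lipschitz and maps the contact set over a ball. Rademacher's theorem, applied to
this gradient and to the distance from the contact set, gives a second order expansion at a contact
point; this takes the place of Alexandrov's theorem.

Existence is Perron's method. Large multiples of `ψ`, lowered by constants, are subsolutions for `F`
and for its dual. Let `U` be the upper envelope of the supremum of all subsolutions below `φ` on
`∂Ω`, and `V` that of `-U`. Barriers for the dual give `U ≤ φ` on `∂Ω`, barriers for `F` give `V ≤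
-φ`, and a bump argument shows that `V` is a subsolution for the dual. Comparison yields `U + V ≤
0`, while `-U ≤ V` by construction; so `U = -V` is continuous and solves the problem. -/

open scoped Manifold ContDiff Topology

namespace DirichletDuality

noncomputable section

open Set Filter MeasureTheory Asymptotics
open scoped RealInnerProductSpace

/-! ### Concave majorants and Jensen's lemma -/

section Jensen

variable {H : Type*} [NormedAddCommGroup H] [InnerProductSpace ℝ H]

/-- A continuous function that is bounded above by a negative quadratic has a concave majorant,
the smallest one with slopes in a given ball, which inherits the lower bound on second
differences. -/
theorem exists_concave_majorant [FiniteDimensional ℝ H] {g : H → ℝ} (hg : Continuous g)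
    {C η δ : ℝ} (hη : 0 < η) (hδ : 0 ≤ δ)
    (hC : ∀ y h, 2 * g y - C * ‖h‖ ^ 2 ≤ g (y + h) + g (y - h))
    (hmax : ∀ y, g y ≤ -(η * ‖y‖ ^ 2)) :
    ∃ (Γ : H → ℝ) (G : H → H), (∀ x, g x ≤ Γ x) ∧ (∀ x y, Γ y ≤ Γ x + ⟪G x, y - x⟫) ∧
      (∀ x h, 2 * Γ x - C * ‖h‖ ^ 2 ≤ Γ (x + h) + Γ (x - h)) ∧ (∀ x, ‖G x‖ ≤ δ) ∧
      (∀ p, ‖p‖ ≤ δ → ∃ x, Γ x = g x ∧ ∀ y, Γ y ≤ Γ x + ⟪p, y - x⟫) := by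
  -- `c p` is the least intercept of an affine function of slope `p` above `g`. The majorant is the
  -- lower envelope of these affine functions over `‖p‖ ≤ δ`, and an optimal slope at `x` is a
  -- supergradient there.
  set c : H → ℝ := fun p => ⨆ y, (g y - ⟪p, y⟫) with hc
  have hbdd : ∀ p, BddAbove (range fun y => g y - ⟪p, y⟫) := by
    intro p
    refine ⟨‖p‖ ^ 2 / (4 * η), ?_⟩
    rintro _ ⟨y, rfl⟩
    have h1 := hmax y
    have h2 := neg_le_of_abs_le (abs_real_inner_le_norm p y)
    rw [le_div_iff₀ (by positivity)]
    nlinarith [sq_nonneg (‖p‖ - 2 * η * ‖y‖)]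
  have hle : ∀ p y, g y ≤ ⟪p, y⟫ + c p := fun p y => by
    have := le_ciSup (hbdd p) y
    simp only [hc]
    linarith
  have hcle : ∀ p a, (∀ y, g y ≤ ⟪p, y⟫ + a) → c p ≤ a := fun p a h =>
    ciSup_le fun y => by linarith [h y]
  have hlsc : LowerSemicontinuous c :=
    lowerSemicontinuous_ciSup hbdd fun y =>
      (continuous_const.sub (continuous_id.inner continuous_const)).lowerSemicontinuous
  have hex : ∀ x : H, ∃ p ∈ Metric.closedBall (0 : H) δ,
      ∀ q ∈ Metric.closedBall (0 : H) δ, ⟪p, x⟫ + c p ≤ ⟪q, x⟫ + c q := by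
    intro x
    have hl : LowerSemicontinuous fun p : H => ⟪p, x⟫ + c p :=
      (continuous_id.inner continuous_const).lowerSemicontinuous.add hlsc
    obtain ⟨p, hp, hpm⟩ := LowerSemicontinuousOn.exists_isMinOn
      (Metric.nonempty_closedBall.2 hδ) (isCompact_closedBall (0 : H) δ)
      (hl.lowerSemicontinuousOn _)
    exact ⟨p, hp, fun q hq => hpm hq⟩
  choose G hGm hG using hex
  refine ⟨fun x => ⟪G x, x⟫ + c (G x), G, fun x => hle _ _, ?_, ?_, ?_, ?_⟩
  · intro x y
    have := hG y (G x) (hGm x)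
    rw [inner_sub_right]
    linarith
  · intro x h
    set p := G (x + h)
    set q := G (x - h)
    -- The average of the optimal slopes at `x ± h` competes at `x`; the second difference bound for
    -- `g` controls its intercept.
    have hm : (2⁻¹ : ℝ) • (p + q) ∈ Metric.closedBall (0 : H) δ := by
      have h1 : ‖p‖ ≤ δ := by simpa using hGm (x + h)
      have h2 : ‖q‖ ≤ δ := by simpa using hGm (x - h)
      rw [mem_closedBall_zero_iff, norm_smul]
      have := norm_add_le p q
      norm_num
      linarith
    have h1 := hG x _ hm
    have h2 : c ((2⁻¹ : ℝ) • (p + q)) ≤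
        2⁻¹ * (c p + c q + ⟪p, h⟫ - ⟪q, h⟫ + C * ‖h‖ ^ 2) := by
      apply hcle
      intro y
      have h3 := hC y h
      have h4 := hle p (y + h)
      have h5 := hle q (y - h)
      rw [inner_add_right] at h4
      rw [inner_sub_right] at h5
      rw [inner_smul_left, inner_add_left]
      simp only [conj_trivial]
      linarith
    rw [inner_smul_left, inner_add_left] at h1
    simp only [conj_trivial] at h1
    change 2 * (⟪G x, x⟫ + c (G x)) - C * ‖h‖ ^ 2 ≤
      (⟪p, x + h⟫ + c p) + (⟪q, x - h⟫ + c q)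
    rw [inner_add_right, inner_sub_right]
    linarith
  · intro x
    simpa using hGm x
  · intro p hp
    -- By coercivity `g - ⟪p, ·⟫` has a maximum point, where the optimal affine function of slope
    -- `p` touches both `g` and the majorant.
    have hcoc : Tendsto (fun y => g y - ⟪p, y⟫) (cocompact H) atBot := by
      refine tendsto_atBot_mono (g := fun y => g y - ⟪p, y⟫)
        (f := fun y => -(‖y‖ * (η * ‖y‖ - δ))) ?_ ?_
      · intro y
        have h1 := hmax y
        have h2 := neg_le_of_abs_le (abs_real_inner_le_norm p y)
        have := mul_le_mul_of_nonneg_right hp (norm_nonneg y)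
        nlinarith
      · refine tendsto_neg_atTop_atBot.comp ?_
        have hn := tendsto_norm_cocompact_atTop (E := H)
        exact hn.atTop_mul_atTop₀
          (tendsto_atTop_add_const_right _ _ (hn.const_mul_atTop hη))
    obtain ⟨x, hx⟩ := (hg.sub (continuous_const.inner continuous_id)).exists_forall_ge hcoc
    have hcx : c p = g x - ⟪p, x⟫ :=
      le_antisymm (hcle _ _ fun y => by have := hx y; simp only [id, Pi.sub_apply] at this; linarith)
        (by linarith [hle p x])
    have h1 := hG x p (by simpa using hp)
    have h2 := hle (G x) x
    have h3 : ⟪G x, x⟫ + c (G x) = g x := by linarith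
    refine ⟨x, h3, fun y => ?_⟩
    have := hG y p (by simpa using hp)
    rw [inner_sub_right]
    linarith

/-- Supergradients of a function with second differences bounded below vary in a Lipschitz
way. -/
theorem norm_supergradient_sub_le {Γ : H → ℝ} {C : ℝ} (hC0 : 0 < C)
    (hC : ∀ x h, 2 * Γ x - C * ‖h‖ ^ 2 ≤ Γ (x + h) + Γ (x - h)) {x₁ x₂ p₁ p₂ : H}
    (h₁ : ∀ y, Γ y ≤ Γ x₁ + ⟪p₁, y - x₁⟫) (h₂ : ∀ y, Γ y ≤ Γ x₂ + ⟪p₂, y - x₂⟫) :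
    ‖p₁ - p₂‖ ≤ 4 * C * ‖x₁ - x₂‖ := by
  set q := p₂ - p₁ with hq
  -- Below `Γ` lies a concave paraboloid touching at `x₂` with slope `p₂`, above it the supporting
  -- affine function at `x₁`.
  have key : ∀ y, ⟪q, y - x₁⟫ ≤ C * ‖y - x₂‖ ^ 2 := by
    intro y
    have a := hC x₂ (y - x₂)
    have b := h₂ (x₂ - (y - x₂))
    have c := h₁ y
    have d := h₂ x₁
    rw [add_sub_cancel] at a
    rw [sub_sub_cancel_left, inner_neg_right] at b
    have e : ⟪p₂, y - x₂⟫ = ⟪p₂, y - x₁⟫ + ⟪p₂, x₁ - x₂⟫ := by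
      rw [← inner_add_right]; congr 1; abel
    rw [hq, inner_sub_left]
    linarith
  -- The displacement `q / (4C)` balances the linear left side of `key` against its quadratic right
  -- side.
  have h := key (x₁ + (1 / (4 * C)) • q)
  rw [add_sub_cancel_left, inner_smul_right, real_inner_self_eq_norm_sq] at h
  have hn : ‖x₁ + (1 / (4 * C)) • q - x₂‖ ≤ ‖x₁ - x₂‖ + 1 / (4 * C) * ‖q‖ := by
    have : x₁ + (1 / (4 * C)) • q - x₂ = (x₁ - x₂) + (1 / (4 * C)) • q := by abel
    rw [this]
    refine (norm_add_le _ _).trans (add_le_add le_rfl ?_)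
    rw [norm_smul, Real.norm_of_nonneg (by positivity)]
  have h' : 1 / (4 * C) * ‖q‖ ^ 2 ≤ C * (‖x₁ - x₂‖ + 1 / (4 * C) * ‖q‖) ^ 2 :=
    h.trans (by gcongr)
  rw [norm_sub_rev p₁ p₂, ← hq]
  have h3 : (4 * C) * ‖q‖ ^ 2 ≤ C * (4 * C * ‖x₁ - x₂‖ + ‖q‖) ^ 2 := by
    have e1 : (4 * C) * ‖q‖ ^ 2 = (4 * C) ^ 2 * (1 / (4 * C) * ‖q‖ ^ 2) := by field_simp
    have e2 : C * (4 * C * ‖x₁ - x₂‖ + ‖q‖) ^ 2 =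
        (4 * C) ^ 2 * (C * (‖x₁ - x₂‖ + 1 / (4 * C) * ‖q‖) ^ 2) := by field_simp
    rw [e1, e2]
    gcongr
  have h4 : (2 * ‖q‖) ^ 2 ≤ (4 * C * ‖x₁ - x₂‖ + ‖q‖) ^ 2 := by
    have : C * ((2 * ‖q‖) ^ 2) ≤ C * (4 * C * ‖x₁ - x₂‖ + ‖q‖) ^ 2 := by linarith
    exact le_of_mul_le_mul_left this hC0
  have := abs_le_of_sq_le_sq h4 (by positivity)
  linarith [le_abs_self (2 * ‖q‖)]

/-- Second order Taylor expansion of a function whose gradient is differentiable at a point. -/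
theorem taylor_two_isLittleO {E : Type*} [NormedAddCommGroup E] [NormedSpace ℝ E] {f : E → ℝ}
    {f' : E → E →L[ℝ] ℝ} {f'' : E →L[ℝ] E →L[ℝ] ℝ} {x : E}
    (hf : ∀ᶠ y in 𝓝 x, HasFDerivAt f (f' y) y) (hf' : HasFDerivAt f' f'' x) :
    (fun h => f (x + h) - f x - f' x h - 2⁻¹ * f'' h h) =o[𝓝 0] fun h => ‖h‖ ^ 2 := by
  have hsymm : ∀ v w, f'' v w = f'' w v := fun v w =>
    second_derivative_symmetric_of_eventually hf hf' v w
  rw [isLittleO_iff]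
  intro ε hε
  have h1 := (hasFDerivAt_iff_isLittleO_nhds_zero.1 hf').def hε
  have h2 : ∀ᶠ h in 𝓝 (0 : E), HasFDerivAt f (f' (x + h)) (x + h) := by
    have : Tendsto (fun h => x + h) (𝓝 0) (𝓝 x) := by
      simpa using (continuous_const.add continuous_id).tendsto (0 : E) (f := fun h => x + h)
    exact this.eventually hf
  obtain ⟨r, hr, hball⟩ := Metric.eventually_nhds_iff_ball.1 (h1.and h2)
  refine Metric.eventually_nhds_iff_ball.2 ⟨r, hr, fun h hh => ?_⟩
  rw [mem_ball_zero_iff] at hh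
  -- Mean value inequality for the Taylor remainder: on the ball of radius `‖h‖` its derivative is
  -- at most `ε * ‖h‖`.
  have hd : ∀ k ∈ Metric.closedBall (0 : E) ‖h‖,
      HasFDerivWithinAt (fun h => f (x + h) - f x - f' x h - 2⁻¹ * f'' h h)
        (f' (x + k) - f' x - f'' k) (Metric.closedBall (0 : E) ‖h‖) k := by
    intro k hk
    rw [mem_closedBall_zero_iff] at hk
    have hk' := (hball k (by rw [mem_ball_zero_iff]; linarith)).2
    have a : HasFDerivAt (fun h => f (x + h)) (f' (x + k)) k := by
      simpa using (hasFDerivAt_comp_add_left x).2 hk'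
    have b : HasFDerivAt (fun h => f'' h h) (f''.flip k + f'' k) k := by
      have := f''.hasFDerivAt (x := k) |>.clm_apply (hasFDerivAt_id k)
      refine this.congr_fderiv ?_
      ext v
      simp [add_comm]
    have c := ((a.sub_const (f x)).sub (f' x).hasFDerivAt).sub (b.const_mul 2⁻¹)
    refine (c.congr_fderiv ?_).hasFDerivWithinAt
    ext v
    simp only [_root_.sub_apply, _root_.smul_apply,
      _root_.add_apply, ContinuousLinearMap.flip_apply, smul_eq_mul, hsymm v k]
    ring
  have hb : ∀ k ∈ Metric.closedBall (0 : E) ‖h‖, ‖f' (x + k) - f' x - f'' k‖ ≤ ε * ‖h‖ := by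
    intro k hk
    rw [mem_closedBall_zero_iff] at hk
    refine (hball k (by rw [mem_ball_zero_iff]; linarith)).1.trans ?_
    gcongr
  have := (convex_closedBall (0 : E) ‖h‖).norm_image_sub_le_of_norm_hasFDerivWithin_le hd hb
    (Metric.mem_closedBall_self (norm_nonneg h)) (by simp : h ∈ Metric.closedBall (0 : E) ‖h‖)
  simp only [add_zero, sub_self, map_zero, mul_zero, sub_zero] at this
  rw [norm_pow, norm_norm]
  calc _ ≤ _ := this
    _ = _ := by ring

/-- The image of a null set under a Lipschitz self-map of a finite-dimensional space is not a
neighbourhood. -/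
theorem exists_mem_notMem_null [FiniteDimensional ℝ H] [MeasurableSpace H] [BorelSpace H]
    {G : H → H} {K : NNReal} (hG : LipschitzWith K G) {E Z : Set H} {δ : ℝ} (hδ : 0 < δ)
    (hE : Metric.ball 0 δ ⊆ G '' E) (hZ : Measure.addHaar Z = 0) : ∃ x ∈ E, x ∉ Z := by
  by_contra! hcon
  -- If `E ⊆ Z`, then a ball lies in `G '' Z`. Hausdorff measure in the dimension of `H` vanishes on
  -- Haar null sets and on their Lipschitz images, but not on balls.
  have hac : (Measure.hausdorffMeasure (Module.finrank ℝ H) : Measure H) ≪ Measure.addHaar :=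
    Measure.absolutelyContinuous_isAddHaarMeasure _ _
  have h1 := hG.hausdorffMeasure_image_le (d := (Module.finrank ℝ H : ℝ)) (by positivity) Z
  rw [hac hZ, mul_zero, nonpos_iff_eq_zero] at h1
  have h2 := measure_mono_null (hE.trans (image_mono hcon)) h1
  exact (Metric.measure_ball_pos (Measure.hausdorffMeasure (Module.finrank ℝ H) : Measure H)
    (0 : H) hδ).ne' h2

/-- **Jensen's lemma.** A function with second differences bounded below that has a strict
maximum at the origin has points of second order differentiability near the origin with small
gradient and nonpositive Hessian. -/
theorem exists_taylor_near_max [FiniteDimensional ℝ H] {g : H → ℝ} (hg : Continuous g)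
    {C η s : ℝ} (hC0 : 0 < C) (hη : 0 < η) (hs : 0 < s)
    (hC : ∀ y h, 2 * g y - C * ‖h‖ ^ 2 ≤ g (y + h) + g (y - h))
    (hmax : ∀ y, g y ≤ -(η * ‖y‖ ^ 2)) (h0 : g 0 = 0) :
    ∃ (x p : H) (B : H →L[ℝ] H →L[ℝ] ℝ), ‖x‖ ≤ s ∧ ‖p‖ ≤ s ∧ -s ≤ g x ∧ (∀ v, B v v ≤ 0) ∧
      (fun h => g (x + h) - g x - ⟪p, h⟫ - 2⁻¹ * B h h) =o[𝓝 0] fun h => ‖h‖ ^ 2 := by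
  borelize H
  -- The bound `s` serves the gradient, `η * s` the location of the point, and `1` the loss in the
  -- value of `g`.
  set δ := min s (min (η * s) 1) with hδ
  have hδ0 : 0 < δ := by positivity
  have hδs : δ ≤ s := min_le_left _ _
  have hδη : δ ≤ η * s := (min_le_right _ _).trans (min_le_left _ _)
  have hδ1 : δ ≤ 1 := (min_le_right _ _).trans (min_le_right _ _)
  obtain ⟨Γ, G, hgΓ, hsup, hCΓ, hGδ, hcont⟩ :=
    exists_concave_majorant hg hη hδ0.le hC hmax
  set E := {x | Γ x = g x} with hE
  have hGlip : LipschitzWith (Real.toNNReal (4 * C)) G := by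
    refine LipschitzWith.of_dist_le_mul fun x y => ?_
    rw [dist_eq_norm, dist_eq_norm, Real.coe_toNNReal _ (by positivity)]
    exact norm_supergradient_sub_le hC0 hCΓ (hsup x) (hsup y)
  -- The Lipschitz estimate at coinciding points makes the supergradient unique, so a slope touching
  -- at `x` is `G x`.
  have himg : Metric.ball 0 δ ⊆ G '' E := by
    intro p hp
    obtain ⟨x, hx, hxp⟩ := hcont p (by simpa using (mem_ball_zero_iff.1 hp).le)
    refine ⟨x, hx, ?_⟩
    have := norm_supergradient_sub_le hC0 hCΓ (hsup x) hxp
    rw [sub_self, norm_zero, mul_zero] at this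
    exact sub_eq_zero.1 (norm_le_zero_iff.1 this)
  have hdlip : LipschitzWith 1 fun x => Metric.infDist x E := Metric.lipschitz_infDist_pt E
  -- Differentiability of `G` gives a second order expansion of `Γ`; differentiability of the
  -- distance to `E` serves to pass it on to `g`.
  obtain ⟨x, hxE, hxZ⟩ := exists_mem_notMem_null hGlip
    (Z := {x | ¬ (DifferentiableAt ℝ G x ∧ DifferentiableAt ℝ (fun x => Metric.infDist x E) x)})
    hδ0 himg ((hGlip.ae_differentiableAt (μ := Measure.addHaar)).and hdlip.ae_differentiableAt)
  simp only [mem_ofPred_eq, not_not] at hxZ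
  obtain ⟨hGx, hdx⟩ := hxZ
  have hxE' : Γ x = g x := hxE
  have hlow : ∀ x h, Γ x + ⟪G x, h⟫ - C * ‖h‖ ^ 2 ≤ Γ (x + h) := by
    intro x h
    have a := hCΓ x h
    have b := hsup x (x - h)
    rw [sub_sub_cancel_left, inner_neg_right] at b
    linarith
  have hderiv : ∀ y, HasFDerivAt Γ (innerSL ℝ (G y)) y := by
    intro y
    rw [hasFDerivAt_iff_isLittleO_nhds_zero]
    refine (IsBigO.of_bound C (Eventually.of_forall fun h => ?_)).trans_isLittleO
      (isLittleO_norm_pow_id one_lt_two)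
    have a := hlow y h
    have b := hsup y (y + h)
    rw [add_sub_cancel_left] at b
    have : 0 ≤ C * ‖h‖ ^ 2 := by positivity
    rw [norm_pow, norm_norm, Real.norm_eq_abs, abs_le]
    simp only [innerSL_apply_apply]
    constructor <;> linarith
  have hT := taylor_two_isLittleO (Eventually.of_forall hderiv)
    ((innerSL ℝ (E := H)).hasFDerivAt.comp x hGx.hasFDerivAt)
  set B : H →L[ℝ] H →L[ℝ] ℝ := (innerSL ℝ (E := H)).comp (fderiv ℝ G x) with hB
  -- Reflect `y` in a contact point `z`: apply the second difference bound of `g` at `z` and the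
  -- supergradient inequality at both `y` and its reflection.
  have hgap : ∀ y, Γ y - g y ≤ C * Metric.infDist y E ^ 2 := by
    intro y
    have key : ∀ z ∈ E, Γ y - g y ≤ C * dist y z ^ 2 := by
      intro z hz
      have hz' : Γ z = g z := hz
      have a := hC z (y - z)
      have b := hgΓ (z - (y - z))
      have c := hsup z (z - (y - z))
      have d := hsup z y
      rw [sub_sub_cancel_left, inner_neg_right] at c
      rw [add_sub_cancel] at a
      rw [dist_eq_norm]
      linarith
    have h1 : Real.sqrt ((Γ y - g y) / C) ≤ Metric.infDist y E := by
      refine (Metric.le_infDist ⟨x, hxE⟩).2 fun z hz => ?_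
      refine Real.sqrt_le_iff.2 ⟨dist_nonneg, ?_⟩
      rw [div_le_iff₀ hC0, mul_comm]
      exact key z hz
    have h2 := Real.sqrt_le_iff.1 h1 |>.2
    rw [div_le_iff₀ hC0] at h2
    linarith
  have hd0 : Metric.infDist x E = 0 := Metric.infDist_zero_of_mem hxE
  -- The distance is minimal at the contact point, so its derivative vanishes there; by `hgap` the
  -- functions `Γ` and `g` then agree to second order.
  have hdo : (fun h => Metric.infDist (x + h) E) =o[𝓝 0] fun h => h := by
    have hmin : IsLocalMin (fun x => Metric.infDist x E) x :=
      Eventually.of_forall fun y => by simp only [hd0]; exact Metric.infDist_nonneg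
    have := hdx.hasFDerivAt
    rw [hmin.fderiv_eq_zero, hasFDerivAt_iff_isLittleO_nhds_zero] at this
    simpa [hd0] using this
  have hgo : (fun h => Γ (x + h) - g (x + h)) =o[𝓝 0] fun h => ‖h‖ ^ 2 := by
    refine IsBigO.trans_isLittleO (g := fun h => Metric.infDist (x + h) E ^ 2)
      (IsBigO.of_bound C (Eventually.of_forall fun h => ?_)) ?_
    · rw [Real.norm_of_nonneg (sub_nonneg.2 (hgΓ _)), Real.norm_of_nonneg (by positivity)]
      exact hgap _
    · exact hdo.norm_right.pow two_pos
  have hTg : (fun h => g (x + h) - g x - ⟪G x, h⟫ - 2⁻¹ * B h h) =o[𝓝 0] fun h => ‖h‖ ^ 2 := by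
    refine (hT.sub hgo).congr_left fun h => ?_
    rw [hxE', innerSL_apply_apply]
    ring
  -- The supporting plane at `x` lies above `g 0 = 0`. With the quadratic upper bound on `g` this
  -- confines `x` and bounds `g x` from below.
  have hg0 : 0 ≤ g x - ⟪G x, x⟫ := by
    have a := hsup x 0
    have b := hgΓ 0
    rw [zero_sub, inner_neg_right] at a
    linarith
  have hin : ⟪G x, x⟫ ≤ ‖G x‖ * ‖x‖ := real_inner_le_norm _ _
  have hin' := neg_le_of_abs_le (abs_real_inner_le_norm (G x) x)
  have hGx' := mul_le_mul_of_nonneg_right (hGδ x) (norm_nonneg x)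
  have hxs : ‖x‖ ≤ s := by
    have a := hmax x
    have hneg : -⟪G x, x⟫ ≤ ‖G x‖ * ‖x‖ := by linarith
    have hx' : η * ‖x‖ ^ 2 ≤ η * s * ‖x‖ := by
      have := mul_le_mul_of_nonneg_right hδη (norm_nonneg x)
      linarith
    by_contra! hlt
    have hpos : 0 < ‖x‖ := hs.trans hlt
    have : η * ‖x‖ * s < η * ‖x‖ * ‖x‖ := by gcongr
    nlinarith
  refine ⟨x, G x, B, hxs, (hGδ x).trans hδs, ?_, ?_, hTg⟩
  · have : δ * ‖x‖ ≤ 1 * s := by gcongr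
    linarith
  · intro v
    -- `Γ` lies below its tangent plane at `x`, so its second order term cannot be positive in any
    -- direction.
    by_contra! hpos
    have hv : v ≠ 0 := by rintro rfl; simp at hpos
    have hv' : 0 < ‖v‖ := norm_pos_iff.2 hv
    have hlim : Tendsto (fun t : ℝ => t • v) (𝓝[>] 0) (𝓝 0) := by
      refine tendsto_nhdsWithin_of_tendsto_nhds ?_
      simpa using (continuous_id.smul continuous_const).tendsto (0 : ℝ) (f := fun t : ℝ => t • v)
    have hev := (hT.comp_tendsto hlim).def (c := B v v / (4 * ‖v‖ ^ 2)) (by positivity)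
    obtain ⟨t, ht, ht0⟩ := (hev.and self_mem_nhdsWithin).exists
    have ht0 : 0 < t := ht0
    have a := hsup x (x + t • v)
    rw [add_sub_cancel_left] at a
    simp only [Function.comp_apply, innerSL_apply_apply, map_smul, _root_.smul_apply,
      smul_eq_mul, norm_smul, norm_pow, norm_mul, norm_norm] at ht
    rw [Real.norm_of_nonneg ht0.le] at ht
    have e : B v v / (4 * ‖v‖ ^ 2) * (t * ‖v‖) ^ 2 = t ^ 2 * (B v v) / 4 := by field_simp
    rw [e] at ht
    have hB' := (abs_le.1 ht).1
    have : 0 < t ^ 2 * B v v := by positivity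
    nlinarith

end Jensen

/-! ### Sup-convolution and the theorem on sums -/

section Sums

variable {V : Type*} [NormedAddCommGroup V] [InnerProductSpace ℝ V]

/-- The pair `(p, A)` is an upper second order jet of `u` at `y`. -/
def IsUpperJet (u : V → ℝ) (y : V) (p : V →L[ℝ] ℝ) (A : V →L[ℝ] V →L[ℝ] ℝ) : Prop :=
  ∀ ε > 0, ∀ᶠ h in 𝓝 (0 : V), u (y + h) ≤ u y + p h + 2⁻¹ * A h h + ε * ‖h‖ ^ 2

/-- `f'` is the sup-convolution of `f|K` with `a ‖·‖²`, attained at the points `π x`. -/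
structure IsSupConv {V : Type*} [NormedAddCommGroup V] (K : Set V) (a : ℝ) (f f' : V → ℝ) (π : V → V) : Prop where
  mem : ∀ x, π x ∈ K
  eq : ∀ x, f' x = f (π x) - a * ‖x - π x‖ ^ 2
  le : ∀ x, ∀ z ∈ K, f z - a * ‖x - z‖ ^ 2 ≤ f' x

theorem exists_isSupConv {V : Type*} [NormedAddCommGroup V] {K : Set V} (hK : IsCompact K) (hne : K.Nonempty) {f : V → ℝ}
    (hf : UpperSemicontinuousOn f K) (a : ℝ) : ∃ f' π, IsSupConv K a f f' π := by
  have h : ∀ x : V, ∃ y ∈ K, ∀ z ∈ K, f z - a * ‖x - z‖ ^ 2 ≤ f y - a * ‖x - y‖ ^ 2 := by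
    intro x
    have hc : UpperSemicontinuousOn (fun z => f z + -(a * ‖x - z‖ ^ 2)) K :=
      hf.add ((by fun_prop : Continuous fun z => -(a * ‖x - z‖ ^ 2)).upperSemicontinuous
        |>.upperSemicontinuousOn _)
    obtain ⟨y, hy, hmax⟩ := UpperSemicontinuousOn.exists_isMaxOn hne hK hc
    exact ⟨y, hy, fun z hz => by simpa [sub_eq_add_neg] using hmax hz⟩
  choose π hπ hmax using h
  exact ⟨fun x => f (π x) - a * ‖x - π x‖ ^ 2, π, hπ, fun _ => rfl, hmax⟩

namespace IsSupConv

variable {K : Set V} {a : ℝ} {f f' : V → ℝ} {π : V → V}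

/-- Adding `a * ‖x‖ ^ 2` leaves a supremum of affine functions whose slopes `2 a z`, `z ∈ K`, are
bounded, hence a Lipschitz function. -/
theorem continuous (h : IsSupConv K a f f' π) (hK : IsCompact K) (ha : 0 ≤ a) :
    Continuous f' := by
  obtain ⟨R, hR⟩ := hK.isBounded.exists_norm_le
  have hR0 : 0 ≤ R := (norm_nonneg _).trans (hR _ (h.mem 0))
  have hlip : LipschitzWith (Real.toNNReal (2 * a * R)) fun x => f' x + a * ‖x‖ ^ 2 := by
    refine LipschitzWith.of_le_add_mul _ fun x y => ?_
    rw [Real.coe_toNNReal _ (by positivity), dist_eq_norm]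
    have h1 := h.le y _ (h.mem x)
    have h2 := h.eq x
    rw [norm_sub_sq_real] at h1 h2
    have h3 : ⟪x - y, π x⟫ ≤ ‖x - y‖ * R :=
      (real_inner_le_norm _ _).trans (by gcongr; exact hR _ (h.mem x))
    rw [inner_sub_left] at h3
    have h4 := mul_le_mul_of_nonneg_left h3 (by positivity : 0 ≤ 2 * a)
    linarith
  have : Continuous fun x => (f' x + a * ‖x‖ ^ 2) - a * ‖x‖ ^ 2 :=
    hlip.continuous.sub (by fun_prop)
  simpa using this

/-- The paraboloid centred at `π x` lies below `f'` and touches it at `x`; its second difference is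
exactly `-2 * a * ‖k‖ ^ 2`. -/
theorem second_difference (h : IsSupConv K a f f' π) (x k : V) :
    2 * f' x - 2 * a * ‖k‖ ^ 2 ≤ f' (x + k) + f' (x - k) := by
  have h1 := h.le (x + k) _ (h.mem x)
  have h2 := h.le (x - k) _ (h.mem x)
  have h3 := h.eq x
  have h4 := parallelogram_law_with_norm ℝ (x - π x) k
  rw [show x - π x + k = x + k - π x by abel, show x - π x - k = x - k - π x by abel] at h4
  have h5 := congrArg (a * ·) h4
  beta_reduce at h5
  linarith

/-- The paraboloid centred at `π x` touches `f'` from below at `x`, so the gradients agree. A bound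
on the gradient therefore bounds `‖π x - x‖`. -/
theorem deriv_eq (h : IsSupConv K a f f' π) {x : V} {l : V →L[ℝ] ℝ}
    {A : V →L[ℝ] V →L[ℝ] ℝ}
    (hT : (fun k => f' (x + k) - f' x - l k - 2⁻¹ * A k k) =o[𝓝 0] fun k => ‖k‖ ^ 2) :
    l = innerSL ℝ ((2 * a) • (π x - x)) := by
  have hd : HasFDerivAt f' l x := by
    rw [hasFDerivAt_iff_isLittleO_nhds_zero]
    have h1 : (fun k => 2⁻¹ * A k k) =O[𝓝 0] fun k : V => ‖k‖ ^ 2 := by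
      refine IsBigO.of_bound (2⁻¹ * ‖A‖) (Eventually.of_forall fun k => ?_)
      have := A.le_opNorm₂ k k
      rw [norm_mul, norm_pow, norm_norm, Real.norm_of_nonneg (by norm_num : (0 : ℝ) ≤ 2⁻¹)]
      linarith
    have h2 := (hT.isBigO.add h1).trans_isLittleO (isLittleO_norm_pow_id one_lt_two)
    refine h2.congr_left fun k => ?_
    ring
  have hd' : HasFDerivAt (fun k => f' (x + k)) l 0 :=
    (hasFDerivAt_comp_add_left x).2 (by simpa using hd)
  have hq : HasFDerivAt (fun k : V => a * ‖x + k - π x‖ ^ 2)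
      (innerSL ℝ ((2 * a) • (x - π x))) 0 := by
    have h1 : HasFDerivAt (fun k : V => x + k - π x) (ContinuousLinearMap.id ℝ V) 0 :=
      ((hasFDerivAt_id (0 : V)).const_add x).sub_const _
    refine (h1.norm_sq.const_mul a).congr_fderiv ?_
    ext v
    simp
    ring
  have hmin : IsLocalMin (fun k => f' (x + k) + a * ‖x + k - π x‖ ^ 2) 0 := by
    refine Eventually.of_forall fun k => ?_
    have h1 := h.le (x + k) _ (h.mem x)
    have h2 := h.eq x
    simp only [add_zero]
    linarith
  have h0 := hmin.hasFDerivAt_eq_zero (hd'.add hq)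
  rw [eq_neg_of_add_eq_zero_left h0, ← map_neg, ← smul_neg, neg_sub]

/-- Moving `x` and the centre `π x` by the same vector leaves the penalty unchanged, so `f` near `π
x` is bounded by a constant plus `f'` near `x`. -/
theorem isUpperJet (h : IsSupConv K a f f' π) {x : V} {l : V →L[ℝ] ℝ}
    {A : V →L[ℝ] V →L[ℝ] ℝ}
    (hT : (fun k => f' (x + k) - f' x - l k - 2⁻¹ * A k k) =o[𝓝 0] fun k => ‖k‖ ^ 2)
    (hx : π x ∈ interior K) : IsUpperJet f (π x) l A := by
  intro ε hε
  have hK : ∀ᶠ k in 𝓝 (0 : V), π x + k ∈ K := by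
    have : Tendsto (fun k => π x + k) (𝓝 0) (𝓝 (π x)) := by
      simpa using (continuous_const.add continuous_id).tendsto (0 : V) (f := fun k => π x + k)
    exact this.eventually (mem_interior_iff_mem_nhds.1 hx)
  filter_upwards [hT.def hε, hK] with k hk hkK
  have h1 := h.le (x + k) _ hkK
  have h2 := h.eq x
  rw [add_sub_add_right_eq_sub] at h1
  rw [norm_pow, norm_norm] at hk
  have := (abs_le.1 hk).2
  linarith

end IsSupConv

theorem eq_zero_of_mul_sq_isLittleO {c : ℝ}
    (h : (fun t : ℝ => c * t ^ 2) =o[𝓝 0] fun t : ℝ => t ^ 2) : c = 0 := by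
  by_contra hc
  have h1 := h.def (c := |c| / 2) (half_pos (abs_pos.2 hc))
  have h2 : ∀ᶠ t : ℝ in 𝓝[>] 0, ‖c * t ^ 2‖ ≤ |c| / 2 * ‖t ^ 2‖ :=
    h1.filter_mono nhdsWithin_le_nhds
  obtain ⟨t, ht, ht0⟩ := (h2.and self_mem_nhdsWithin).exists
  have ht0 : 0 < t := ht0
  rw [norm_mul, Real.norm_eq_abs] at ht
  have : 0 < |c| * ‖t ^ 2‖ := mul_pos (abs_pos.2 hc) (norm_pos_iff.2 (by positivity))
  linarith

/-- The inner product, as a bilinear form. -/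
def innerBil (V : Type*) [NormedAddCommGroup V] [InnerProductSpace ℝ V] : V →L[ℝ] V →L[ℝ] ℝ :=
  innerSL ℝ

@[simp] theorem innerBil_apply (v w : V) : innerBil V v w = ⟪v, w⟫ := rfl

/-- The left inclusion of `V` in the Hilbert sum of two copies of `V`. -/
def inlL2 (V : Type*) [NormedAddCommGroup V] [InnerProductSpace ℝ V] :
    V →L[ℝ] WithLp 2 (V × V) :=
  ((WithLp.prodContinuousLinearEquiv 2 ℝ V V).symm : V × V →L[ℝ] WithLp 2 (V × V)).comp
    (ContinuousLinearMap.inl ℝ V V)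

/-- The right inclusion of `V` in the Hilbert sum of two copies of `V`. -/
def inrL2 (V : Type*) [NormedAddCommGroup V] [InnerProductSpace ℝ V] :
    V →L[ℝ] WithLp 2 (V × V) :=
  ((WithLp.prodContinuousLinearEquiv 2 ℝ V V).symm : V × V →L[ℝ] WithLp 2 (V × V)).comp
    (ContinuousLinearMap.inr ℝ V V)

@[simp] theorem inlL2_fst (a : V) : (inlL2 V a).fst = a := rfl
@[simp] theorem inlL2_snd (a : V) : (inlL2 V a).snd = 0 := rfl
@[simp] theorem inrL2_fst (a : V) : (inrL2 V a).fst = 0 := rfl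
@[simp] theorem inrL2_snd (a : V) : (inrL2 V a).snd = a := rfl

/-- A separable function with a quadratic doubling penalty: from a second order expansion one
gets expansions of both summands, and the Hessian bound of the theorem on sums. -/
theorem taylor_of_doubling {f₁ f₂ : V → ℝ} {b η : ℝ} {x p : WithLp 2 (V × V)}
    {B : WithLp 2 (V × V) →L[ℝ] WithLp 2 (V × V) →L[ℝ] ℝ} (hB : ∀ v, B v v ≤ 0)
    {g : WithLp 2 (V × V) → ℝ}
    (hg : ∀ z, g z = f₁ z.fst + f₂ z.snd - b * ‖z.fst - z.snd‖ ^ 2 - η * ‖z‖ ^ 2)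
    (hT : (fun h => g (x + h) - g x - ⟪p, h⟫ - 2⁻¹ * B h h) =o[𝓝 0] fun h => ‖h‖ ^ 2) :
    ∃ A₁ A₂ : V →L[ℝ] V →L[ℝ] ℝ,
      (fun h => f₁ (x.fst + h) - f₁ x.fst -
        innerSL ℝ (p.fst + (2 * b) • (x.fst - x.snd) + (2 * η) • x.fst) h - 2⁻¹ * A₁ h h)
        =o[𝓝 0] (fun h => ‖h‖ ^ 2) ∧
      (fun h => f₂ (x.snd + h) - f₂ x.snd -
        innerSL ℝ (p.snd - (2 * b) • (x.fst - x.snd) + (2 * η) • x.snd) h - 2⁻¹ * A₂ h h)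
        =o[𝓝 0] (fun h => ‖h‖ ^ 2) ∧
      ∀ v w, A₁ v v + A₂ w w ≤ 2 * b * ‖v - w‖ ^ 2 + 2 * η * (‖v‖ ^ 2 + ‖w‖ ^ 2) := by
  have hnorm : ∀ z : WithLp 2 (V × V), ‖z‖ ^ 2 = ‖z.fst‖ ^ 2 + ‖z.snd‖ ^ 2 :=
    fun z => WithLp.prod_norm_sq_eq_of_L2 z
  have hinner : ∀ z w : WithLp 2 (V × V), ⟪z, w⟫ = ⟪z.fst, w.fst⟫ + ⟪z.snd, w.snd⟫ :=
    fun z w => WithLp.prod_inner_apply z w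
  have hl : Tendsto (inlL2 V) (𝓝 0) (𝓝 0) := by
    simpa using (inlL2 V).continuous.tendsto 0
  have hr : Tendsto (inrL2 V) (𝓝 0) (𝓝 0) := by
    simpa using (inrL2 V).continuous.tendsto 0
  -- The multiple of the inner product restores the Hessians of the two quadratics subtracted in
  -- `g`.
  refine ⟨B.bilinearComp (inlL2 V) (inlL2 V) + (2 * b + 2 * η) • innerBil V,
    B.bilinearComp (inrL2 V) (inrL2 V) + (2 * b + 2 * η) • innerBil V, ?_, ?_, ?_⟩
  · refine (hT.comp_tendsto hl).congr (fun h => ?_) fun h => ?_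
    · simp only [Function.comp_apply, hg, hnorm, hinner, WithLp.add_fst, WithLp.add_snd, inlL2_fst,
        inlL2_snd, add_zero, inner_zero_right, innerSL_apply_apply, inner_add_left,
        real_inner_smul_left, inner_sub_left, _root_.add_apply, _root_.smul_apply,
        ContinuousLinearMap.bilinearComp_apply, smul_eq_mul, innerBil_apply,
        real_inner_self_eq_norm_sq]
      rw [show x.fst + h - x.snd = (x.fst - x.snd) + h by abel, norm_add_sq_real,
        norm_add_sq_real, inner_sub_left]
      ring
    · simp [hnorm]
  · refine (hT.comp_tendsto hr).congr (fun h => ?_) fun h => ?_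
    · simp only [Function.comp_apply, hg, hnorm, hinner, WithLp.add_fst, WithLp.add_snd, inrL2_fst,
        inrL2_snd, add_zero, inner_zero_right, innerSL_apply_apply, inner_add_left,
        real_inner_smul_left, inner_sub_left, _root_.add_apply, _root_.smul_apply,
        ContinuousLinearMap.bilinearComp_apply, smul_eq_mul, innerBil_apply,
        real_inner_self_eq_norm_sq]
      rw [show x.fst - (x.snd + h) = (x.fst - x.snd) - h by abel, norm_sub_sq_real,
        norm_add_sq_real, inner_sub_left]
      ring
    · simp [hnorm]
  · intro v w
    have htend : ∀ z : WithLp 2 (V × V), Tendsto (fun t : ℝ => t • z) (𝓝 0) (𝓝 0) := fun z => by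
      simpa using (continuous_id.smul continuous_const).tendsto (0 : ℝ) (f := fun t : ℝ => t • z)
    have hz : ∀ z : WithLp 2 (V × V),
        (fun t : ℝ => g (x + t • z) - g x - ⟪p, t • z⟫ - 2⁻¹ * B (t • z) (t • z))
          =o[𝓝 0] fun t : ℝ => t ^ 2 := fun z => by
      refine (hT.comp_tendsto (htend z)).trans_isBigO ?_
      refine IsBigO.of_bound (‖z‖ ^ 2) (Eventually.of_forall fun t => ?_)
      simp only [Function.comp_apply, norm_smul, norm_pow, norm_mul, norm_norm]
      exact le_of_eq (by ring)
    have hcross := ((hz (inlL2 V v + inrL2 V w)).sub (hz (inlL2 V v))).sub (hz (inrL2 V w))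
    -- `f₁` and `f₂` do not couple the variables, so the mixed part of `B` is that of the penalty.
    -- Symmetry of `B` is not assumed, hence the two mixed terms.
    have hc : B (inlL2 V v) (inrL2 V w) + B (inrL2 V w) (inlL2 V v) = 4 * b * ⟪v, w⟫ := by
      have : 2 * b * ⟪v, w⟫ -
          2⁻¹ * (B (inlL2 V v) (inrL2 V w) + B (inrL2 V w) (inlL2 V v)) = 0 := by
        apply eq_zero_of_mul_sq_isLittleO
        refine hcross.congr_left fun t => ?_
        simp only [hg, hnorm, WithLp.add_fst, WithLp.add_snd, WithLp.smul_fst, WithLp.smul_snd,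
          inlL2_fst, inlL2_snd, inrL2_fst, inrL2_snd, smul_zero, add_zero, zero_add,
          inner_smul_right, inner_add_right, map_smul, map_add, _root_.add_apply,
          _root_.smul_apply, smul_eq_mul]
        rw [show x.fst + t • v - (x.snd + t • w) = (x.fst - x.snd) + (t • v - t • w) by abel,
          show x.fst + t • v - x.snd = (x.fst - x.snd) + t • v by abel,
          show x.fst - (x.snd + t • w) = (x.fst - x.snd) - t • w by abel]
        simp only [norm_add_sq_real, norm_sub_sq_real, inner_sub_right, inner_smul_right,
          real_inner_smul_left]
        ring
      linarith
    have hBz := hB (inlL2 V v + inrL2 V w)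
    simp only [map_add, _root_.add_apply] at hBz
    simp only [_root_.add_apply, _root_.smul_apply,
      ContinuousLinearMap.bilinearComp_apply, smul_eq_mul, innerBil_apply,
      real_inner_self_eq_norm_sq]
    rw [norm_sub_sq_real]
    nlinarith

set_option maxHeartbeats 1000000 in
/-- **Theorem on sums**, in approximate form. -/
theorem theorem_on_sums [FiniteDimensional ℝ V] {K : Set V} (hK : IsCompact K) {u v : V → ℝ}
    (hu : UpperSemicontinuousOn u K) (hv : UpperSemicontinuousOn v K) {x y : V}
    (hx : x ∈ interior K) (hy : y ∈ interior K) {α τ : ℝ} (hα : 0 < α) (hτ : 0 < τ)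
    (hmax : ∀ x' ∈ K, ∀ y' ∈ K,
      u x' + v y' - α / 2 * ‖x' - y'‖ ^ 2 ≤ u x + v y - α / 2 * ‖x - y‖ ^ 2) :
    ∃ (x₁ y₁ : V) (p q : V →L[ℝ] ℝ) (A B : V →L[ℝ] V →L[ℝ] ℝ), x₁ ∈ interior K ∧
      y₁ ∈ interior K ∧ ‖x₁ - x‖ ≤ τ ∧ ‖y₁ - y‖ ≤ τ ∧ u x + v y - τ ≤ u x₁ + v y₁ ∧
      ‖p - innerSL ℝ (α • (x - y))‖ ≤ τ ∧ ‖q + innerSL ℝ (α • (x - y))‖ ≤ τ ∧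
      IsUpperJet u x₁ p A ∧ IsUpperJet v y₁ q B ∧
      ∀ a b, A a a + B b b ≤ 3 * α * ‖a - b‖ ^ 2 + τ * (‖a‖ ^ 2 + ‖b‖ ^ 2) := by
  set P := α • (x - y) with hP
  have cx : Continuous fun z => x + z := continuous_const.add continuous_id
  have cy : Continuous fun z => y + z := continuous_const.add continuous_id
  set K₁ := (fun z => x + z) ⁻¹' K with hK₁
  set K₂ := (fun z => y + z) ⁻¹' K with hK₂
  have hK₁c : IsCompact K₁ := (Homeomorph.addLeft x).isCompact_preimage.2 hK
  have hK₂c : IsCompact K₂ := (Homeomorph.addLeft y).isCompact_preimage.2 hK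
  have h0₁ : (0 : V) ∈ K₁ := by simpa [hK₁] using interior_subset hx
  have h0₂ : (0 : V) ∈ K₂ := by simpa [hK₂] using interior_subset hy
  -- Values and first order terms at the maximum are removed: both functions vanish at `0`, and
  -- their sum is at most `α / 2 * ‖z₁ - z₂‖ ^ 2`.
  set f₁ : V → ℝ := fun z => u (x + z) + (-u x - ⟪P, z⟫) with hf₁
  set f₂ : V → ℝ := fun z => v (y + z) + (-v y + ⟪P, z⟫) with hf₂
  have husc₁ : UpperSemicontinuousOn f₁ K₁ :=
    (hu.comp cx.continuousOn (fun _ h => h)).add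
      ((by fun_prop : Continuous fun z : V => -u x - ⟪P, z⟫).upperSemicontinuous
        |>.upperSemicontinuousOn _)
  have husc₂ : UpperSemicontinuousOn f₂ K₂ :=
    (hv.comp cy.continuousOn (fun _ h => h)).add
      ((by fun_prop : Continuous fun z : V => -v y + ⟪P, z⟫).upperSemicontinuous
        |>.upperSemicontinuousOn _)
  -- The coefficient is three times `α / 2`, to match the factor in `htri`: the sup-convolutions
  -- then satisfy the bound `hgle`, with equality at the origin.
  obtain ⟨g₁, π₁, hS₁⟩ := exists_isSupConv hK₁c ⟨0, h0₁⟩ husc₁ (3 * α / 2)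
  obtain ⟨g₂, π₂, hS₂⟩ := exists_isSupConv hK₂c ⟨0, h0₂⟩ husc₂ (3 * α / 2)
  have hsum : ∀ z₁ ∈ K₁, ∀ z₂ ∈ K₂, f₁ z₁ + f₂ z₂ ≤ α / 2 * ‖z₁ - z₂‖ ^ 2 := by
    intro z₁ h₁ z₂ h₂
    have h := hmax _ h₁ _ h₂
    rw [show x + z₁ - (y + z₂) = (x - y) + (z₁ - z₂) by abel, norm_add_sq_real] at h
    simp only [hf₁, hf₂, hP, real_inner_smul_left]
    rw [inner_sub_right] at h
    linarith
  have htri : ∀ ξ₁ ξ₂ z₁ z₂ : V, ‖z₁ - z₂‖ ^ 2 ≤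
      3 * (‖ξ₁ - ξ₂‖ ^ 2 + ‖ξ₁ - z₁‖ ^ 2 + ‖ξ₂ - z₂‖ ^ 2) := by
    intro ξ₁ ξ₂ z₁ z₂
    have h : ‖z₁ - z₂‖ ≤ ‖ξ₁ - ξ₂‖ + ‖ξ₁ - z₁‖ + ‖ξ₂ - z₂‖ := by
      rw [show z₁ - z₂ = (ξ₁ - ξ₂) - (ξ₁ - z₁) + (ξ₂ - z₂) by abel]
      exact (norm_add_le _ _).trans (add_le_add (norm_sub_le _ _) le_rfl)
    have h' : ‖z₁ - z₂‖ ^ 2 ≤ (‖ξ₁ - ξ₂‖ + ‖ξ₁ - z₁‖ + ‖ξ₂ - z₂‖) ^ 2 := by gcongr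
    nlinarith [sq_nonneg (‖ξ₁ - ξ₂‖ - ‖ξ₁ - z₁‖), sq_nonneg (‖ξ₁ - ξ₂‖ - ‖ξ₂ - z₂‖),
      sq_nonneg (‖ξ₁ - z₁‖ - ‖ξ₂ - z₂‖)]
  have hgle : ∀ ξ₁ ξ₂, g₁ ξ₁ + g₂ ξ₂ ≤ 3 * α / 2 * ‖ξ₁ - ξ₂‖ ^ 2 := by
    intro ξ₁ ξ₂
    rw [hS₁.eq, hS₂.eq]
    have h1 := hsum _ (hS₁.mem ξ₁) _ (hS₂.mem ξ₂)
    have h2 := mul_le_mul_of_nonneg_left (htri ξ₁ ξ₂ (π₁ ξ₁) (π₂ ξ₂)) hα.le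
    linarith
  have hg₁0 : 0 ≤ g₁ 0 := by simpa [hf₁] using hS₁.le 0 0 h0₁
  have hg₂0 : 0 ≤ g₂ 0 := by simpa [hf₂] using hS₂.le 0 0 h0₂
  have hg0 : g₁ 0 + g₂ 0 ≤ 0 := by simpa using hgle 0 0
  obtain ⟨r, hr, hrx, hry⟩ : ∃ r > 0, Metric.closedBall x r ⊆ interior K ∧
      Metric.closedBall y r ⊆ interior K := by
    obtain ⟨r₁, h₁, h₁'⟩ := Metric.nhds_basis_closedBall.mem_iff.1 (isOpen_interior.mem_nhds hx)
    obtain ⟨r₂, h₂, h₂'⟩ := Metric.nhds_basis_closedBall.mem_iff.1 (isOpen_interior.mem_nhds hy)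
    exact ⟨min r₁ r₂, lt_min h₁ h₂,
      (Metric.closedBall_subset_closedBall (min_le_left _ _)).trans h₁',
      (Metric.closedBall_subset_closedBall (min_le_right _ _)).trans h₂'⟩
  set η := τ / 2 with hη
  have hη0 : 0 < η := by positivity
  -- `κ * s` will bound the gradients and `s * T` the contact points; the factor `2 + 2 * ‖P‖` in
  -- `s` pays for restoring the linear terms in the final value estimate.
  set κ := 1 + 6 * α + 2 * η with hκ
  have hκ0 : 0 < κ := by positivity
  set T := 1 + κ + κ / (3 * α) with hT
  have hT0 : 0 < T := by positivity
  set s := min τ r / (T * (2 + 2 * ‖P‖)) with hs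
  have hs0 : 0 < s := by positivity
  have hsT : s * T * (2 + 2 * ‖P‖) = min τ r := by rw [hs]; field_simp
  set g : WithLp 2 (V × V) → ℝ := fun z =>
    g₁ z.fst + g₂ z.snd - 3 * α / 2 * ‖z.fst - z.snd‖ ^ 2 - η * ‖z‖ ^ 2 with hg
  have cg₁ := hS₁.continuous hK₁c (by positivity)
  have cg₂ := hS₂.continuous hK₂c (by positivity)
  have cfst : Continuous fun z : WithLp 2 (V × V) => z.fst :=
    continuous_fst.comp (WithLp.prod_continuous_ofLp 2 V V)
  have csnd : Continuous fun z : WithLp 2 (V × V) => z.snd :=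
    continuous_snd.comp (WithLp.prod_continuous_ofLp 2 V V)
  have hgc : Continuous g := by fun_prop
  have hnorm : ∀ z : WithLp 2 (V × V), ‖z‖ ^ 2 = ‖z.fst‖ ^ 2 + ‖z.snd‖ ^ 2 :=
    fun z => WithLp.prod_norm_sq_eq_of_L2 z
  have hfst : ∀ z : WithLp 2 (V × V), ‖z.fst‖ ≤ ‖z‖ := fun z =>
    abs_le_of_sq_le_sq' (by rw [hnorm]; nlinarith [sq_nonneg ‖z.snd‖]) (norm_nonneg z) |>.2
  have hsnd : ∀ z : WithLp 2 (V × V), ‖z.snd‖ ≤ ‖z‖ := fun z =>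
    abs_le_of_sq_le_sq' (by rw [hnorm]; nlinarith [sq_nonneg ‖z.fst‖]) (norm_nonneg z) |>.2
  have hpar : ∀ a b : V, ‖a + b‖ ^ 2 + ‖a - b‖ ^ 2 = 2 * (‖a‖ ^ 2 + ‖b‖ ^ 2) := fun a b => by
    have := parallelogram_law_with_norm ℝ a b
    linarith
  -- Of `9 * α`, the sup-convolutions contribute `3 * α` and the doubling penalty `6 * α`; the
  -- strictness term contributes `2 * η`.
  have hC : ∀ z h, 2 * g z - (9 * α + 2 * η) * ‖h‖ ^ 2 ≤ g (z + h) + g (z - h) := by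
    intro z h
    have h1 := hS₁.second_difference z.fst h.fst
    have h2 := hS₂.second_difference z.snd h.snd
    have h3 := hpar (z.fst - z.snd) (h.fst - h.snd)
    have h5 := hpar z.fst h.fst
    have h6 := hpar z.snd h.snd
    have h7 := hpar h.fst h.snd
    rw [show z.fst - z.snd + (h.fst - h.snd) = z.fst + h.fst - (z.snd + h.snd) by abel,
      show z.fst - z.snd - (h.fst - h.snd) = z.fst - h.fst - (z.snd - h.snd) by abel] at h3
    simp only [hg, hnorm, WithLp.add_fst, WithLp.add_snd, WithLp.sub_fst, WithLp.sub_snd]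
    have h8 := mul_nonneg hα.le (sq_nonneg ‖h.fst + h.snd‖)
    have e3 := congrArg (α * ·) h3
    have e5 := congrArg (η * ·) h5
    have e6 := congrArg (η * ·) h6
    have e7 := congrArg (α * ·) h7
    beta_reduce at e3 e5 e6 e7
    linarith
  obtain ⟨z, p, B, hz, hp, hgz, hB, hTay⟩ := exists_taylor_near_max hgc
    (C := 9 * α + 2 * η) (by positivity) hη0 hs0 hC
    (fun z => by simp only [hg]; linarith [hgle z.fst z.snd])
    (by simp [hg]; linarith)
  obtain ⟨A₁, A₂, hT₁, hT₂, hA⟩ := taylor_of_doubling hB (fun _ => rfl) hTay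
  set q₁ := p.fst + (2 * (3 * α / 2)) • (z.fst - z.snd) + (2 * η) • z.fst with hq₁
  set q₂ := p.snd - (2 * (3 * α / 2)) • (z.fst - z.snd) + (2 * η) • z.snd with hq₂
  have hzz : ‖z.fst - z.snd‖ ≤ 2 * s :=
    (norm_sub_le _ _).trans (by linarith [hfst z, hsnd z])
  have e1 : ‖(2 * (3 * α / 2)) • (z.fst - z.snd)‖ ≤ 6 * α * s := by
    rw [norm_smul, Real.norm_of_nonneg (by positivity)]
    nlinarith
  have hq₁s : ‖q₁‖ ≤ κ * s := by
    have e2 : ‖(2 * η) • z.fst‖ ≤ 2 * η * s := by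
      rw [norm_smul, Real.norm_of_nonneg (by positivity)]
      have := (hfst z).trans hz
      gcongr
    have := (hfst p).trans hp
    refine (norm_add_le _ _).trans ?_
    have := norm_add_le p.fst ((2 * (3 * α / 2)) • (z.fst - z.snd))
    rw [hκ]
    linarith
  have hq₂s : ‖q₂‖ ≤ κ * s := by
    have e2 : ‖(2 * η) • z.snd‖ ≤ 2 * η * s := by
      rw [norm_smul, Real.norm_of_nonneg (by positivity)]
      have := (hsnd z).trans hz
      gcongr
    have := (hsnd p).trans hp
    refine (norm_add_le _ _).trans ?_
    have := norm_sub_le p.snd ((2 * (3 * α / 2)) • (z.fst - z.snd))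
    rw [hκ]
    linarith
  have hclose : ∀ {ζ w q : V}, innerSL ℝ q = innerSL ℝ ((2 * (3 * α / 2)) • (ζ - w)) →
      ‖q‖ ≤ κ * s → ‖w‖ ≤ s → ‖ζ‖ ≤ s * T - κ * s := by
    intro ζ w q he hqs hws
    have he' : q = (2 * (3 * α / 2)) • (ζ - w) := by
      refine ext_inner_right ℝ fun v => ?_
      exact congrArg (fun l => l v) he
    have h1 : ‖ζ - w‖ ≤ κ * s / (3 * α) := by
      rw [le_div_iff₀ (by positivity)]
      rw [he', norm_smul, Real.norm_of_nonneg (by positivity)] at hqs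
      linarith
    have h2 : ‖ζ‖ ≤ ‖ζ - w‖ + ‖w‖ := by simpa using norm_add_le (ζ - w) w
    rw [hT]
    have : κ * s / (3 * α) = s * (κ / (3 * α)) := by ring
    linarith
  have hζ₁ := hclose (hS₁.deriv_eq hT₁) hq₁s ((hfst z).trans hz)
  have hζ₂ := hclose (hS₂.deriv_eq hT₂) hq₂s ((hsnd z).trans hz)
  set ζ₁ := π₁ z.fst with hζ₁'
  set ζ₂ := π₂ z.snd with hζ₂'
  have hsT0 : 0 < s * T := by positivity
  have hκs : 0 < κ * s := by positivity
  have hsTm : 2 * (s * T) ≤ min τ r := by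
    rw [← hsT]
    nlinarith [norm_nonneg P]
  have hmτ := min_le_left τ r
  have hmr := min_le_right τ r
  have hκsT : κ * s ≤ s * T := by
    rw [hT]
    have : 0 < κ / (3 * α) := by positivity
    nlinarith
  have hin₁ : x + ζ₁ ∈ interior K := hrx (by
    rw [Metric.mem_closedBall, dist_eq_norm, add_sub_cancel_left]; linarith)
  have hin₂ : y + ζ₂ ∈ interior K := hry (by
    rw [Metric.mem_closedBall, dist_eq_norm, add_sub_cancel_left]; linarith)
  have hj₁ := hS₁.isUpperJet hT₁ (preimage_interior_subset_interior_preimage cx hin₁)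
  have hj₂ := hS₂.isUpperJet hT₂ (preimage_interior_subset_interior_preimage cy hin₂)
  refine ⟨x + ζ₁, y + ζ₂, innerSL ℝ q₁ + innerSL ℝ P, innerSL ℝ q₂ - innerSL ℝ P, A₁, A₂,
    hin₁, hin₂, ?_, ?_, ?_, ?_, ?_, ?_, ?_, ?_⟩
  · rw [add_sub_cancel_left]; linarith
  · rw [add_sub_cancel_left]; linarith
  · have h1 := hS₁.eq z.fst
    have h2 := hS₂.eq z.snd
    have h3 : g z ≤ f₁ ζ₁ + f₂ ζ₂ := by
      simp only [hg, h1, h2]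
      have a1 : 0 ≤ 3 * α / 2 * ‖z.fst - π₁ z.fst‖ ^ 2 := by positivity
      have a2 : 0 ≤ 3 * α / 2 * ‖z.snd - π₂ z.snd‖ ^ 2 := by positivity
      have a3 : 0 ≤ 3 * α / 2 * ‖z.fst - z.snd‖ ^ 2 := by positivity
      have a4 : 0 ≤ η * ‖z‖ ^ 2 := by positivity
      linarith
    simp only [hf₁, hf₂] at h3
    have b1 := neg_le_of_abs_le (abs_real_inner_le_norm P ζ₁)
    have b2 := (abs_le.1 (abs_real_inner_le_norm P ζ₂)).2
    have b3 : ‖P‖ * ‖ζ₁‖ ≤ ‖P‖ * (s * T) := by gcongr; linarith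
    have b4 : ‖P‖ * ‖ζ₂‖ ≤ ‖P‖ * (s * T) := by gcongr; linarith
    have b5 : s ≤ s * T := by
      have : 1 ≤ T := by
        have : 0 < κ / (3 * α) := by positivity
        rw [hT]; linarith
      nlinarith
    have b6 : s * T * (2 + 2 * ‖P‖) ≤ τ := hsT.le.trans hmτ
    linarith
  · rw [add_sub_cancel_right, innerSL_apply_norm]; linarith
  · rw [sub_add_cancel, innerSL_apply_norm]; linarith
  · intro ε hε
    filter_upwards [hj₁ ε hε] with h hh
    simp only [hf₁, inner_add_right] at hh
    rw [add_assoc x ζ₁ h]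
    simp only [_root_.add_apply, innerSL_apply_apply] at hh ⊢
    linarith
  · intro ε hε
    filter_upwards [hj₂ ε hε] with h hh
    simp only [hf₂, inner_add_right] at hh
    rw [add_assoc y ζ₂ h]
    simp only [_root_.sub_apply, innerSL_apply_apply] at hh ⊢
    linarith
  · intro a b
    have := hA a b
    have e : 2 * η = τ := by rw [hη]; ring
    rw [e] at this
    linarith

end Sums

/-! ### Doubling of variables at a strict maximum -/

section Doubling

variable {V : Type*} [NormedAddCommGroup V] [InnerProductSpace ℝ V]

/-- Maxima of a usc sum with doubled variables and a large quadratic penalty are close to the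
strict maximum of the sum, with a small penalty. -/
theorem exists_doubling_max {V : Type*} [NormedAddCommGroup V] {K : Set V}
    (hK : IsCompact K) {u v : V → ℝ}
    (hu : UpperSemicontinuousOn u K) (hv : UpperSemicontinuousOn v K) {y₀ : V} (hy₀ : y₀ ∈ K)
    (hmax : ∀ x ∈ K, x ≠ y₀ → u x + v x < u y₀ + v y₀) {ε : ℝ} (hε : 0 < ε) :
    ∃ α : ℝ, 0 < α ∧ ∃ x ∈ K, ∃ y ∈ K, ‖x - y₀‖ < ε ∧ ‖y - y₀‖ < ε ∧ α * ‖x - y‖ ^ 2 < ε ∧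
      ∀ x' ∈ K, ∀ y' ∈ K,
        u x' + v y' - α / 2 * ‖x' - y'‖ ^ 2 ≤ u x + v y - α / 2 * ‖x - y‖ ^ 2 := by
  set m := u y₀ + v y₀ with hm
  set w : V × V → ℝ := fun z => u z.1 + v z.2 with hw
  have hwusc : UpperSemicontinuousOn w (K ×ˢ K) :=
    (hu.comp continuous_fst.continuousOn fun z hz => hz.1).add
      (hv.comp continuous_snd.continuousOn fun z hz => hz.2)
  have hKK := hK.prod hK
  have hne : (K ×ˢ K).Nonempty := ⟨(y₀, y₀), hy₀, hy₀⟩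
  obtain ⟨zC, hzC, hCmax⟩ := UpperSemicontinuousOn.exists_isMaxOn hne hKK hwusc
  have hex : ∀ k : ℕ, ∃ z ∈ K ×ˢ K, ∀ z' ∈ K ×ˢ K,
      w z' - (k + 1 : ℝ) / 2 * ‖z'.1 - z'.2‖ ^ 2 ≤ w z - (k + 1 : ℝ) / 2 * ‖z.1 - z.2‖ ^ 2 := by
    intro k
    have hc : UpperSemicontinuousOn
        (fun z : V × V => w z + -((k + 1 : ℝ) / 2 * ‖z.1 - z.2‖ ^ 2)) (K ×ˢ K) :=
      hwusc.add ((by fun_prop : Continuous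
        fun z : V × V => -((k + 1 : ℝ) / 2 * ‖z.1 - z.2‖ ^ 2)).upperSemicontinuous
        |>.upperSemicontinuousOn _)
    obtain ⟨z, hz, hzm⟩ := UpperSemicontinuousOn.exists_isMaxOn hne hKK hc
    exact ⟨z, hz, fun z' hz' => by simpa [sub_eq_add_neg] using hzm hz'⟩
  choose z hzK hzmax using hex
  -- Testing maximality against `(y₀, y₀)` bounds the penalty by the excess of `w` over `m`. As the
  -- coefficients `k + 1` grow, cluster points are diagonal, and strictness makes them equal to
  -- `(y₀, y₀)`.
  have hlow : ∀ k : ℕ, (k + 1 : ℝ) / 2 * ‖(z k).1 - (z k).2‖ ^ 2 ≤ w (z k) - m := fun k => by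
    have := hzmax k (y₀, y₀) ⟨hy₀, hy₀⟩
    simp only [sub_self, norm_zero] at this
    have e : w (y₀, y₀) = m := rfl
    rw [e] at this
    linarith
  obtain ⟨⟨a, b⟩, habK, φ, hφ, hlim⟩ := hKK.tendsto_subseq hzK
  have hd : Tendsto (fun k => ‖(z (φ k)).1 - (z (φ k)).2‖ ^ 2) atTop (𝓝 0) := by
    have h1 : Tendsto (fun k : ℕ => 2 * (w zC - m) / ((k : ℝ) + 1)) atTop (𝓝 0) := by
      refine Tendsto.div_atTop tendsto_const_nhds ?_
      exact tendsto_atTop_add_const_right _ _ tendsto_natCast_atTop_atTop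
    refine squeeze_zero (fun k => by positivity) (fun k => ?_) (h1.comp hφ.tendsto_atTop)
    have h2 := hlow (φ k)
    have h3 : w (z (φ k)) ≤ w zC := hCmax (hzK _)
    simp only [Function.comp_apply]
    rw [le_div_iff₀ (by positivity)]
    linarith
  have hab : a = b := by
    have h1 : Tendsto (fun k => ‖(z (φ k)).1 - (z (φ k)).2‖ ^ 2) atTop (𝓝 (‖a - b‖ ^ 2)) :=
      ((by fun_prop : Continuous fun z : V × V => ‖z.1 - z.2‖ ^ 2).tendsto (a, b)).comp hlim
    have h2 := tendsto_nhds_unique h1 hd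
    exact sub_eq_zero.1 (norm_eq_zero.1 (pow_eq_zero_iff two_ne_zero |>.1 h2))
  subst hab
  have hwithin : Tendsto (z ∘ φ) atTop (𝓝[K ×ˢ K] (a, a)) :=
    tendsto_nhdsWithin_iff.2 ⟨hlim, Eventually.of_forall fun k => hzK _⟩
  have hev : ∀ c, w (a, a) < c → ∀ᶠ k in atTop, w (z (φ k)) < c := fun c hc =>
    hwithin.eventually (hwusc (a, a) habK c hc)
  have hnn : ∀ k, m ≤ w (z k) := fun k => by
    have h1 := hlow k
    have : 0 ≤ (k + 1 : ℝ) / 2 * ‖(z k).1 - (z k).2‖ ^ 2 := by positivity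
    linarith
  have ha : a = y₀ := by
    by_contra hne
    obtain ⟨k, hk⟩ := (hev m (hmax a habK.1 hne)).exists
    linarith [hnn (φ k)]
  subst ha
  have hfin := hev (m + ε / 2) (by simp only [hw, hm]; linarith)
  have hball := hlim.eventually (Metric.ball_mem_nhds (a, a) hε)
  obtain ⟨k, hk, hkb⟩ := (hfin.and hball).exists
  rw [Prod.dist_eq, max_lt_iff, dist_eq_norm, dist_eq_norm] at hkb
  refine ⟨φ k + 1, by positivity, (z (φ k)).1, (hzK _).1, (z (φ k)).2, (hzK _).2,
    hkb.1, hkb.2, ?_, fun x' hx' y' hy' => hzmax (φ k) (x', y') ⟨hx', hy'⟩⟩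
  linarith [hlow (φ k)]

/-- Jets at nearby points obtained by doubling variables at a strict maximum. -/
theorem exists_doubled_jets [FiniteDimensional ℝ V] {K : Set V} (hK : IsCompact K) {u v : V → ℝ}
    (hu : UpperSemicontinuousOn u K) (hv : UpperSemicontinuousOn v K) {y₀ : V}
    (hy₀ : y₀ ∈ interior K) (hmax : ∀ x ∈ K, x ≠ y₀ → u x + v x < u y₀ + v y₀) {ε : ℝ}
    (hε : 0 < ε) :
    ∃ (x y : V) (p q : V →L[ℝ] ℝ) (A B : V →L[ℝ] V →L[ℝ] ℝ) (σ : ℝ), x ∈ interior K ∧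
      y ∈ interior K ∧ ‖x - y₀‖ ≤ ε ∧ ‖y - y₀‖ ≤ ε ∧ u y₀ + v y₀ - ε ≤ u x + v y ∧
      ‖p + q‖ ≤ ε ∧ ‖x - y‖ * ‖p‖ ≤ ε ∧ IsUpperJet u x p A ∧ IsUpperJet v y q B ∧ 0 ≤ σ ∧
      σ * ‖x - y‖ ^ 2 ≤ ε ∧
      ∀ a b, A a a + B b b ≤ σ * ‖a - b‖ ^ 2 + ε * (‖a‖ ^ 2 + ‖b‖ ^ 2) := by
  obtain ⟨r, hr, hrK⟩ := Metric.isOpen_iff.1 isOpen_interior y₀ hy₀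
  -- The factor `24` absorbs all constants below, and `e ≤ r` keeps the points inside `K`.
  set e := min (min ε 1 / 24) r with he
  have he0 : 0 < e := by positivity
  have heε : 24 * e ≤ ε := by
    have h1 : e ≤ min ε 1 / 24 := min_le_left _ _
    have h2 : min ε 1 ≤ ε := min_le_left _ _
    linarith
  have he1 : 24 * e ≤ 1 := by
    have h1 : e ≤ min ε 1 / 24 := min_le_left _ _
    have h2 : min ε 1 ≤ 1 := min_le_right _ _
    linarith
  have her : e ≤ r := min_le_right _ _
  obtain ⟨α, hα, x, hxK, y, hyK, hx, hy, hα', hm⟩ :=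
    exists_doubling_max hK hu hv (interior_subset hy₀) hmax he0
  -- `α` is already fixed and may be large; this choice makes both `τ` and `τ * α` at most `e`.
  set τ := e / (1 + α) with hτ
  have hτ0 : 0 < τ := by positivity
  have hτα : τ * (1 + α) = e := by rw [hτ]; field_simp
  have hτα' : 0 < τ * α := by positivity
  have hτe : τ ≤ e := by linarith
  have hτe' : τ * α ≤ e := by linarith
  obtain ⟨x₁, y₁, p, q, A, B, hx₁, hy₁, hxx, hyy, huv, hp, hq, hju, hjv, hAB⟩ :=
    theorem_on_sums hK hu hv (hrK (by rw [Metric.mem_ball, dist_eq_norm]; linarith))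
      (hrK (by rw [Metric.mem_ball, dist_eq_norm]; linarith)) hα hτ0 hm
  set d := ‖x - y‖ with hd
  have hd0 : 0 ≤ d := norm_nonneg _
  have hde : d ≤ 2 * e := by
    have : x - y = (x - y₀) - (y - y₀) := by abel
    rw [hd, this]
    exact (norm_sub_le _ _).trans (by linarith)
  have hd₁ : ‖x₁ - y₁‖ ≤ d + 2 * τ := by
    rw [show x₁ - y₁ = (x₁ - x) + (x - y) - (y₁ - y) by abel]
    exact (norm_sub_le _ _).trans (by linarith [norm_add_le (x₁ - x) (x - y)])
  have hp₁ : ‖p‖ ≤ α * d + τ := by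
    have h1 : ‖innerSL ℝ (α • (x - y))‖ = α * d := by
      rw [innerSL_apply_norm, norm_smul, Real.norm_of_nonneg hα.le]
    have h2 := norm_add_le (p - innerSL ℝ (α • (x - y))) (innerSL ℝ (α • (x - y)))
    rw [sub_add_cancel] at h2
    linarith
  have htri : ∀ {a b c : V}, ‖a - b‖ ≤ τ → ‖b - c‖ < e → ‖a - c‖ ≤ ε := fun {a b c} h1 h2 => by
    rw [show a - c = (a - b) + (b - c) by abel]
    exact (norm_add_le _ _).trans (by linarith)
  have hτd : τ * d ≤ τ * 1 := by gcongr; linarith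
  have hταd : τ * α * d ≤ τ * α * 1 := by gcongr; linarith
  have hττ : τ * τ ≤ τ * 1 := by gcongr; linarith
  have hταττ : τ * α * τ ≤ τ * α * 1 := by gcongr; linarith
  refine ⟨x₁, y₁, p, q, A, B, 3 * α, hx₁, hy₁, htri hxx hx, htri hyy hy, ?_, ?_, ?_, hju, hjv,
    by positivity, ?_, ?_⟩
  · have h := hm y₀ (interior_subset hy₀) y₀ (interior_subset hy₀)
    rw [sub_self, norm_zero] at h
    have : 0 ≤ α / 2 * d ^ 2 := by positivity
    linarith
  · have : p + q = (p - innerSL ℝ (α • (x - y))) + (q + innerSL ℝ (α • (x - y))) := by abel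
    rw [this]
    exact (norm_add_le _ _).trans (by linarith)
  · have h1 : ‖x₁ - y₁‖ * ‖p‖ ≤ (d + 2 * τ) * (α * d + τ) := by gcongr
    have h2 : (d + 2 * τ) * (α * d + τ) =
      α * d ^ 2 + τ * d + 2 * (τ * α * d) + 2 * (τ * τ) := by ring
    linarith
  · have h1 : 3 * α * ‖x₁ - y₁‖ ^ 2 ≤ 3 * α * (d + 2 * τ) ^ 2 := by gcongr
    have h2 : (d + 2 * τ) ^ 2 ≤ 2 * d ^ 2 + 8 * τ ^ 2 := by nlinarith [sq_nonneg (d - 2 * τ)]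
    have h3 : 3 * α * (d + 2 * τ) ^ 2 ≤ 3 * α * (2 * d ^ 2 + 8 * τ ^ 2) := by gcongr
    have h4 : 3 * α * (2 * d ^ 2 + 8 * τ ^ 2) = 6 * (α * d ^ 2) + 24 * (τ * α * τ) := by ring
    have h5 : τ * α * τ ≤ e * τ := by gcongr
    have h6 : 24 * e * τ ≤ 1 * τ := by gcongr
    linarith
  · intro a b
    have h1 := hAB a b
    have h2 : τ * (‖a‖ ^ 2 + ‖b‖ ^ 2) ≤ ε * (‖a‖ ^ 2 + ‖b‖ ^ 2) := by gcongr; linarith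
    linarith

end Doubling

/-! ### Symmetric forms and affine automorphisms of the jet fibre -/

section SymForm

variable {n : ℕ}

namespace SymForm

theorem ext {A B : SymForm n} (h : ∀ v w, A.bil v w = B.bil v w) : A = B := by
  refine Subtype.ext (p := (· ∈ symForms n)) ?_
  exact ContinuousLinearMap.ext fun v => ContinuousLinearMap.ext fun w => h v w

@[simp] theorem bil_add (A B : SymForm n) : (A + B).bil = A.bil + B.bil := rfl
@[simp] theorem bil_sub (A B : SymForm n) : (A - B).bil = A.bil - B.bil := rfl
@[simp] theorem bil_neg (A : SymForm n) : (-A).bil = -A.bil := rfl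
@[simp] theorem bil_smul (t : ℝ) (A : SymForm n) : (t • A).bil = t • A.bil := rfl
theorem norm_bil (A : SymForm n) : ‖A.bil‖ = ‖A‖ := rfl
@[simp] theorem bil_mk (B : Bil n) (h) : (SymForm.mk B h).bil = B := rfl

@[simp] theorem pull_apply (k : Rn n →L[ℝ] Rn n) (A : SymForm n) (v w : Rn n) :
    (A.pull k).bil v w = A.bil (k v) (k w) := rfl

theorem ofBilin_self (B : Bil n) (v : Rn n) : (ofBilin B).bil v v = B v v := by
  change (2⁻¹ : ℝ) * (B v v + B v v) = B v v
  ring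

theorem ofBilin_bil (A : SymForm n) : ofBilin A.bil = A := by
  refine ext fun v w => ?_
  change (2⁻¹ : ℝ) * (A.bil v w + A.bil w v) = _
  rw [A.bil_symm w v]
  ring

theorem norm_pull_le (k : Rn n →L[ℝ] Rn n) (A : SymForm n) :
    ‖A.pull k‖ ≤ ‖A‖ * ‖k‖ * ‖k‖ := by
  rw [← norm_bil, ← norm_bil]
  refine ContinuousLinearMap.opNorm_le_bound₂ _ (by positivity) fun v w => ?_
  rw [pull_apply]
  refine (A.bil.le_opNorm₂ _ _).trans ?_
  have h1 := k.le_opNorm v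
  have h2 := k.le_opNorm w
  calc ‖A.bil‖ * ‖k v‖ * ‖k w‖ ≤ ‖A.bil‖ * (‖k‖ * ‖v‖) * (‖k‖ * ‖w‖) := by gcongr
    _ = _ := by ring

theorem pull_pull_symm (k : Rn n ≃L[ℝ] Rn n) (A : SymForm n) :
    (A.pull (k.symm : Rn n →L[ℝ] Rn n)).pull (k : Rn n →L[ℝ] Rn n) = A :=
  ext fun v w => by simp

theorem pull_add (k : Rn n →L[ℝ] Rn n) (A B : SymForm n) :
    (A + B).pull k = A.pull k + B.pull k := ext fun v w => by simp

theorem pull_neg (k : Rn n →L[ℝ] Rn n) (A : SymForm n) :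
    (-A).pull k = -A.pull k := ext fun v w => by simp

/-- The Euclidean inner product as a symmetric form. -/
def one (n : ℕ) : SymForm n :=
  SymForm.mk (innerBil (Rn n)) fun v w => by
    rw [innerBil_apply, innerBil_apply, real_inner_comm]

theorem one_apply (v w : Rn n) : (one n).bil v w = ⟪v, w⟫ := rfl

theorem norm_one_le : ‖one n‖ ≤ 1 := by
  rw [← norm_bil]
  refine ContinuousLinearMap.opNorm_le_bound₂ _ zero_le_one fun v w => ?_
  rw [one_apply, one_mul]
  exact norm_inner_le_norm v w

end SymForm

/-- The automorphism is triangular: solve for the gradient, remove its image under `L`, then undo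
the pullback. This converts room around a jet into room around its image. -/
theorem AffineJetAut.exists_act_add {Vt : Set (Rn n)} (Ψ : AffineJetAut n Vt) {y : Rn n} {Λ : ℝ}
    (hΛ : 1 ≤ Λ) (hg : ‖((Ψ.g y).symm : (Rn n →L[ℝ] ℝ) →L[ℝ] (Rn n →L[ℝ] ℝ))‖ ≤ Λ)
    (hk : ‖((Ψ.k y).symm : Rn n →L[ℝ] Rn n)‖ ≤ Λ) (hL : ‖Ψ.L y‖ ≤ Λ) (j d : Jet n) :
    ∃ d' : Jet n, ‖d'‖ ≤ 2 * Λ ^ 4 * ‖d‖ ∧ Ψ.act y (j + d') = Ψ.act y j + d := by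
  set p := (Ψ.g y).symm d.2.1 with hp
  set A := SymForm.pull ((Ψ.k y).symm : Rn n →L[ℝ] Rn n) (d.2.2 - Ψ.L y p) with hA
  have hd1 : ‖d.1‖ ≤ ‖d‖ := norm_fst_le d
  have hd2 : ‖d.2.1‖ ≤ ‖d‖ := (norm_fst_le d.2).trans (norm_snd_le d)
  have hd3 : ‖d.2.2‖ ≤ ‖d‖ := (norm_snd_le d.2).trans (norm_snd_le d)
  have hd0 := norm_nonneg d
  have hΛ0 : 0 ≤ Λ := by linarith
  have hpn : ‖p‖ ≤ Λ * ‖d‖ := by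
    refine (((Ψ.g y).symm : (Rn n →L[ℝ] ℝ) →L[ℝ] (Rn n →L[ℝ] ℝ)).le_opNorm d.2.1).trans ?_
    gcongr
  have hAn : ‖A‖ ≤ 2 * Λ ^ 4 * ‖d‖ := by
    have h1 : ‖d.2.2 - Ψ.L y p‖ ≤ 2 * Λ ^ 2 * ‖d‖ := by
      have h2 : ‖Ψ.L y p‖ ≤ Λ * (Λ * ‖d‖) :=
        ((Ψ.L y).le_opNorm p).trans (by gcongr)
      refine (norm_sub_le _ _).trans ?_
      nlinarith [mul_nonneg (by nlinarith : 0 ≤ Λ ^ 2 - 1) hd0]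
    refine (SymForm.norm_pull_le _ _).trans ?_
    calc _ ≤ 2 * Λ ^ 2 * ‖d‖ * Λ * Λ := by gcongr
      _ = _ := by ring
  refine ⟨(d.1, p, A), ?_, ?_⟩
  · have h1 : 1 ≤ Λ ^ 4 := one_le_pow₀ hΛ
    have h2 : Λ ≤ Λ ^ 4 := le_self_pow₀ hΛ (by norm_num)
    refine norm_prod_le_iff.2 ⟨?_, norm_prod_le_iff.2 ⟨?_, hAn⟩⟩
    · refine hd1.trans ?_
      nlinarith [mul_nonneg (sub_nonneg.2 h1) hd0]
    · refine hpn.trans ?_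
      nlinarith [mul_nonneg (sub_nonneg.2 h2) hd0, mul_nonneg (sub_nonneg.2 h1) hd0]
  · unfold AffineJetAut.act
    refine Prod.ext ?_ (Prod.ext ?_ ?_)
    · simp only [Prod.fst_add]; ring
    · simp only [Prod.snd_add, Prod.fst_add, map_add, hp, ContinuousLinearEquiv.apply_symm_apply]
      abel
    · simp only [Prod.snd_add, Prod.fst_add, map_add, SymForm.pull_add, hA,
        SymForm.pull_pull_symm]
      abel

end SymForm

/-! ### Local comparison through the jet equivalence -/

section LocalComparison

variable {n : ℕ}

/-- Used once for the tuple of all coefficients of the jet equivalence and the inverses of `g` and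
`k`, so that a single `Λ` serves everywhere. -/
theorem exists_lipschitz_bound {V E : Type*} [NormedAddCommGroup V] [NormedSpace ℝ V]
    [NormedAddCommGroup E] [NormedSpace ℝ E] {f : V → E} {y₀ : V} (hf : ContDiffAt ℝ 1 f y₀) :
    ∃ Λ, 1 ≤ Λ ∧ ∃ r > 0, ∀ y ∈ Metric.ball y₀ r, ‖f y‖ ≤ Λ ∧
      ∀ y' ∈ Metric.ball y₀ r, ‖f y - f y'‖ ≤ Λ * ‖y - y'‖ := by
  obtain ⟨K, t, ht, hK⟩ := hf.exists_lipschitzOnWith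
  have h1 : ∀ᶠ y in 𝓝 y₀, ‖f y‖ < ‖f y₀‖ + 1 :=
    hf.continuousAt.norm.eventually (gt_mem_nhds (by linarith))
  obtain ⟨r, hr, hball⟩ := Metric.eventually_nhds_iff_ball.1 (h1.and ht)
  have hKnn := K.2
  refine ⟨‖f y₀‖ + 1 + K, ?_, r, hr, fun y hy => ⟨?_, fun y' hy' => ?_⟩⟩
  · have := norm_nonneg (f y₀)
    have : (0 : ℝ) ≤ K := K.2
    linarith
  · have : (0 : ℝ) ≤ K := K.2
    linarith [(hball y hy).1]
  · refine (hK.norm_sub_le (hball y hy).2 (hball y' hy').2).trans ?_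
    gcongr
    have := norm_nonneg (f y₀)
    linarith

theorem contDiffAt_symm {V E : Type*} [NormedAddCommGroup V] [NormedSpace ℝ V]
    [NormedAddCommGroup E] [NormedSpace ℝ E] [CompleteSpace E] {f : V → (E ≃L[ℝ] E)} {y₀ : V}
    {m : WithTop ℕ∞} (hf : ContDiffAt ℝ m (fun y => (f y : E →L[ℝ] E)) y₀) :
    ContDiffAt ℝ m (fun y => ((f y).symm : E →L[ℝ] E)) y₀ := by
  have h := (contDiffAt_map_inverse (f y₀)).comp y₀ hf
  refine h.congr_of_eventuallyEq (Eventually.of_forall fun y => ?_)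
  simp

theorem add_mem_interior_of_forall {E : Type*} [NormedAddCommGroup E] {S : Set E} {m j : E}
    (h : ∀ x ∈ S, x + m ∈ S) (hj : j ∈ interior S) : j + m ∈ interior S := by
  have h1 : (fun x => x + m) '' interior S ⊆ S := by
    rintro _ ⟨x, hx, rfl⟩
    exact h x (interior_subset hx)
  exact interior_maximal h1 ((Homeomorph.addRight m).isOpenMap _ isOpen_interior) ⟨j, hj, rfl⟩

set_option maxHeartbeats 1000000 in
/-- Local comparison: a strict maximum of `u + v` with positive value is impossible if the jets of
`u` lie strictly inside the subequation and those of `v` in its dual. -/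
theorem local_comparison {F₀ : Set (Jet n)} (hF₀ : PosNeg F₀) {Vt : Set (Rn n)} (hV : IsOpen Vt)
    (Ψ : AffineJetAut n Vt) {K : Set (Rn n)} (hK : IsCompact K) {y₀ : Rn n} (hy₀V : y₀ ∈ Vt)
    (hy₀ : y₀ ∈ interior K) {u v : Rn n → ℝ}
    (hu : UpperSemicontinuousOn u K) (hv : UpperSemicontinuousOn v K)
    (hmax : ∀ x ∈ K, x ≠ y₀ → u x + v x < u y₀ + v y₀) (hpos : 0 < u y₀ + v y₀) {c : ℝ}
    (hc : 0 < c)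
    (hju : ∀ y ∈ interior K, ∀ p (A : SymForm n), IsUpperJet u y p A.bil → ∀ d : Jet n,
      ‖d‖ ≤ c → Ψ.act y ((u y, p, A) + d) ∈ F₀)
    (hjv : ∀ y ∈ interior K, ∀ p (A : SymForm n), IsUpperJet v y p A.bil →
      Ψ.act y (-(v y, p, A)) ∉ interior F₀) : False := by
  have hVn : Vt ∈ 𝓝 y₀ := hV.mem_nhds hy₀V
  have cg := (Ψ.smooth_g.contDiffAt hVn).of_le (m := 1) (by norm_cast)
  have ck := (Ψ.smooth_k.contDiffAt hVn).of_le (m := 1) (by norm_cast)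
  have cL := (Ψ.smooth_L.contDiffAt hVn).of_le (m := 1) (by norm_cast)
  have cS := (Ψ.smooth_S.contDiffAt hVn).of_le (m := 1) (by norm_cast)
  obtain ⟨Λ, hΛ, r, hr, hball⟩ := exists_lipschitz_bound
    ((cg.prodMk (contDiffAt_symm cg)).prodMk ((ck.prodMk (contDiffAt_symm ck)).prodMk
      (cL.prodMk cS)))
  simp only [Prod.mk_sub_mk, norm_prod_le_iff] at hball
  have hΛ0 : 0 < Λ := by linarith
  set m := u y₀ + v y₀ with hm
  -- The factor `32 * Λ ^ 6` is `2 * Λ ^ 4`, from `exists_act_add`, times the `16 * Λ ^ 2` needed in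
  -- the fibre of `F₀`.
  set ε := min (min (r / 2) m) (c / (32 * Λ ^ 6)) with hε
  have hε0 : 0 < ε := by positivity
  have hεr : ε < r := by
    have : ε ≤ r / 2 := (min_le_left _ _).trans (min_le_left _ _)
    linarith
  have hεm : ε ≤ m := (min_le_left _ _).trans (min_le_right _ _)
  have hεc : ε * (32 * Λ ^ 6) ≤ c := by
    rw [← le_div_iff₀ (by positivity)]
    exact min_le_right _ _
  obtain ⟨x, y, p, q, A', B', σ, hxK, hyK, hx, hy, huv, hpq, hxyp, hjx, hjy, hσ, hσxy, hAB⟩ :=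
    exists_doubled_jets hK hu hv hy₀ hmax hε0
  set A := SymForm.ofBilin A' with hA
  set B := SymForm.ofBilin B' with hB
  have hjx' : IsUpperJet u x p A.bil := fun e he => by
    filter_upwards [hjx e he] with h hh
    rwa [hA, SymForm.ofBilin_self]
  have hjy' : IsUpperJet v y q B.bil := fun e he => by
    filter_upwards [hjy e he] with h hh
    rwa [hB, SymForm.ofBilin_self]
  have hxr : x ∈ Metric.ball y₀ r := by rw [Metric.mem_ball, dist_eq_norm]; linarith
  have hyr : y ∈ Metric.ball y₀ r := by rw [Metric.mem_ball, dist_eq_norm]; linarith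
  obtain ⟨⟨⟨bg, bgs⟩, ⟨bk, bks⟩, bL, bS⟩, hlipx⟩ := hball x hxr
  obtain ⟨⟨⟨bg', -⟩, ⟨bk', -⟩, bL', -⟩, -⟩ := hball y hyr
  obtain ⟨⟨lg, -⟩, ⟨lk, -⟩, lL, lS⟩ := hlipx y hyr
  have hxy : ‖x - y‖ ≤ 2 * ε := by
    rw [show x - y = (x - y₀) - (y - y₀) by abel]
    exact (norm_sub_le _ _).trans (by linarith)
  -- One `Λ ^ 2 * ε` covers the term in `σ`, through the variation of `k` between `x` and `y`; two
  -- cover the `ε` term of the Hessian bound.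
  set s' := 3 * Λ ^ 2 * ε with hs'
  set Q : SymForm n := -(SymForm.pull (Ψ.k y : Rn n →L[ℝ] Rn n) B) -
    SymForm.pull (Ψ.k x : Rn n →L[ℝ] Rn n) A + s' • SymForm.one n with hQ
  have hQ0 : Q.Nonneg := by
    intro w
    have h1 := hAB (Ψ.k x w) (Ψ.k y w)
    have h2 : ‖Ψ.k x w - Ψ.k y w‖ ≤ Λ * ‖x - y‖ * ‖w‖ := by
      have := ((Ψ.k x : Rn n →L[ℝ] Rn n) - (Ψ.k y : Rn n →L[ℝ] Rn n)).le_opNorm w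
      exact this.trans (by gcongr)
    have h3 : ‖Ψ.k x w‖ ≤ Λ * ‖w‖ := ((Ψ.k x : Rn n →L[ℝ] Rn n).le_opNorm w).trans (by gcongr)
    have h4 : ‖Ψ.k y w‖ ≤ Λ * ‖w‖ := ((Ψ.k y : Rn n →L[ℝ] Rn n).le_opNorm w).trans (by gcongr)
    have h5 : σ * ‖Ψ.k x w - Ψ.k y w‖ ^ 2 ≤ Λ ^ 2 * ‖w‖ ^ 2 * ε := by
      calc _ ≤ σ * (Λ * ‖x - y‖ * ‖w‖) ^ 2 := by gcongr
        _ = Λ ^ 2 * ‖w‖ ^ 2 * (σ * ‖x - y‖ ^ 2) := by ring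
        _ ≤ _ := by gcongr
    have h6 : ε * (‖Ψ.k x w‖ ^ 2 + ‖Ψ.k y w‖ ^ 2) ≤
        ε * ((Λ * ‖w‖) ^ 2 + (Λ * ‖w‖) ^ 2) := by gcongr
    have h7 : Q.bil w w = -(B' (Ψ.k y w) (Ψ.k y w)) - A' (Ψ.k x w) (Ψ.k x w) +
        s' * ‖w‖ ^ 2 := by
      rw [← real_inner_self_eq_norm_sq, ← SymForm.ofBilin_self B', ← SymForm.ofBilin_self A']
      rfl
    rw [h7, hs']
    linarith
  -- This is the difference of the transformed jets of `-v` at `y` and of `u` at `x`, without `Q`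
  -- and without the difference of the values. As `‖p‖` has no bound of its own, the variation of
  -- `g` and `L` is paired with the bound on `‖x - y‖ * ‖p‖`.
  set d : Jet n := (Ψ.S y - Ψ.S x) + (0, Ψ.g y (-q) - Ψ.g x p,
    Ψ.L y (-q) - Ψ.L x p - s' • SymForm.one n) with hd
  have hΛ2 : Λ ≤ Λ ^ 2 := le_self_pow₀ hΛ (by norm_num)
  have hd2 : ‖d‖ ≤ 8 * Λ ^ 2 * ε := by
    have e1 : ‖Ψ.S y - Ψ.S x‖ ≤ Λ * (2 * ε) := by
      have : ‖Ψ.S x - Ψ.S y‖ ≤ Λ * ‖x - y‖ := norm_prod_le_iff.2 ⟨lS.1, norm_prod_le_iff.2 lS.2⟩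
      rw [norm_sub_rev]
      exact this.trans (by gcongr)
    have epq : ‖-q - p‖ ≤ ε := by
      rw [← norm_neg, neg_sub, sub_neg_eq_add]; exact hpq
    have e2 : ‖Ψ.g y (-q) - Ψ.g x p‖ ≤ Λ * ε + Λ * ε := by
      have : Ψ.g y (-q) - Ψ.g x p = Ψ.g y (-q - p) -
          (((Ψ.g x : (Rn n →L[ℝ] ℝ) →L[ℝ] (Rn n →L[ℝ] ℝ)) - Ψ.g y) p) := by
        simp only [map_sub, _root_.sub_apply, ContinuousLinearEquiv.coe_coe]
        abel
      rw [this]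
      refine (norm_sub_le _ _).trans (add_le_add ?_ ?_)
      · exact ((Ψ.g y : (Rn n →L[ℝ] ℝ) →L[ℝ] (Rn n →L[ℝ] ℝ)).le_opNorm _).trans (by gcongr)
      · refine (ContinuousLinearMap.le_opNorm _ p).trans ?_
        calc _ ≤ Λ * ‖x - y‖ * ‖p‖ := by gcongr
          _ = Λ * (‖x - y‖ * ‖p‖) := by ring
          _ ≤ _ := by gcongr
    have e3 : ‖Ψ.L y (-q) - Ψ.L x p‖ ≤ Λ * ε + Λ * ε := by
      have : Ψ.L y (-q) - Ψ.L x p = Ψ.L y (-q - p) - ((Ψ.L x - Ψ.L y) p) := by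
        simp only [map_sub, _root_.sub_apply]
        abel
      rw [this]
      refine (norm_sub_le _ _).trans (add_le_add ?_ ?_)
      · exact ((Ψ.L y).le_opNorm _).trans (by gcongr)
      · refine (ContinuousLinearMap.le_opNorm _ p).trans ?_
        calc _ ≤ Λ * ‖x - y‖ * ‖p‖ := by gcongr
          _ = Λ * (‖x - y‖ * ‖p‖) := by ring
          _ ≤ _ := by gcongr
    have e4 : ‖s' • SymForm.one n‖ ≤ s' := by
      rw [norm_smul, Real.norm_of_nonneg (by positivity)]
      calc _ ≤ s' * 1 := by gcongr; exact SymForm.norm_one_le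
        _ = s' := mul_one _
    have hΛε : Λ * ε ≤ Λ ^ 2 * ε := by gcongr
    have h0 : 0 ≤ Λ ^ 2 * ε := by positivity
    refine (norm_add_le _ _).trans ?_
    have e5 : ‖((0 : ℝ), Ψ.g y (-q) - Ψ.g x p,
        Ψ.L y (-q) - Ψ.L x p - s' • SymForm.one n)‖ ≤ 5 * (Λ ^ 2 * ε) := by
      refine norm_prod_le_iff.2 ⟨by simpa using h0, norm_prod_le_iff.2 ⟨?_, ?_⟩⟩
      · linarith
      · refine (norm_sub_le _ _).trans ?_
        rw [hs'] at e4 ⊢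
        linarith
    linarith
  have hmemI : Ψ.act x (u x, p, A) + d ∈ interior F₀ := by
    rw [mem_interior_iff_mem_nhds, Metric.mem_nhds_iff]
    refine ⟨8 * Λ ^ 2 * ε, by positivity, fun w hw => ?_⟩
    rw [Metric.mem_ball, dist_eq_norm] at hw
    obtain ⟨d', hd', he⟩ := Ψ.exists_act_add hΛ bgs bks bL (u x, p, A)
      (w - Ψ.act x (u x, p, A))
    have hw' : ‖w - Ψ.act x (u x, p, A)‖ ≤ 16 * Λ ^ 2 * ε := by
      rw [show w - Ψ.act x (u x, p, A) = (w - (Ψ.act x (u x, p, A) + d)) + d by abel]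
      exact (norm_add_le _ _).trans (by linarith)
    have hd'c : ‖d'‖ ≤ c := by
      refine hd'.trans (le_trans ?_ hεc)
      calc 2 * Λ ^ 4 * ‖w - Ψ.act x (u x, p, A)‖ ≤ 2 * Λ ^ 4 * (16 * Λ ^ 2 * ε) := by gcongr
        _ = _ := by ring
    have := hju x hxK p A hjx' d' hd'c
    rwa [he, add_sub_cancel] at this
  have hmemP := add_mem_interior_of_forall (m := (0, 0, Q))
    (fun j hj => hF₀.1 j hj Q hQ0) hmemI
  have hmemN := add_mem_interior_of_forall (m := (-(u x + v y), 0, 0))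
    (fun j hj => hF₀.2 j hj (-(u x + v y)) (by linarith)) hmemP
  -- The interior jet, moved by `Q` under (P) and by the nonpositive number `-(u x + v y)` under
  -- (N), is exactly the transformed negative jet of `v`.
  refine hjv y hyK q B hjy' ?_
  convert hmemN using 1
  unfold AffineJetAut.act
  refine Prod.ext ?_ (Prod.ext ?_ ?_)
  · simp only [Prod.fst_add, Prod.fst_neg, hd, Prod.fst_sub]
    ring
  · simp only [Prod.fst_add, Prod.snd_add, Prod.fst_neg, Prod.snd_neg, hd, Prod.fst_sub,
      Prod.snd_sub]
    abel
  · simp only [Prod.snd_add, Prod.fst_neg, Prod.snd_neg, hd, Prod.snd_sub, SymForm.pull_neg, hQ]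
    abel

end LocalComparison

/-! ### Calculus of 2-jets on Euclidean space -/

section JetCalculus

variable {n : ℕ}

theorem SymForm.norm_ofBilin_le (B : Bil n) : ‖SymForm.ofBilin B‖ ≤ ‖B‖ := by
  rw [← SymForm.norm_bil]
  refine ContinuousLinearMap.opNorm_le_bound₂ _ (by positivity) fun v w => ?_
  change ‖(2⁻¹ : ℝ) * (B v w + B w v)‖ ≤ _
  have h1 := B.le_opNorm₂ v w
  have h2 := B.le_opNorm₂ w v
  rw [norm_mul, Real.norm_of_nonneg (by norm_num : (0 : ℝ) ≤ 2⁻¹)]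
  have := norm_add_le (B v w) (B w v)
  nlinarith

/-- Symmetrization as a continuous linear map. -/
def SymForm.ofBilinL (n : ℕ) : Bil n →L[ℝ] SymForm n :=
  LinearMap.mkContinuous
    { toFun := SymForm.ofBilin
      map_add' := fun B C => SymForm.ext fun v w => by
        change (2⁻¹ : ℝ) * ((B v w + C v w) + (B w v + C w v)) =
          (2⁻¹ : ℝ) * (B v w + B w v) + (2⁻¹ : ℝ) * (C v w + C w v)
        ring
      map_smul' := fun t B => SymForm.ext fun v w => by
        change (2⁻¹ : ℝ) * (t * B v w + t * B w v) = t * ((2⁻¹ : ℝ) * (B v w + B w v))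
        ring }
    1 fun B => by rw [one_mul]; exact SymForm.norm_ofBilin_le B

@[simp] theorem SymForm.ofBilinL_apply (B : Bil n) :
    SymForm.ofBilinL n B = SymForm.ofBilin B := rfl

/-- The 2-jet at `y` of a function on `ℝⁿ`. -/
def jetF (h : Rn n → ℝ) (y : Rn n) : Jet n :=
  (h y, fderiv ℝ h y, SymForm.ofBilin (fderiv ℝ (fderiv ℝ h) y))

theorem jetF_congr {h k : Rn n → ℝ} {y : Rn n} (hk : h =ᶠ[𝓝 y] k) : jetF h y = jetF k y := by
  unfold jetF
  rw [hk.eq_of_nhds, hk.fderiv_eq, hk.fderiv.fderiv_eq]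

theorem eventually_hasFDerivAt {h : Rn n → ℝ} {y : Rn n} (hh : ContDiffAt ℝ 2 h y) :
    ∀ᶠ z in 𝓝 y, HasFDerivAt h (fderiv ℝ h z) z := by
  filter_upwards [hh.eventually (by simp)] with z hz
  exact (hz.differentiableAt (by simp)).hasFDerivAt

theorem hasFDerivAt_fderiv {h : Rn n → ℝ} {y : Rn n} (hh : ContDiffAt ℝ 2 h y) :
    HasFDerivAt (fderiv ℝ h) (fderiv ℝ (fderiv ℝ h) y) y :=
  ((hh.fderiv_right (m := 1) (by norm_num)).differentiableAt (by simp)).hasFDerivAt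

theorem jetF_eq {h : Rn n → ℝ} {y : Rn n} {h' : Rn n → (Rn n →L[ℝ] ℝ)} {h'' : Bil n}
    (hh : ∀ᶠ z in 𝓝 y, HasFDerivAt h (h' z) z) (hh' : HasFDerivAt h' h'' y) :
    jetF h y = (h y, h' y, SymForm.ofBilin h'') := by
  have e : fderiv ℝ h =ᶠ[𝓝 y] h' := hh.mono fun z hz => hz.fderiv
  unfold jetF
  rw [e.eq_of_nhds, e.fderiv_eq, hh'.fderiv]

theorem jetF_add {h k : Rn n → ℝ} {y : Rn n} (hh : ContDiffAt ℝ 2 h y)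
    (hk : ContDiffAt ℝ 2 k y) : jetF (fun z => h z + k z) y = jetF h y + jetF k y := by
  rw [jetF_eq (h := fun z => h z + k z) (h' := fun z => fderiv ℝ h z + fderiv ℝ k z)
    (((eventually_hasFDerivAt hh).and (eventually_hasFDerivAt hk)).mono fun z hz => hz.1.add hz.2)
    ((hasFDerivAt_fderiv hh).add (hasFDerivAt_fderiv hk))]
  simp only [jetF, ← SymForm.ofBilinL_apply, map_add, Prod.mk_add_mk]

theorem jetF_mul {h : Rn n → ℝ} {y : Rn n} (hh : ContDiffAt ℝ 2 h y) (t : ℝ) :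
    jetF (fun z => t * h z) y = t • jetF h y := by
  rw [jetF_eq (h := fun z => t * h z) (h' := fun z => t • fderiv ℝ h z)
    ((eventually_hasFDerivAt hh).mono fun z hz => hz.const_mul t)
    ((hasFDerivAt_fderiv hh).const_smul t)]
  simp only [jetF, ← SymForm.ofBilinL_apply, map_smul, Prod.smul_mk, smul_eq_mul]

theorem hasFDerivAt_poly (j : Jet n) (y z : Rn n) :
    HasFDerivAt (fun z => j.poly (z - y)) (j.2.1 + j.2.2.bil (z - y)) z := by
  have h0 : HasFDerivAt (fun z : Rn n => z - y) (ContinuousLinearMap.id ℝ (Rn n)) z :=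
    (hasFDerivAt_id z).sub_const y
  have h1 : HasFDerivAt (fun z : Rn n => j.2.1 (z - y)) j.2.1 z :=
    (j.2.1.hasFDerivAt.comp z h0)
  have h2 : HasFDerivAt (fun z : Rn n => j.2.2.bil (z - y)) j.2.2.bil z :=
    (j.2.2.bil.hasFDerivAt.comp z h0)
  have h3 := (h1.const_add j.1).add ((h2.clm_apply h0).const_mul 2⁻¹)
  refine h3.congr_fderiv ?_
  ext v
  have := j.2.2.bil_symm v (z - y)
  simp only [_root_.add_apply, _root_.smul_apply, smul_eq_mul, ContinuousLinearMap.comp_apply,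
    ContinuousLinearMap.id_apply, ContinuousLinearMap.flip_apply, this]
  ring

theorem contDiff_poly (j : Jet n) (y : Rn n) {m : WithTop ℕ∞} :
    ContDiff ℝ m fun z => j.poly (z - y) := by
  unfold Jet.poly
  fun_prop

theorem jetF_poly (j : Jet n) (y : Rn n) : jetF (fun z => j.poly (z - y)) y = j := by
  have h0 : HasFDerivAt (fun z : Rn n => z - y) (ContinuousLinearMap.id ℝ (Rn n)) y :=
    (hasFDerivAt_id y).sub_const y
  have h2 : HasFDerivAt (fun z : Rn n => j.2.2.bil (z - y)) j.2.2.bil y :=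
    (j.2.2.bil.hasFDerivAt.comp y h0)
  rw [jetF_eq (Eventually.of_forall fun z => hasFDerivAt_poly j y z) (h2.const_add j.2.1),
    SymForm.ofBilin_bil]
  simp [Jet.poly]

theorem poly_add (j k : Jet n) (v : Rn n) : (j + k).poly v = j.poly v + k.poly v := by
  simp only [Jet.poly, Prod.fst_add, Prod.snd_add, SymForm.bil_add, _root_.add_apply]
  ring

theorem poly_smul (t : ℝ) (j : Jet n) (v : Rn n) : (t • j).poly v = t * j.poly v := by
  simp only [Jet.poly, Prod.smul_fst, Prod.smul_snd, SymForm.bil_smul, _root_.smul_apply,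
    smul_eq_mul]
  ring

theorem continuousAt_jetF {h : Rn n → ℝ} {y : Rn n} (hh : ContDiffAt ℝ 2 h y) :
    ContinuousAt (jetF h) y := by
  have h1 : ContDiffAt ℝ 1 (fderiv ℝ h) y := hh.fderiv_right (by norm_num)
  have h2 : ContDiffAt ℝ 0 (fderiv ℝ (fderiv ℝ h)) y := h1.fderiv_right (by norm_num)
  exact hh.continuousAt.prodMk (h1.continuousAt.prodMk
    ((SymForm.ofBilinL n).continuous.continuousAt.comp h2.continuousAt))

theorem jetF_taylor {h : Rn n → ℝ} {y : Rn n} (hh : ContDiffAt ℝ 2 h y) :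
    (fun k => h (y + k) - (jetF h y).poly k) =o[𝓝 0] fun k => ‖k‖ ^ 2 := by
  refine (taylor_two_isLittleO (eventually_hasFDerivAt hh) (hasFDerivAt_fderiv hh)).congr_left
    fun k => ?_
  simp only [jetF, Jet.poly, SymForm.ofBilin_self]
  ring

/-- Every term of the second order chain rule contains a derivative of `h`. Chart independence of
jets reduces to this case by taking differences. -/
theorem jetF_comp_eq_zero {h : Rn n → ℝ} {τ : Rn n → Rn n} {y : Rn n}
    (hh : ContDiffAt ℝ 2 h (τ y)) (hτ : ContDiffAt ℝ 2 τ y) (h0 : jetF h (τ y) = 0) :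
    jetF (h ∘ τ) y = 0 := by
  have hh0 : h (τ y) = 0 := congrArg Prod.fst h0
  have hh1 : fderiv ℝ h (τ y) = 0 := congrArg (fun j => j.2.1) h0
  have hh2 : fderiv ℝ (fderiv ℝ h) (τ y) = 0 := by
    have hs : SymForm.ofBilin (fderiv ℝ (fderiv ℝ h) (τ y)) = 0 := congrArg (fun j => j.2.2) h0
    ext v w
    have h1 := second_derivative_symmetric_of_eventually (eventually_hasFDerivAt hh)
      (hasFDerivAt_fderiv hh) v w
    have h2 : (2⁻¹ : ℝ) * (fderiv ℝ (fderiv ℝ h) (τ y) v w + fderiv ℝ (fderiv ℝ h) (τ y) w v) = 0 :=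
      congrArg (fun A : SymForm n => A.bil v w) hs
    simp only [_root_.zero_apply]
    linarith
  have hτ1 : ∀ᶠ z in 𝓝 y, HasFDerivAt τ (fderiv ℝ τ z) z := by
    filter_upwards [hτ.eventually (by simp)] with z hz
    exact (hz.differentiableAt (by simp)).hasFDerivAt
  have hτ2 : HasFDerivAt (fderiv ℝ τ) (fderiv ℝ (fderiv ℝ τ) y) y :=
    ((hτ.fderiv_right (m := 1) (by norm_num)).differentiableAt (by simp)).hasFDerivAt
  have ha : HasFDerivAt (fun z => fderiv ℝ h (τ z))
      ((fderiv ℝ (fderiv ℝ h) (τ y)).comp (fderiv ℝ τ y)) y :=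
    (hasFDerivAt_fderiv hh).comp y hτ1.self_of_nhds
  rw [jetF_eq (h' := fun z => (fderiv ℝ h (τ z)).comp (fderiv ℝ τ z))
    (((hτ.continuousAt.eventually (eventually_hasFDerivAt hh)).and hτ1).mono
      fun z hz => hz.1.comp z hz.2) (ha.clm_comp hτ2)]
  refine Prod.ext hh0 (Prod.ext ?_ ?_)
  · change (fderiv ℝ h (τ y)).comp (fderiv ℝ τ y) = 0
    rw [hh1, ContinuousLinearMap.zero_comp]
  · rw [hh1, hh2, ContinuousLinearMap.zero_comp, map_zero, ContinuousLinearMap.zero_comp,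
      ContinuousLinearMap.zero_comp, ContinuousLinearMap.comp_zero, zero_add]
    exact map_zero (SymForm.ofBilinL n)

theorem jetF_of_localMin {h : Rn n → ℝ} {y : Rn n} (hh : ContDiffAt ℝ 2 h y) (h0 : h y = 0)
    (hmin : ∀ᶠ z in 𝓝 y, 0 ≤ h z) : ∃ A : SymForm n, A.Nonneg ∧ jetF h y = (0, 0, A) := by
  have hlm : IsLocalMin h y := hmin.mono fun z hz => by rwa [h0]
  refine ⟨(jetF h y).2.2, fun v => ?_, Prod.ext h0 (Prod.ext hlm.fderiv_eq_zero rfl)⟩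
  by_contra! hneg
  set A := (jetF h y).2.2 with hA
  have hv : v ≠ 0 := by rintro rfl; simp at hneg
  have hv' : 0 < ‖v‖ := norm_pos_iff.2 hv
  have hlim : Tendsto (fun t : ℝ => t • v) (𝓝[>] 0) (𝓝 0) := by
    refine tendsto_nhdsWithin_of_tendsto_nhds ?_
    simpa using (continuous_id.smul continuous_const).tendsto (0 : ℝ) (f := fun t : ℝ => t • v)
  have hev := ((jetF_taylor hh).comp_tendsto hlim).def (c := -A.bil v v / (4 * ‖v‖ ^ 2))
    (div_pos (by linarith) (by positivity))
  have hlim' : Tendsto (fun t : ℝ => y + t • v) (𝓝[>] 0) (𝓝 y) := by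
    simpa using (tendsto_const_nhds (x := y)).add hlim
  obtain ⟨t, ⟨ht, htn⟩, ht0⟩ :=
    ((hev.and (hlim'.eventually hmin)).and self_mem_nhdsWithin).exists
  have ht0 : 0 < t := ht0
  simp only [Function.comp_apply, norm_smul, norm_pow, norm_mul, norm_norm] at ht
  rw [Real.norm_of_nonneg ht0.le] at ht
  have e : -A.bil v v / (4 * ‖v‖ ^ 2) * (t * ‖v‖) ^ 2 = -(t ^ 2 * (A.bil v v)) / 4 := by
    field_simp
  have e2 : (jetF h y).poly (t • v) = 2⁻¹ * (t ^ 2 * A.bil v v) := by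
    have h1 : (jetF h y).1 = 0 := h0
    have h2 : (jetF h y).2.1 = 0 := hlm.fderiv_eq_zero
    simp only [Jet.poly, h1, h2, ← hA, map_smul, _root_.smul_apply, smul_eq_mul,
      _root_.zero_apply]
    ring
  rw [e, e2] at ht
  have := (abs_le.1 ht).2
  have : t ^ 2 * A.bil v v < 0 := mul_neg_of_pos_of_neg (by positivity) hneg
  linarith

end JetCalculus

/-! ### The jet bundle in charts -/

section Charts

theorem eventually_comp_chart {X Y : Type*} [TopologicalSpace X] [TopologicalSpace Y]
    {e e' : OpenPartialHomeomorph X Y} {x : X}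
    (hx : x ∈ e.source) (hx' : x ∈ e'.source) :
    ∀ᶠ z in 𝓝 (e' x), e.symm (e (e'.symm z)) = e'.symm z := by
  have h1 : Tendsto e'.symm (𝓝 (e' x)) (𝓝 x) := by
    have := e'.continuousAt_symm (e'.map_source hx')
    rwa [ContinuousAt, e'.left_inv hx'] at this
  filter_upwards [h1.eventually (e.open_source.mem_nhds hx)] with z hz
  exact e.left_inv hz

variable {n : ℕ} {X : Type*} [TopologicalSpace X] [ChartedSpace (Rn n) X]

theorem jetAt_eq (x : X) (f : X → ℝ) :
    jetAt n x f = jetF (f ∘ (chartAt (Rn n) x).symm) (chartAt (Rn n) x x) := by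
  unfold jetAt jetF
  simp [(chartAt (Rn n) x).left_inv (mem_chart_source (Rn n) x)]

theorem contDiffAt_comp_symm {e : OpenPartialHomeomorph X (Rn n)}
    (he : e ∈ IsManifold.maximalAtlas 𝓘(ℝ, Rn n) ∞ X) {y : Rn n} (hy : y ∈ e.target) {f : X → ℝ}
    (hf : ContMDiffAt 𝓘(ℝ, Rn n) 𝓘(ℝ, ℝ) 2 f (e.symm y)) :
    ContDiffAt ℝ 2 (f ∘ e.symm) y := by
  have h1 : ContMDiffAt 𝓘(ℝ, Rn n) 𝓘(ℝ, Rn n) 2 e.symm y :=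
    ((contMDiffOn_symm_of_mem_maximalAtlas he).contMDiffAt (e.open_target.mem_nhds hy)).of_le
      (by norm_cast)
  exact contMDiffAt_iff_contDiffAt.1 (hf.comp y h1)

theorem contMDiffAt_comp_chart {e : OpenPartialHomeomorph X (Rn n)}
    (he : e ∈ IsManifold.maximalAtlas 𝓘(ℝ, Rn n) ∞ X) {x : X} (hx : x ∈ e.source)
    {h : Rn n → ℝ} (hh : ContDiffAt ℝ 2 h (e x)) :
    ContMDiffAt 𝓘(ℝ, Rn n) 𝓘(ℝ, ℝ) 2 (fun z => h (e z)) x := by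
  have h1 : ContMDiffAt 𝓘(ℝ, Rn n) 𝓘(ℝ, Rn n) 2 e x :=
    ((contMDiffOn_of_mem_maximalAtlas he).contMDiffAt (e.open_source.mem_nhds hx)).of_le
      (by norm_cast)
  exact (contMDiffAt_iff_contDiffAt.2 hh).comp x h1

theorem continuous_ofChart {e : OpenPartialHomeomorph X (Rn n)}
    (he : e ∈ IsManifold.maximalAtlas 𝓘(ℝ, Rn n) ∞ X) :
    Continuous fun q : e.target × Jet n => ofChart e (q.1 : Rn n) q.2 := by
  rw [continuous_iff_coinduced_le]
  exact le_iSup (fun e : IsManifold.maximalAtlas 𝓘(ℝ, Rn n) ∞ X =>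
    TopologicalSpace.coinduced
      (fun q : e.1.target × Jet n => ofChart e.1 (q.1 : Rn n) q.2) inferInstance) ⟨e, he⟩

/-- Open sets of jets pull back to open sets in every trivialization; one radius serves for the base
and for the fibre. -/
theorem exists_ball_ofChart_mem {e : OpenPartialHomeomorph X (Rn n)}
    (he : e ∈ IsManifold.maximalAtlas 𝓘(ℝ, Rn n) ∞ X) {O : Set (JetBundle n X)} (hO : IsOpen O)
    {y₀ : Rn n} (hy₀ : y₀ ∈ e.target) {j₀ : Jet n} (hj₀ : ofChart e y₀ j₀ ∈ O) :
    ∃ r > 0, Metric.ball y₀ r ⊆ e.target ∧ ∀ y ∈ Metric.ball y₀ r, ∀ j, ‖j - j₀‖ < r →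
      ofChart e y j ∈ O := by
  have h1 := (hO.preimage (continuous_ofChart he)).mem_nhds
    (show ((⟨y₀, hy₀⟩ : e.target), j₀) ∈ _ from hj₀)
  rw [nhds_prod_eq, mem_prod_iff] at h1
  obtain ⟨s, hs, t, ht, hst⟩ := h1
  rw [nhds_subtype_eq_comap, mem_comap] at hs
  obtain ⟨s', hs', hss⟩ := hs
  obtain ⟨r₁, hr₁, h₁⟩ := Metric.mem_nhds_iff.1 (inter_mem hs' (e.open_target.mem_nhds hy₀))
  obtain ⟨r₂, hr₂, h₂⟩ := Metric.mem_nhds_iff.1 ht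
  refine ⟨min r₁ r₂, lt_min hr₁ hr₂,
    (Metric.ball_subset_ball (min_le_left _ _)).trans (h₁.trans inter_subset_right), ?_⟩
  intro y hy j hj
  have hy' := h₁ (Metric.ball_subset_ball (min_le_left _ _) hy)
  have hj' : j ∈ t :=
    h₂ (by rw [Metric.mem_ball, dist_eq_norm]; exact hj.trans_le (min_le_right _ _))
  exact hst (show ((⟨y, hy'.2⟩ : e.target), j) ∈ s ×ˢ t from ⟨hss hy'.1, hj'⟩)

variable [IsManifold 𝓘(ℝ, Rn n) ∞ X]

theorem contDiffAt_chartAt {x : X} {f : X → ℝ} (hf : ContMDiffAt 𝓘(ℝ, Rn n) 𝓘(ℝ, ℝ) 2 f x) :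
    ContDiffAt ℝ 2 (f ∘ (chartAt (Rn n) x).symm) (chartAt (Rn n) x x) :=
  contDiffAt_comp_symm (IsManifold.chart_mem_maximalAtlas x) (mem_chart_target (Rn n) x)
    (by rwa [(chartAt (Rn n) x).left_inv (mem_chart_source (Rn n) x)])

theorem jetAt_add {x : X} {f g : X → ℝ} (hf : ContMDiffAt 𝓘(ℝ, Rn n) 𝓘(ℝ, ℝ) 2 f x)
    (hg : ContMDiffAt 𝓘(ℝ, Rn n) 𝓘(ℝ, ℝ) 2 g x) :
    jetAt n x (fun z => f z + g z) = jetAt n x f + jetAt n x g := by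
  rw [jetAt_eq, jetAt_eq, jetAt_eq]
  exact jetF_add (contDiffAt_chartAt hf) (contDiffAt_chartAt hg)

theorem jetAt_mul {x : X} {f : X → ℝ} (hf : ContMDiffAt 𝓘(ℝ, Rn n) 𝓘(ℝ, ℝ) 2 f x) (t : ℝ) :
    jetAt n x (fun z => t * f z) = t • jetAt n x f := by
  rw [jetAt_eq, jetAt_eq]
  exact jetF_mul (contDiffAt_chartAt hf) t

/-- The jet of a `C²` function, computed in an arbitrary chart. -/
theorem ofChart_jetF {e : OpenPartialHomeomorph X (Rn n)}
    (he : e ∈ IsManifold.maximalAtlas 𝓘(ℝ, Rn n) ∞ X) {y : Rn n} (hy : y ∈ e.target) {f : X → ℝ}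
    (hf : ContMDiffAt 𝓘(ℝ, Rn n) 𝓘(ℝ, ℝ) 2 f (e.symm y)) :
    ofChart e y (jetF (f ∘ e.symm) y) = ⟨e.symm y, jetAt n (e.symm y) f⟩ := by
  unfold ofChart
  congr 1
  set x := e.symm y with hx
  have hxs : x ∈ e.source := e.map_target hy
  have hex : e x = y := e.right_inv hy
  set j := jetF (f ∘ e.symm) y with hj
  have hP : ContMDiffAt 𝓘(ℝ, Rn n) 𝓘(ℝ, ℝ) 2 (fun z => j.poly (e z - y)) x :=
    contMDiffAt_comp_chart he hxs (h := fun w => j.poly (w - y)) (contDiff_poly j y).contDiffAt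
  have hfy := contDiffAt_comp_symm he hy hf
  have hnf : ContMDiffAt 𝓘(ℝ, Rn n) 𝓘(ℝ, ℝ) 2 (fun z => (-1) * f z) x :=
    contMDiffAt_const.mul hf
  have hnfy : ContDiffAt ℝ 2 (fun w => (-1) * (f ∘ e.symm) w) y := contDiffAt_const.mul hfy
  have hd : ContMDiffAt 𝓘(ℝ, Rn n) 𝓘(ℝ, ℝ) 2 (fun z => j.poly (e z - y) + (-1) * f z) x :=
    hP.add hnf
  -- `f` minus its quadratic model has zero 2-jet in the chart `e`, hence also in the preferred
  -- chart.
  have hzero : jetAt n x (fun z => j.poly (e z - y) + (-1) * f z) = 0 := by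
    set χ := chartAt (Rn n) x with hχ
    have hχx : x ∈ χ.source := mem_chart_source (Rn n) x
    have hmem : χ ∈ IsManifold.maximalAtlas 𝓘(ℝ, Rn n) ∞ X :=
      IsManifold.chart_mem_maximalAtlas x
    have hτ : ContDiffAt ℝ 2 (e ∘ χ.symm) (χ x) := by
      have h1 : ContMDiffAt 𝓘(ℝ, Rn n) 𝓘(ℝ, Rn n) ∞ χ.symm (χ x) :=
        (contMDiffOn_symm_of_mem_maximalAtlas hmem).contMDiffAt
          (χ.open_target.mem_nhds (χ.map_source hχx))
      have h2 : ContMDiffAt 𝓘(ℝ, Rn n) 𝓘(ℝ, Rn n) ∞ e (χ.symm (χ x)) := by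
        rw [χ.left_inv hχx]
        exact (contMDiffOn_of_mem_maximalAtlas he).contMDiffAt (e.open_source.mem_nhds hxs)
      exact (contMDiffAt_iff_contDiffAt.1 (h2.comp _ h1)).of_le (by norm_cast)
    have hτx : (e ∘ χ.symm) (χ x) = y := by
      simp only [Function.comp_apply, χ.left_inv hχx, hex]
    have hD : ContDiffAt ℝ 2 ((fun z => j.poly (e z - y) + (-1) * f z) ∘ e.symm) y :=
      contDiffAt_comp_symm he hy hd
    have hD0 : jetF ((fun z => j.poly (e z - y) + (-1) * f z) ∘ e.symm) y = 0 := by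
      have e1 : ((fun z => j.poly (e z - y) + (-1) * f z) ∘ e.symm) =ᶠ[𝓝 y]
          fun w => j.poly (w - y) + (-1) * (f ∘ e.symm) w := by
        filter_upwards [e.open_target.mem_nhds hy] with w hw
        simp only [Function.comp_apply, e.right_inv hw]
      rw [jetF_congr e1, jetF_add (contDiff_poly j y).contDiffAt hnfy,
        jetF_mul hfy, jetF_poly, ← hj, neg_one_smul ℝ j]
      exact add_neg_cancel j
    rw [jetAt_eq]
    have e2 : (fun z => j.poly (e z - y) + (-1) * f z) ∘ χ.symm =ᶠ[𝓝 (χ x)]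
        ((fun z => j.poly (e z - y) + (-1) * f z) ∘ e.symm) ∘ (e ∘ χ.symm) := by
      filter_upwards [eventually_comp_chart hxs hχx] with z hz
      simp only [Function.comp_apply, hz]
    rw [jetF_congr e2]
    exact jetF_comp_eq_zero (by rwa [hτx]) hτ (by rwa [hτx])
  rw [jetAt_add hP hnf, jetAt_mul hf, neg_one_smul ℝ (jetAt n x f)] at hzero
  exact add_neg_eq_zero.1 hzero

/-- The fibre coordinate change from the trivialization of a chart to the preferred one. -/
def fibreMap {e : OpenPartialHomeomorph X (Rn n)}
    (he : e ∈ IsManifold.maximalAtlas 𝓘(ℝ, Rn n) ∞ X) {y : Rn n} (hy : y ∈ e.target) :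
    Jet n →ₗ[ℝ] Jet n where
  toFun j := (ofChart e y j).fib
  map_add' j k := by
    have hP : ∀ j : Jet n,
        ContMDiffAt 𝓘(ℝ, Rn n) 𝓘(ℝ, ℝ) 2 (fun z => j.poly (e z - y)) (e.symm y) := fun j =>
      contMDiffAt_comp_chart he (e.map_target hy) (h := fun w => j.poly (w - y))
        (contDiff_poly j y).contDiffAt
    simp only [ofChart, poly_add]
    exact jetAt_add (hP j) (hP k)
  map_smul' t j := by
    have hP : ContMDiffAt 𝓘(ℝ, Rn n) 𝓘(ℝ, ℝ) 2 (fun z => j.poly (e z - y)) (e.symm y) :=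
      contMDiffAt_comp_chart he (e.map_target hy) (h := fun w => j.poly (w - y))
        (contDiff_poly j y).contDiffAt
    simp only [ofChart, poly_smul]
    exact jetAt_mul hP t

theorem ofChart_eq {e : OpenPartialHomeomorph X (Rn n)}
    (he : e ∈ IsManifold.maximalAtlas 𝓘(ℝ, Rn n) ∞ X) {y : Rn n} (hy : y ∈ e.target) (j : Jet n) :
    ofChart e y j = ⟨e.symm y, fibreMap he hy j⟩ := rfl

theorem ofChart_mem {e : OpenPartialHomeomorph X (Rn n)}
    (he : e ∈ IsManifold.maximalAtlas 𝓘(ℝ, Rn n) ∞ X) {y : Rn n} (hy : y ∈ e.target) (j : Jet n)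
    (G : Set (JetBundle n X)) : ofChart e y j ∈ G ↔ fibreMap he hy j ∈ fibre G (e.symm y) :=
  Iff.rfl

/-- Realize the jet by a quadratic polynomial in the preferred chart; its jet in `e` is a preimage.
-/
theorem fibreMap_surjective {e : OpenPartialHomeomorph X (Rn n)}
    (he : e ∈ IsManifold.maximalAtlas 𝓘(ℝ, Rn n) ∞ X) {y : Rn n} (hy : y ∈ e.target) :
    Function.Surjective (fibreMap he hy) := by
  intro j
  set x := e.symm y with hx
  set χ := chartAt (Rn n) x with hχ
  have hχx : x ∈ χ.source := mem_chart_source (Rn n) x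
  have hf : ContMDiffAt 𝓘(ℝ, Rn n) 𝓘(ℝ, ℝ) 2 (fun z => j.poly (χ z - χ x)) x :=
    contMDiffAt_comp_chart (IsManifold.chart_mem_maximalAtlas x) hχx
      (h := fun w => j.poly (w - χ x)) (contDiff_poly j _).contDiffAt
  refine ⟨jetF ((fun z => j.poly (χ z - χ x)) ∘ e.symm) y, ?_⟩
  have h1 := congrArg JetBundle.fib (ofChart_jetF he hy hf)
  refine h1.trans ?_
  change jetAt n x (fun z => j.poly (χ z - χ x)) = j
  rw [jetAt_eq]
  have e1 : (fun z => j.poly (χ z - χ x)) ∘ χ.symm =ᶠ[𝓝 (χ x)] fun w => j.poly (w - χ x) := by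
    filter_upwards [χ.open_target.mem_nhds (χ.map_source hχx)] with w hw
    simp only [Function.comp_apply, χ.right_inv hw]
  rw [jetF_congr e1, jetF_poly]

instance : FiniteDimensional ℝ (SymForm n) := by
  have h : FiniteDimensional ℝ (Bil n) := inferInstance
  have h' := @FiniteDimensional.finiteDimensional_submodule ℝ (Bil n) _ _ _ h (symForms n)
  exact h'

theorem isOpenMap_fibreMap {e : OpenPartialHomeomorph X (Rn n)}
    (he : e ∈ IsManifold.maximalAtlas 𝓘(ℝ, Rn n) ∞ X) {y : Rn n} (hy : y ∈ e.target) :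
    IsOpenMap (fibreMap he hy) :=
  (fibreMap he hy).isOpenMap_of_finiteDimensional (fibreMap_surjective he hy)

end Charts

/-! ### Upper jets and the fibrewise jet equivalence -/

section UpperJets

variable {n : ℕ}

theorem IsUpperJet.sub_contDiffAt {u h : Rn n → ℝ} {y : Rn n} {p : Rn n →L[ℝ] ℝ} {A : SymForm n}
    (hj : IsUpperJet (fun z => u z + h z) y p A.bil) (hh : ContDiffAt ℝ 2 h y) :
    IsUpperJet u y (p - (jetF h y).2.1) (A - (jetF h y).2.2).bil := by
  intro ε hε
  filter_upwards [hj (ε / 2) (by positivity), (jetF_taylor hh).def (half_pos hε)] with k hk hT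
  rw [norm_pow, norm_norm] at hT
  have h1 := (abs_le.1 hT).1
  have h2 : (jetF h y).poly k = h y + (jetF h y).2.1 k + 2⁻¹ * (jetF h y).2.2.bil k k := rfl
  rw [h2] at h1
  simp only [SymForm.bil_sub, _root_.sub_apply]
  linarith

namespace AffineJetAut

variable {Vt : Set (Rn n)} (Ψ : AffineJetAut n Vt)

theorem act_injective (y : Rn n) : Function.Injective (Ψ.act y) := by
  rintro ⟨r, p, A⟩ ⟨r', p', A'⟩ h
  have h := add_right_cancel h
  obtain ⟨h1, h2, h3⟩ : r = r' ∧ Ψ.g y p = Ψ.g y p' ∧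
      SymForm.pull (Ψ.k y : Rn n →L[ℝ] Rn n) A + Ψ.L y p =
        SymForm.pull (Ψ.k y : Rn n →L[ℝ] Rn n) A' + Ψ.L y p' := by
    simpa only [Prod.mk.injEq] using h
  obtain rfl := h1
  obtain rfl := (Ψ.g y).injective h2
  have h4 := add_right_cancel h3
  have h5 : A = A' := by
    refine SymForm.ext fun v w => ?_
    have := congrArg (fun B : SymForm n => B.bil ((Ψ.k y).symm v) ((Ψ.k y).symm w)) h4
    simpa using this
  rw [h5]

theorem act_surjective (y : Rn n) : Function.Surjective (Ψ.act y) := by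
  intro d
  set a := ‖((Ψ.g y).symm : (Rn n →L[ℝ] ℝ) →L[ℝ] (Rn n →L[ℝ] ℝ))‖
  set b := ‖((Ψ.k y).symm : Rn n →L[ℝ] Rn n)‖
  have ha : 0 ≤ a := by positivity
  have hb : 0 ≤ b := by positivity
  have hc : 0 ≤ ‖Ψ.L y‖ := by positivity
  obtain ⟨d', -, h⟩ := Ψ.exists_act_add (y := y) (Λ := 1 + a + b + ‖Ψ.L y‖) (by linarith)
    (by linarith) (by linarith) (by linarith) 0 (d - Ψ.act y 0)
  exact ⟨0 + d', by rw [h]; abel⟩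

theorem continuous_act (y : Rn n) : Continuous (Ψ.act y) := by
  have hpull : Continuous (SymForm.pull (Ψ.k y : Rn n →L[ℝ] Rn n)) := by
    let T : SymForm n →ₗ[ℝ] SymForm n :=
      { toFun := SymForm.pull (Ψ.k y : Rn n →L[ℝ] Rn n)
        map_add' := SymForm.pull_add _
        map_smul' := fun t A => SymForm.ext fun v w => by simp }
    exact T.continuous_of_finiteDimensional
  unfold AffineJetAut.act
  fun_prop

end AffineJetAut

end UpperJets

/-! ### Viscosity subsolutions and comparison -/

section Viscosity

variable {n : ℕ} {X : Type*} [TopologicalSpace X] [ChartedSpace (Rn n) X]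

/-- The viscosity condition at a point for a real function: jets of upper `C²` test functions lie
in `G`. -/
def ViscAt (G : Set (JetBundle n X)) (u : X → ℝ) (x : X) : Prop :=
  ∀ φ : X → ℝ, ContMDiffAt 𝓘(ℝ, Rn n) 𝓘(ℝ, ℝ) 2 φ x → (∀ᶠ z in 𝓝 x, u z ≤ φ z) →
    u x = φ x → jetAt n x φ ∈ fibre G x

theorem tendsto_chart_sub {X : Type*} [TopologicalSpace X]
    {e : OpenPartialHomeomorph X (Rn n)} {y : Rn n} (hy : y ∈ e.target) :
    Tendsto (fun z => e z - y) (𝓝 (e.symm y)) (𝓝 0) := by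
  have h1 := (e.continuousAt (e.map_target hy)).tendsto
  rw [e.right_inv hy] at h1
  simpa using h1.sub_const y

/-- An upper jet holds only up to `ε * ‖h‖ ^ 2`. Adding this quadratic to its polynomial gives a
genuine test function, and closedness of `G` allows `ε` to tend to `0`. -/
theorem ViscAt.ofChart_mem {G : Set (JetBundle n X)} (hG : IsClosed G)
    {e : OpenPartialHomeomorph X (Rn n)} (he : e ∈ IsManifold.maximalAtlas 𝓘(ℝ, Rn n) ∞ X)
    {y : Rn n} (hy : y ∈ e.target) {u : X → ℝ} (hu : ViscAt G u (e.symm y))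
    {p : Rn n →L[ℝ] ℝ} {A : SymForm n} (hj : IsUpperJet (u ∘ e.symm) y p A.bil) :
    ofChart e y (u (e.symm y), p, A) ∈ G := by
  have key : ∀ ε : ℝ, 0 < ε → ofChart e y (u (e.symm y), p, A + (2 * ε) • SymForm.one n) ∈ G := by
    intro ε hε
    set j : Jet n := (u (e.symm y), p, A + (2 * ε) • SymForm.one n) with hjdef
    refine hu (fun z => j.poly (e z - y)) ?_ ?_ ?_
    · exact contMDiffAt_comp_chart he (e.map_target hy) (h := fun w => j.poly (w - y))
        (contDiff_poly j y).contDiffAt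
    · filter_upwards [(tendsto_chart_sub hy).eventually (hj ε hε),
        e.open_source.mem_nhds (e.map_target hy)] with z hz hzs
      rw [add_sub_cancel] at hz
      simp only [Function.comp_apply, e.left_inv hzs] at hz
      refine hz.trans (le_of_eq ?_)
      simp only [Jet.poly, hjdef, SymForm.bil_add, SymForm.bil_smul, _root_.add_apply,
        _root_.smul_apply, SymForm.one_apply, real_inner_self_eq_norm_sq, smul_eq_mul]
      ring
    · simp [Jet.poly, hjdef, e.right_inv hy]
  by_contra hcon
  obtain ⟨r, hr, -, hball⟩ := exists_ball_ofChart_mem he hG.isOpen_compl hy hcon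
  refine hball y (Metric.mem_ball_self hr) (u (e.symm y), p, A + (2 * (r / 4)) • SymForm.one n) ?_
    (key _ (by positivity))
  rw [Prod.mk_sub_mk, Prod.mk_sub_mk, sub_self, sub_self, add_sub_cancel_left]
  have h1 : ‖(2 * (r / 4)) • SymForm.one n‖ ≤ r / 2 := by
    rw [norm_smul, Real.norm_of_nonneg (by positivity)]
    have := SymForm.norm_one_le (n := n)
    nlinarith
  rw [Prod.norm_mk, Prod.norm_mk, norm_zero, norm_zero]
  refine max_lt hr (max_lt hr ?_)
  linarith

/-- A criterion for being open in the jet bundle. -/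
theorem isOpen_jetBundle_iff {O : Set (JetBundle n X)} :
    IsOpen O ↔ ∀ e ∈ IsManifold.maximalAtlas 𝓘(ℝ, Rn n) ∞ X,
      IsOpen {q : e.target × Jet n | ofChart e (q.1 : Rn n) q.2 ∈ O} := by
  refine isOpen_iSup_iff.trans ?_
  rw [Subtype.forall]
  exact forall₂_congr fun e he => isOpen_coinduced

/-- Duality may be tested fibre by fibre because interiors in the fibre and in the total space
agree. -/
theorem IsSubequation.mem_fibre_dual {F : Set (JetBundle n X)} (hF : IsSubequation F) {x : X}
    {j : Jet n} : j ∈ fibre (dual F) x ↔ -j ∉ interior (fibre F x) := by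
  rw [hF.interior_fibre]
  rfl

variable [IsManifold 𝓘(ℝ, Rn n) ∞ X]

/-- Coordinate changes are linear on fibres, so negation of jets is continuous in every
trivialization. -/
theorem isClosed_dual (F : Set (JetBundle n X)) : IsClosed (dual F) := by
  rw [← isOpen_compl_iff, isOpen_jetBundle_iff]
  intro e he
  have h : Continuous fun q : e.target × Jet n => (q.1, -q.2) := by fun_prop
  have h2 := (isOpen_interior (s := F)).preimage ((continuous_ofChart he).comp h)
  convert h2 using 1
  ext q
  have e1 : ofChart e (q.1 : Rn n) (-q.2) =
      ⟨(ofChart e (q.1 : Rn n) q.2).base, -(ofChart e (q.1 : Rn n) q.2).fib⟩ := by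
    rw [ofChart_eq he q.1.2, ofChart_eq he q.1.2, map_neg]
  simp only [dual, mem_compl_iff, mem_ofPred_eq, not_not, mem_preimage, Function.comp_apply, e1]

theorem ofChart_add_mem {F M : Set (JetBundle n X)} (hM : IsMonotonicityCone M F)
    {e : OpenPartialHomeomorph X (Rn n)} (he : e ∈ IsManifold.maximalAtlas 𝓘(ℝ, Rn n) ∞ X)
    {y : Rn n} (hy : y ∈ e.target) {j m : Jet n} (hj : ofChart e y j ∈ F)
    (hm : ofChart e y m ∈ M) : ofChart e y (j + m) ∈ F := by
  rw [ofChart_mem he hy] at hj hm ⊢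
  rw [map_add]
  exact hM.add_mem _ _ hj _ hm

theorem ofChart_smul_mem {F M : Set (JetBundle n X)} (hM : IsMonotonicityCone M F)
    {e : OpenPartialHomeomorph X (Rn n)} (he : e ∈ IsManifold.maximalAtlas 𝓘(ℝ, Rn n) ∞ X)
    {y : Rn n} (hy : y ∈ e.target) {m : Jet n} (hm : ofChart e y m ∈ M) {t : ℝ} (ht : 0 < t) :
    ofChart e y (t • m) ∈ M := by
  rw [ofChart_mem he hy] at hm ⊢
  rw [map_smul]
  exact hM.cone _ _ hm t ht

/-- Near a point, all jets close to a multiple of that of a strictly subharmonic function lie in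
the monotonicity cone. -/
theorem exists_ball_cone {F M : Set (JetBundle n X)} (hM : IsMonotonicityCone M F) {ψ : X → ℝ}
    (hψ : IsStrictlySubharmonic M ψ) {e : OpenPartialHomeomorph X (Rn n)}
    (he : e ∈ IsManifold.maximalAtlas 𝓘(ℝ, Rn n) ∞ X) {y₀ : Rn n} (hy₀ : y₀ ∈ e.target) :
    ∃ r > 0, Metric.ball y₀ r ⊆ e.target ∧ ∀ y ∈ Metric.ball y₀ r, ∀ t > 0, ∀ j : Jet n,
      ‖j - t • jetF (ψ ∘ e.symm) y₀‖ < t * r → ofChart e y j ∈ M := by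
  have h1 : ofChart e y₀ (jetF (ψ ∘ e.symm) y₀) ∈ interior M := by
    rw [ofChart_jetF he hy₀ hψ.1.contMDiffAt]
    have := hψ.2 (e.symm y₀)
    rwa [hM.isSubequation.interior_fibre] at this
  obtain ⟨r, hr, hsub, hball⟩ := exists_ball_ofChart_mem he isOpen_interior hy₀ h1
  refine ⟨r, hr, hsub, fun y hy t ht j hj => ?_⟩
  have h2 : ‖t⁻¹ • j - jetF (ψ ∘ e.symm) y₀‖ < r := by
    have h3 : j - t • jetF (ψ ∘ e.symm) y₀ = t • (t⁻¹ • j - jetF (ψ ∘ e.symm) y₀) := by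
      rw [smul_sub, smul_inv_smul₀ ht.ne']
    rw [h3, norm_smul, Real.norm_of_nonneg ht.le] at hj
    exact lt_of_mul_lt_mul_left hj ht.le
  have h4 := ofChart_smul_mem hM he (hsub hy) (interior_subset (hball y hy _ h2)) ht
  rwa [smul_inv_smul₀ ht.ne'] at h4

/-- If the jet of `v` at a point lies in the dual, its negative is not interior after a jet
equivalence. -/
theorem act_neg_notMem_interior {F : Set (JetBundle n X)} (hF : IsSubequation F)
    {e : OpenPartialHomeomorph X (Rn n)} (he : e ∈ IsManifold.maximalAtlas 𝓘(ℝ, Rn n) ∞ X)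
    {F₀ : Set (Jet n)} {Ψ : AffineJetAut n e.target} {y : Rn n} (hy : y ∈ e.target)
    (hΨ : Ψ.act y '' {j | ofChart e y j ∈ F} = F₀) {j : Jet n} (hj : ofChart e y j ∈ dual F) :
    Ψ.act y (-j) ∉ interior F₀ := by
  intro hin
  rw [ofChart_mem he hy, hF.mem_fibre_dual, ← map_neg] at hj
  refine hj ?_
  have h1 : Ψ.act y ⁻¹' interior F₀ ⊆ {j | ofChart e y j ∈ F} := by
    intro k hk
    have hk' : Ψ.act y k ∈ F₀ := interior_subset hk
    rw [← hΨ] at hk'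
    obtain ⟨k', hk', he'⟩ := hk'
    rwa [← Ψ.act_injective y he']
  have h2 : fibreMap he hy '' (Ψ.act y ⁻¹' interior F₀) ⊆ fibre F (e.symm y) := by
    rintro _ ⟨k, hk, rfl⟩
    exact h1 hk
  exact interior_maximal h2
    (isOpenMap_fibreMap he hy _ (isOpen_interior.preimage (Ψ.continuous_act y))) ⟨-j, hin, rfl⟩

/-- The interior maximum principle behind comparison: `u + v + ε ψ` has no local maximum with
positive value. -/
theorem no_positive_local_max {F M : Set (JetBundle n X)} (hF : IsSubequation F)
    (hM : IsMonotonicityCone M F) {F₀ : Set (Jet n)} (hF₀ : IsConstSubequation F₀)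
    (hjet : LocallyAffinelyJetEquivalent F F₀) {ψ : X → ℝ} (hψ : IsStrictlySubharmonic M ψ)
    {Ω : Set X} (hΩ : IsOpen Ω) {u v : X → ℝ} (hu : UpperSemicontinuousOn u Ω)
    (hv : UpperSemicontinuousOn v Ω) (huF : ∀ x ∈ Ω, ViscAt F u x)
    (hvF : ∀ x ∈ Ω, ViscAt (dual F) v x) {ε : ℝ} (hε : 0 < ε) {x₀ : X} (hx₀ : x₀ ∈ Ω)
    (hmax : ∀ x ∈ Ω, u x + v x + ε * ψ x ≤ u x₀ + v x₀ + ε * ψ x₀)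
    (hpos : 0 < u x₀ + v x₀ + ε * ψ x₀) : False := by
  obtain ⟨e, he, hxe, Ψ, hΨ⟩ := hjet x₀
  set y₀ := e x₀ with hy₀
  have hy₀t : y₀ ∈ e.target := e.map_source hxe
  have hey₀ : e.symm y₀ = x₀ := e.left_inv hxe
  obtain ⟨r, hr, hrt, hcone⟩ := exists_ball_cone hM hψ he hy₀t
  -- The term `-η * ‖z - y₀‖ ^ 2` makes the maximum strict. Its jet, the variation of the jet of
  -- `h`, and the perturbation `d` take at most `ε * r / 4` each, within the room `ε * r` that the
  -- cone leaves around `ε` times the jet of `ψ`.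
  set η := ε * r / 8 with hη
  have hη0 : 0 < η := by positivity
  set J : Jet n := (0, 0, (-(2 * η)) • SymForm.one n) with hJ
  set h : Rn n → ℝ := fun z => ε * (ψ ∘ e.symm) z + J.poly (z - y₀) with hh
  have hJpoly : ∀ z, J.poly z = -(η * ‖z‖ ^ 2) := by
    intro z
    simp only [Jet.poly, hJ, SymForm.bil_smul, _root_.zero_apply, _root_.smul_apply,
      SymForm.one_apply, real_inner_self_eq_norm_sq, smul_eq_mul]
    ring
  have hψe : ∀ z ∈ e.target, ContDiffAt ℝ 2 (ψ ∘ e.symm) z := fun z hz =>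
    contDiffAt_comp_symm he hz hψ.1.contMDiffAt
  have hC2 : ∀ z ∈ e.target, ContDiffAt ℝ 2 h z := fun z hz =>
    (contDiffAt_const.mul (hψe z hz)).add (contDiff_poly J y₀).contDiffAt
  have hmul2 : ContDiffAt ℝ 2 (fun z => ε * (ψ ∘ e.symm) z) y₀ :=
    contDiffAt_const.mul (hψe y₀ hy₀t)
  have hj0 : jetF h y₀ = ε • jetF (ψ ∘ e.symm) y₀ + J := by
    rw [hh, jetF_add hmul2 (contDiff_poly J y₀).contDiffAt, jetF_mul (hψe y₀ hy₀t), jetF_poly]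
  have hJn : ‖J‖ ≤ ε * r / 4 := by
    rw [hJ, Prod.norm_mk, Prod.norm_mk, norm_zero, norm_zero]
    refine max_le (by positivity) (max_le (by positivity) ?_)
    rw [norm_smul, norm_neg, Real.norm_of_nonneg (by positivity)]
    have := SymForm.norm_one_le (n := n)
    calc 2 * η * ‖SymForm.one n‖ ≤ 2 * η * 1 := by gcongr
      _ = _ := by rw [hη]; ring
  have hev1 : ∀ᶠ y in 𝓝 y₀, ‖jetF h y - jetF h y₀‖ < ε * r / 4 := by
    have := continuousAt_jetF (hC2 y₀ hy₀t)
    have h2 := Metric.tendsto_nhds.1 this (ε * r / 4) (by positivity)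
    simpa only [dist_eq_norm] using h2
  have hev2 : ∀ᶠ y in 𝓝 y₀, e.symm y ∈ Ω := by
    have := (e.continuousAt_symm hy₀t).tendsto
    rw [hey₀] at this
    exact this.eventually (hΩ.mem_nhds hx₀)
  obtain ⟨R, hR, hball⟩ := Metric.nhds_basis_closedBall.eventually_iff.1
    ((hev1.and hev2).and (Metric.ball_mem_nhds y₀ hr))
  set K := Metric.closedBall y₀ R with hK
  have hKt : K ⊆ e.target := fun y hy => hrt (hball hy).2
  have hmaps : MapsTo e.symm K Ω := fun y hy => (hball hy).1.2
  have hcs : ContinuousOn e.symm K := e.continuousOn_symm.mono hKt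
  have hhc : ContinuousOn h K := fun y hy => (hC2 y (hKt hy)).continuousAt.continuousWithinAt
  refine local_comparison hF₀.posNeg e.open_target Ψ (isCompact_closedBall y₀ R) hy₀t
    (mem_interior_iff_mem_nhds.2 (Metric.closedBall_mem_nhds y₀ hR))
    (u := fun z => (u ∘ e.symm) z + h z) (v := v ∘ e.symm)
    ((hu.comp hcs hmaps).add hhc.upperSemicontinuousOn) (hv.comp hcs hmaps) ?_ ?_
    (c := ε * r / 4) (by positivity) ?_ ?_
  · intro z hz hne
    have h1 := hmax _ (hmaps hz)
    have h2 : 0 < η * ‖z - y₀‖ ^ 2 := by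
      have : 0 < ‖z - y₀‖ := norm_pos_iff.2 (sub_ne_zero.2 hne)
      positivity
    simp only [hh, Function.comp_apply, hJpoly, sub_self, norm_zero, hey₀]
    linarith
  · simp only [hh, Function.comp_apply, hJpoly, sub_self, norm_zero, hey₀]
    linarith
  · intro y hy p A hjet d hd
    have hyK := interior_subset hy
    have hyt := hKt hyK
    have h1 := (huF _ (hmaps hyK)).ofChart_mem hF.isClosed he hyt
      (hjet.sub_contDiffAt (hC2 y hyt))
    have h2 : ofChart e y (jetF h y + d) ∈ M := by
      refine hcone y (hball hyK).2 ε hε _ ?_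
      have e1 : jetF h y + d - ε • jetF (ψ ∘ e.symm) y₀ =
          (jetF h y - jetF h y₀) + J + d := by rw [hj0]; abel
      rw [e1]
      have := norm_add₃_le (a := jetF h y - jetF h y₀) (b := J) (c := d)
      have h4 := (hball hyK).1.1
      have : 0 < ε * r := by positivity
      linarith
    have h3 := ofChart_add_mem hM he hyt h1 h2
    rw [← hΨ y hyt]
    refine ⟨_, ?_, rfl⟩
    rw [mem_ofPred_eq]
    convert h3 using 2
    refine Prod.ext ?_ (Prod.ext ?_ ?_)
    · change u (e.symm y) + h y + d.1 = u (e.symm y) + (h y + d.1)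
      ring
    · simp only [Prod.fst_add, Prod.snd_add]; abel
    · simp only [Prod.snd_add]; abel
  · intro y hy p A hjet
    have hyK := interior_subset hy
    have hyt := hKt hyK
    exact act_neg_notMem_interior hF he hyt (hΨ y hyt)
      ((hvF _ (hmaps hyK)).ofChart_mem (isClosed_dual F) he hyt hjet)

/-- **Comparison.** -/
theorem comparison {F M : Set (JetBundle n X)} (hF : IsSubequation F)
    (hM : IsMonotonicityCone M F) {F₀ : Set (Jet n)} (hF₀ : IsConstSubequation F₀)
    (hjet : LocallyAffinelyJetEquivalent F F₀) {ψ : X → ℝ} (hψ : IsStrictlySubharmonic M ψ)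
    {Ω : Set X} (hΩ : IsOpen Ω) (hΩc : IsCompact (closure Ω)) {u v : X → ℝ}
    (hu : UpperSemicontinuousOn u (closure Ω)) (hv : UpperSemicontinuousOn v (closure Ω))
    (huF : ∀ x ∈ Ω, ViscAt F u x) (hvF : ∀ x ∈ Ω, ViscAt (dual F) v x)
    (hbd : ∀ x ∈ frontier Ω, u x + v x ≤ 0) : ∀ x ∈ closure Ω, u x + v x ≤ 0 := by
  intro x hx
  by_contra! hpos
  set m := u x + v x with hm
  have hψc : Continuous ψ := hψ.1.continuous
  obtain ⟨b, hb⟩ := hΩc.exists_bound_of_continuousOn hψc.continuousOn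
  have hb0 : 0 ≤ b := (norm_nonneg _).trans (hb x hx)
  -- Then `ε * ψ` varies by at most `m / 2`, so `u + v` stays positive at a maximum point of the
  -- perturbed sum, which is therefore off the boundary.
  set ε := m / (4 * (b + 1)) with hε
  have hε0 : 0 < ε := by positivity
  have hεb : ε * b ≤ m / 4 := by
    have : ε * (b + 1) = m / 4 := by rw [hε]; field_simp
    nlinarith
  have hw : UpperSemicontinuousOn (fun z => u z + v z + ε * ψ z) (closure Ω) :=
    (hu.add hv).add (continuous_const.mul hψc).continuousOn.upperSemicontinuousOn
  obtain ⟨x₀, hx₀, hmax⟩ := UpperSemicontinuousOn.exists_isMaxOn ⟨x, hx⟩ hΩc hw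
  have hψb : ∀ z ∈ closure Ω, -(m / 4) ≤ ε * ψ z ∧ ε * ψ z ≤ m / 4 := by
    intro z hz
    have h1 := abs_le.1 (hb z hz)
    constructor
    · have := mul_le_mul_of_nonneg_left h1.1 hε0.le
      linarith
    · have := mul_le_mul_of_nonneg_left h1.2 hε0.le
      linarith
  have h1 : u x + v x + ε * ψ x ≤ u x₀ + v x₀ + ε * ψ x₀ := hmax hx
  have h2 := hψb x hx
  have h3 := hψb x₀ hx₀
  have hx₀Ω : x₀ ∈ Ω := by
    by_contra hn
    have hfr : x₀ ∈ frontier Ω := by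
      rw [hΩ.frontier_eq]
      exact ⟨hx₀, hn⟩
    have := hbd x₀ hfr
    linarith
  exact no_positive_local_max hF hM hF₀ hjet hψ hΩ (hu.mono subset_closure)
    (hv.mono subset_closure) huF hvF hε0 hx₀Ω (fun z hz => hmax (subset_closure hz))
    (by linarith)

end Viscosity

/-! ### Coordinate balls and stability of open jet conditions -/

section ChartBalls

variable {n : ℕ} {X : Type*} [TopologicalSpace X] [ChartedSpace (Rn n) X]

/-- The squared distance to `x` in the preferred chart at `x`. -/
def chartSq (n : ℕ) {X : Type*} [TopologicalSpace X] [ChartedSpace (Rn n) X] (x z : X) : ℝ :=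
  ‖chartAt (Rn n) x z - chartAt (Rn n) x x‖ ^ 2

/-- The closed coordinate ball about `x`. -/
def chartDisc (n : ℕ) {X : Type*} [TopologicalSpace X] [ChartedSpace (Rn n) X] (x : X) (R : ℝ) :
    Set X :=
  {z | z ∈ (chartAt (Rn n) x).source ∧ ‖chartAt (Rn n) x z - chartAt (Rn n) x x‖ ≤ R}

/-- The open coordinate ball about `x`. -/
def chartBall (n : ℕ) {X : Type*} [TopologicalSpace X] [ChartedSpace (Rn n) X] (x : X) (R : ℝ) :
    Set X :=
  {z | z ∈ (chartAt (Rn n) x).source ∧ ‖chartAt (Rn n) x z - chartAt (Rn n) x x‖ < R}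

theorem chartSq_self (x : X) : chartSq n x x = 0 := by simp [chartSq]

theorem chartSq_nonneg (x z : X) : 0 ≤ chartSq n x z := sq_nonneg _

theorem isOpen_chartBall (x : X) (R : ℝ) : IsOpen (chartBall n x R) := by
  have h := (chartAt (Rn n) x).continuousOn.isOpen_inter_preimage
    (chartAt (Rn n) x).open_source (Metric.isOpen_ball (x := chartAt (Rn n) x x) (ε := R))
  convert h using 1
  ext z
  simp [chartBall, dist_eq_norm]

theorem mem_chartBall_self (x : X) {R : ℝ} (hR : 0 < R) : x ∈ chartBall n x R :=
  ⟨mem_chart_source (Rn n) x, by simpa using hR⟩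

theorem chartBall_subset_chartDisc (x : X) (R : ℝ) : chartBall n x R ⊆ chartDisc n x R :=
  fun _ h => ⟨h.1, h.2.le⟩

theorem isCompact_chartDisc {x : X} {R : ℝ}
    (h : Metric.closedBall (chartAt (Rn n) x x) R ⊆ (chartAt (Rn n) x).target) :
    IsCompact (chartDisc n x R) := by
  have h1 := (isCompact_closedBall (chartAt (Rn n) x x) R).image_of_continuousOn
    ((chartAt (Rn n) x).continuousOn_symm.mono h)
  convert h1 using 1
  ext z
  constructor
  · rintro ⟨hz, hzR⟩
    exact ⟨chartAt (Rn n) x z, by rwa [Metric.mem_closedBall, dist_eq_norm],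
      (chartAt (Rn n) x).left_inv hz⟩
  · rintro ⟨y, hy, rfl⟩
    refine ⟨(chartAt (Rn n) x).map_target (h hy), ?_⟩
    rw [(chartAt (Rn n) x).right_inv (h hy), ← dist_eq_norm]
    exact hy

theorem jetF_const (c : ℝ) (y : Rn n) : jetF (fun _ => c) y = (c, 0, 0) := by
  rw [jetF_eq (h' := fun _ => 0) (Eventually.of_forall fun z => hasFDerivAt_const c z)
    (hasFDerivAt_const _ y)]
  exact Prod.ext rfl (Prod.ext rfl (map_zero (SymForm.ofBilinL n)))

theorem jetAt_const (c : ℝ) (x : X) : jetAt n x (fun _ => c) = (c, 0, 0) := by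
  rw [jetAt_eq]
  exact jetF_const c _

variable [IsManifold 𝓘(ℝ, Rn n) ∞ X]

theorem contMDiffAt_chartSq {x z : X} (hz : z ∈ (chartAt (Rn n) x).source) :
    ContMDiffAt 𝓘(ℝ, Rn n) 𝓘(ℝ, ℝ) 2 (chartSq n x) z :=
  contMDiffAt_comp_chart (IsManifold.chart_mem_maximalAtlas x) hz
    (h := fun w => ‖w - chartAt (Rn n) x x‖ ^ 2)
    (by
      have h : ContDiff ℝ 2 fun w : Rn n => ‖w - chartAt (Rn n) x x‖ ^ 2 :=
        (contDiff_id.sub contDiff_const).norm_sq ℝ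
      exact h.contDiffAt)

theorem jetAt_add_const {x : X} {f : X → ℝ} (hf : ContMDiffAt 𝓘(ℝ, Rn n) 𝓘(ℝ, ℝ) 2 f x) (c : ℝ) :
    jetAt n x (fun z => f z + c) = jetAt n x f + (c, 0, 0) := by
  rw [jetAt_add hf contMDiffAt_const, jetAt_const]

/-- If the jet of `f` at `x` lies in an open set of jets, so do the jets of all small quadratic
perturbations of `f` at all nearby points. -/
theorem exists_perturbation {f : X → ℝ} {x : X}
    (hf : ContMDiffAt 𝓘(ℝ, Rn n) 𝓘(ℝ, ℝ) 2 f x) {O : Set (JetBundle n X)} (hO : IsOpen O)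
    (h : (⟨x, jetAt n x f⟩ : JetBundle n X) ∈ O) :
    ∃ η > 0, ∀ A ∈ 𝓝 x, ∃ R > 0, (∀ R' ≤ R, IsCompact (chartDisc n x R')) ∧
      ∀ z ∈ chartDisc n x R, z ∈ A ∧ ContMDiffAt 𝓘(ℝ, Rn n) 𝓘(ℝ, ℝ) 2 f z ∧
        ∀ s κ, |s| ≤ η → |κ| ≤ η →
          (⟨z, jetAt n z (fun w => f w + s * chartSq n x w + κ)⟩ : JetBundle n X) ∈ O := by
  set e := chartAt (Rn n) x with he
  have hex : x ∈ e.source := mem_chart_source (Rn n) x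
  have hmem : e ∈ IsManifold.maximalAtlas 𝓘(ℝ, Rn n) ∞ X := IsManifold.chart_mem_maximalAtlas x
  set y₀ := e x with hy₀
  have hyt : y₀ ∈ e.target := e.map_source hex
  have hsy : e.symm y₀ = x := e.left_inv hex
  have h1 : ofChart e y₀ (jetF (f ∘ e.symm) y₀) ∈ O := by
    rw [ofChart_jetF hmem hyt (by rwa [hsy]), hsy]
    exact h
  obtain ⟨r, hr, hrt, hball⟩ := exists_ball_ofChart_mem hmem hO hyt h1
  have hq : ∀ z ∈ e.source, ContMDiffAt 𝓘(ℝ, Rn n) 𝓘(ℝ, ℝ) 2 (chartSq n x) z :=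
    fun z hz => contMDiffAt_chartSq hz
  have cf := continuousAt_jetF (contDiffAt_comp_symm hmem hyt (f := f) (by rwa [hsy]))
  have cq := continuousAt_jetF (contDiffAt_comp_symm hmem hyt (f := chartSq n x)
    (by rw [hsy]; exact hq x hex))
  set b := ‖jetF (chartSq n x ∘ e.symm) y₀‖ + 1 with hb
  have hb0 : 0 < b := by positivity
  have hev1 : ∀ᶠ y in 𝓝 y₀, ‖jetF (f ∘ e.symm) y - jetF (f ∘ e.symm) y₀‖ < r / 2 := by
    have h2 := Metric.tendsto_nhds.1 cf (r / 2) (by positivity)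
    simpa only [dist_eq_norm] using h2
  have hev2 : ∀ᶠ y in 𝓝 y₀, ‖jetF (chartSq n x ∘ e.symm) y‖ < b :=
    cq.norm.eventually (gt_mem_nhds (by rw [hb]; linarith))
  -- `η` is fixed before `A`: half the room is for `f`, half for the quadratic and the constant. In
  -- the barrier construction `A` depends on `η`.
  refine ⟨r / (2 * (b + 1)), by positivity, fun A hA => ?_⟩
  have hsymm : Tendsto e.symm (𝓝 y₀) (𝓝 x) := by
    have := (e.continuousAt_symm hyt).tendsto
    rwa [hsy] at this
  have hev3 : ∀ᶠ y in 𝓝 y₀, e.symm y ∈ A := hsymm.eventually hA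
  have hev4 : ∀ᶠ y in 𝓝 y₀, ContMDiffAt 𝓘(ℝ, Rn n) 𝓘(ℝ, ℝ) 2 f (e.symm y) := by
    have : IsManifold 𝓘(ℝ, Rn n) 2 X := IsManifold.of_le (n := ∞) (by norm_cast)
    exact hsymm.eventually ((contMDiffAt_iff_contMDiffAt_nhds (by simp)).1 hf)
  obtain ⟨R, hR, hRb⟩ := Metric.nhds_basis_closedBall.eventually_iff.1
    (((hev1.and hev2).and (hev3.and hev4)).and (Metric.ball_mem_nhds y₀ hr))
  refine ⟨R, hR, fun R' hR' => isCompact_chartDisc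
    ((Metric.closedBall_subset_closedBall hR').trans fun y hy => hrt (hRb hy).2), ?_⟩
  rintro z ⟨hz, hzR⟩
  have hzb : e z ∈ Metric.closedBall y₀ R := by rwa [Metric.mem_closedBall, dist_eq_norm]
  have hsz : e.symm (e z) = z := e.left_inv hz
  have hzt : e z ∈ e.target := e.map_source hz
  obtain ⟨⟨⟨a1, a2⟩, a3, a4⟩, a5⟩ := hRb hzb
  rw [hsz] at a3 a4
  refine ⟨a3, a4, fun s κ hs hκ => ?_⟩
  have hsq : ContMDiffAt 𝓘(ℝ, Rn n) 𝓘(ℝ, ℝ) 2 (fun w => s * chartSq n x w) z :=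
    contMDiffAt_const.mul (hq z hz)
  have hfs : ContMDiffAt 𝓘(ℝ, Rn n) 𝓘(ℝ, ℝ) 2 (fun w => f w + s * chartSq n x w) z := a4.add hsq
  have hall : ContMDiffAt 𝓘(ℝ, Rn n) 𝓘(ℝ, ℝ) 2 (fun w => f w + s * chartSq n x w + κ) z :=
    hfs.add contMDiffAt_const
  have h2 := ofChart_jetF hmem hzt (f := fun w => f w + s * chartSq n x w + κ) (by rwa [hsz])
  rw [hsz] at h2
  rw [← h2]
  refine hball _ a5 _ ?_
  have c1 : ContDiffAt ℝ 2 (f ∘ e.symm) (e z) := contDiffAt_comp_symm hmem hzt (by rwa [hsz])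
  have c2 : ContDiffAt ℝ 2 (chartSq n x ∘ e.symm) (e z) :=
    contDiffAt_comp_symm hmem hzt (by rw [hsz]; exact hq z hz)
  have c3 : ContDiffAt ℝ 2 (fun y => s * (chartSq n x ∘ e.symm) y) (e z) := contDiffAt_const.mul c2
  have e1 : jetF ((fun w => f w + s * chartSq n x w + κ) ∘ e.symm) (e z) =
      jetF (f ∘ e.symm) (e z) + s • jetF (chartSq n x ∘ e.symm) (e z) + (κ, 0, 0) := by
    rw [← jetF_mul c2, ← jetF_const κ (e z), ← jetF_add c1 c3]
    exact jetF_add (c1.add c3) contDiffAt_const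
  rw [e1, show jetF (f ∘ e.symm) (e z) + s • jetF (chartSq n x ∘ e.symm) (e z) + (κ, 0, 0) -
    jetF (f ∘ e.symm) y₀ = (jetF (f ∘ e.symm) (e z) - jetF (f ∘ e.symm) y₀) +
      s • jetF (chartSq n x ∘ e.symm) (e z) + (κ, 0, 0) by abel]
  have n1 : ‖s • jetF (chartSq n x ∘ e.symm) (e z)‖ ≤ r / (2 * (b + 1)) * b := by
    rw [norm_smul, Real.norm_eq_abs]
    gcongr
  have n2 : ‖((κ, 0, 0) : Jet n)‖ ≤ r / (2 * (b + 1)) := by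
    rw [Prod.norm_mk, Prod.norm_mk, norm_zero, norm_zero, max_self, Real.norm_eq_abs]
    exact max_le hκ (by positivity)
  have n3 : r / (2 * (b + 1)) * b + r / (2 * (b + 1)) = r / 2 := by field_simp
  have n4 := norm_add₃_le (a := jetF (f ∘ e.symm) (e z) - jetF (f ∘ e.symm) y₀)
    (b := s • jetF (chartSq n x ∘ e.symm) (e z)) (c := ((κ, 0, 0) : Jet n))
  linarith

end ChartBalls

/-! ### Gluing and upper semicontinuous envelopes -/

section Envelopes

open Classical in
/-- Replacement of `b` by the larger of `a` and `b` on `W`. -/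
def glue {X : Type*} (W : Set X) (a b : X → ℝ) (x : X) : ℝ := if x ∈ W then max (a x) (b x) else b x

theorem glue_of_mem {X : Type*} {W : Set X} {a b : X → ℝ} {x : X} (hx : x ∈ W) :
    glue W a b x = max (a x) (b x) := if_pos hx

theorem glue_of_notMem {X : Type*} {W C : Set X} {S : Set X} {a b : X → ℝ}
    (hab : ∀ x ∈ S, x ∈ W → x ∉ C → a x < b x) {x : X} (hx : x ∈ S) (hxC : x ∉ C) :
    glue W a b x = b x := by
  unfold glue
  split_ifs with hW
  · exact max_eq_right (hab x hx hW hxC).le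
  · rfl

variable {X : Type*} [TopologicalSpace X]

/-- Locally the glued function is a maximum (inside `W`) or just `b` (off `C`), and these two open
sets cover `S`. -/
theorem upperSemicontinuousOn_glue {W C S : Set X} {a b : X → ℝ} (hW : IsOpen W)
    (hC : IsClosed C) (hCW : C ⊆ W) (hab : ∀ x ∈ S, x ∈ W → x ∉ C → a x < b x)
    (ha : ContinuousOn a W) (hb : UpperSemicontinuousOn b S) :
    UpperSemicontinuousOn (glue W a b) S := by
  intro x hx
  by_cases hxW : x ∈ W
  · have h1 : UpperSemicontinuousWithinAt (fun z => max (a z) (b z)) S x :=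
      ((ha.continuousAt (hW.mem_nhds hxW)).upperSemicontinuousAt.upperSemicontinuousWithinAt S).sup
        (hb x hx)
    refine h1.congr_of_eventuallyEq hx ?_
    filter_upwards [mem_nhdsWithin_of_mem_nhds (hW.mem_nhds hxW)] with z hz
    exact (glue_of_mem hz).symm
  · have hxC : x ∉ C := fun h => hxW (hCW h)
    refine (hb x hx).congr_of_eventuallyEq hx ?_
    filter_upwards [mem_nhdsWithin_of_mem_nhds (hC.isOpen_compl.mem_nhds hxC),
      self_mem_nhdsWithin] with z hz hzS
    rw [glue_of_notMem hab hzS hz]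
    exact fun _ => Iff.rfl

/-- The upper semicontinuous envelope of `f` relative to `S`. -/
def uscEnv (S : Set X) (f : X → ℝ) (x : X) : ℝ := sInf {c | ∀ᶠ z in 𝓝[S] x, f z ≤ c}

variable {S : Set X} {f : X → ℝ}

theorem bddBelow_uscEnv {x : X} (hx : x ∈ S) : BddBelow {c | ∀ᶠ z in 𝓝[S] x, f z ≤ c} :=
  ⟨f x, fun _ hc => hc.self_of_nhdsWithin hx⟩

theorem le_uscEnv (hf : BddAbove (f '' S)) {x : X} (hx : x ∈ S) : f x ≤ uscEnv S f x := by
  obtain ⟨b, hb⟩ := hf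
  refine le_csInf ⟨b, ?_⟩ fun c hc => ?_
  · exact eventually_nhdsWithin_of_forall fun z hz => hb ⟨z, hz, rfl⟩
  · have hc' : ∀ᶠ z in 𝓝[S] x, f z ≤ c := hc
    exact hc'.self_of_nhdsWithin hx

theorem uscEnv_le {x : X} (hx : x ∈ S) {c : ℝ} (h : ∀ᶠ z in 𝓝[S] x, f z ≤ c) :
    uscEnv S f x ≤ c := csInf_le (bddBelow_uscEnv hx) h

theorem frequently_lt_of_lt_uscEnv {x : X} (hx : x ∈ S) {c : ℝ} (h : c < uscEnv S f x) :
    ∃ᶠ z in 𝓝[S] x, c < f z := by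
  intro hcon
  refine absurd (uscEnv_le hx (c := c) ?_) (not_le.2 h)
  filter_upwards [hcon] with z hz
  exact not_lt.1 hz

theorem upperSemicontinuousOn_uscEnv (hf : BddAbove (f '' S)) :
    UpperSemicontinuousOn (uscEnv S f) S := by
  obtain ⟨b, hb⟩ := hf
  intro x hx c hc
  obtain ⟨c', hc', hlt⟩ := exists_lt_of_csInf_lt
    ⟨b, eventually_nhdsWithin_of_forall fun z hz => hb ⟨z, hz, rfl⟩⟩ hc
  have h1 : ∀ᶠ z in 𝓝[S] x, ∀ᶠ w in 𝓝[S] z, f w ≤ c' :=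
    eventually_eventually_nhdsWithin.2 hc'
  filter_upwards [h1, self_mem_nhdsWithin] with z hz hzS
  exact (uscEnv_le hzS hz).trans_lt hlt

end Envelopes

/-! ### Stability of the viscosity condition -/

section ViscosityTools

variable {n : ℕ} {X : Type*} [TopologicalSpace X] [ChartedSpace (Rn n) X]

theorem ViscAt.congr {G : Set (JetBundle n X)} {u v : X → ℝ} {x : X} (hu : ViscAt G u x)
    (h : u =ᶠ[𝓝 x] v) : ViscAt G v x := by
  intro φ hφ hle heq
  refine hu φ hφ ?_ (by rw [h.eq_of_nhds, heq])
  filter_upwards [h, hle] with z hz hz'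
  rwa [hz]

theorem ViscAt.max {G : Set (JetBundle n X)} {u v : X → ℝ} {x : X} (hu : ViscAt G u x)
    (hv : ViscAt G v x) : ViscAt G (fun z => max (u z) (v z)) x := by
  intro φ hφ hle heq
  rcases max_choice (u x) (v x) with h | h
  · exact hu φ hφ (hle.mono fun z hz => (le_max_left _ _).trans hz) (h ▸ heq)
  · exact hv φ hφ (hle.mono fun z hz => (le_max_right _ _).trans hz) (h ▸ heq)

/-- The condition depends only on germs, and the germ is that of `max a b` inside `W` and of `b` off
`C`. -/
theorem ViscAt.glue {G : Set (JetBundle n X)} {W C Ω : Set X} {a b : X → ℝ} (hΩ : IsOpen Ω)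
    (hW : IsOpen W)
    (hC : IsClosed C) (hCW : C ⊆ W) (hab : ∀ x ∈ Ω, x ∈ W → x ∉ C → a x < b x)
    (ha : ∀ x ∈ Ω, x ∈ W → ViscAt G a x) (hb : ∀ x ∈ Ω, ViscAt G b x) :
    ∀ x ∈ Ω, ViscAt G (glue W a b) x := by
  intro x hx
  by_cases hxW : x ∈ W
  · refine ((ha x hx hxW).max (hb x hx)).congr ?_
    filter_upwards [hW.mem_nhds hxW] with z hz
    exact (glue_of_mem hz).symm
  · have hxC : x ∉ C := fun h => hxW (hCW h)
    refine (hb x hx).congr ?_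
    filter_upwards [hC.isOpen_compl.mem_nhds hxC, hΩ.mem_nhds hx] with z hz hzΩ
    exact (glue_of_notMem hab hzΩ hz).symm

variable [IsManifold 𝓘(ℝ, Rn n) ∞ X]

/-- `φ - u` has a local minimum with value zero, so the two jets differ by a nonnegative Hessian and
(P) applies. -/
theorem viscAt_of_contMDiffAt {G : Set (JetBundle n X)} {x : X} (hG : PosNeg (fibre G x))
    {u : X → ℝ} (hu : ContMDiffAt 𝓘(ℝ, Rn n) 𝓘(ℝ, ℝ) 2 u x) (hj : jetAt n x u ∈ fibre G x) :
    ViscAt G u x := by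
  intro φ hφ hle heq
  have hm : ContMDiffAt 𝓘(ℝ, Rn n) 𝓘(ℝ, ℝ) 2 (fun z => (-1) * u z) x := contMDiffAt_const.mul hu
  have hd : ContMDiffAt 𝓘(ℝ, Rn n) 𝓘(ℝ, ℝ) 2 (fun z => φ z + (-1) * u z) x := hφ.add hm
  have hχ : Tendsto (chartAt (Rn n) x).symm (𝓝 (chartAt (Rn n) x x)) (𝓝 x) := by
    have := ((chartAt (Rn n) x).continuousAt_symm (mem_chart_target (Rn n) x)).tendsto
    rwa [(chartAt (Rn n) x).left_inv (mem_chart_source (Rn n) x)] at this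
  obtain ⟨A, hA, hAj⟩ := jetF_of_localMin (contDiffAt_chartAt hd)
    (by simp [(chartAt (Rn n) x).left_inv (mem_chart_source (Rn n) x), heq])
    (by
      filter_upwards [hχ.eventually hle] with z hz
      simp only [Function.comp_apply]
      linarith)
  rw [← jetAt_eq, jetAt_add hφ hm, jetAt_mul hu, neg_one_smul ℝ (jetAt n x u),
    add_neg_eq_iff_eq_add] at hAj
  rw [hAj, add_comm]
  exact hG.1 _ hj A hA

end ViscosityTools

/-! ### Global subsolutions and boundary barriers -/

section Subsolutions

variable {n : ℕ} {X : Type*} [TopologicalSpace X] [ChartedSpace (Rn n) X]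

/-- The properties, shared by a subequation and its dual, on which the construction of
subsolutions rests. -/
structure IsMonotoneFor (M G : Set (JetBundle n X)) : Prop where
  posNeg : ∀ x, PosNeg (fibre G x)
  add_mem : ∀ x, ∀ j ∈ fibre G x, ∀ m ∈ fibre M x, j + m ∈ fibre G x
  exists_interior : ∀ x, ∃ j : Jet n, (⟨x, j⟩ : JetBundle n X) ∈ interior G

/-- If `-(j + m)` were interior to the fibre of `F`, translation by `m` would make `-j` interior.
Thus translations preserving `F` preserve its dual. -/
theorem IsSubequation.dual_add_mem {F : Set (JetBundle n X)} (hF : IsSubequation F) {x : X}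
    {j m : Jet n} (hm : ∀ k ∈ fibre F x, k + m ∈ fibre F x) (hj : j ∈ fibre (dual F) x) :
    j + m ∈ fibre (dual F) x := by
  rw [hF.mem_fibre_dual] at hj ⊢
  intro h
  have h1 := add_mem_interior_of_forall hm h
  rw [show -(j + m) + m = -j by abel] at h1
  exact hj h1

variable [IsManifold 𝓘(ℝ, Rn n) ∞ X]

/-- The conditions on a subequation permit empty or full fibres; properness comes from `F₀` through
the equivalence. -/
theorem exists_mem_notMem_fibre {F : Set (JetBundle n X)} {F₀ : Set (Jet n)}
    (hF₀ : IsConstSubequation F₀) (hjet : LocallyAffinelyJetEquivalent F F₀) (x : X) :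
    (fibre F x).Nonempty ∧ ∃ j, j ∉ fibre F x := by
  obtain ⟨e, he, hx, Ψ, hΨ⟩ := hjet x
  have hy : e x ∈ e.target := e.map_source hx
  have hs : e.symm (e x) = x := e.left_inv hx
  have h := hΨ _ hy
  rw [← hs]
  constructor
  · obtain ⟨k, hk⟩ := hF₀.nonempty
    rw [← h] at hk
    obtain ⟨j, hj, -⟩ := hk
    exact ⟨_, (ofChart_mem he hy j F).1 hj⟩
  · obtain ⟨k, hk⟩ := (ne_univ_iff_exists_notMem F₀).1 hF₀.ne_univ
    obtain ⟨j, rfl⟩ := Ψ.act_surjective (e x) k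
    refine ⟨fibreMap he hy j, fun hj => hk ?_⟩
    rw [← h]
    exact mem_image_of_mem _ ((ofChart_mem he hy j F).2 hj)

theorem IsMonotonicityCone.isMonotoneFor {F M : Set (JetBundle n X)} (hF : IsSubequation F)
    (hM : IsMonotonicityCone M F) {F₀ : Set (Jet n)} (hF₀ : IsConstSubequation F₀)
    (hjet : LocallyAffinelyJetEquivalent F F₀) : IsMonotoneFor M F where
  posNeg := hF.posNeg
  add_mem := hM.add_mem
  exists_interior x := by
    have h := (exists_mem_notMem_fibre hF₀ hjet x).1
    rw [hF.fibre_closure_interior x, closure_nonempty_iff, hF.interior_fibre x] at h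
    exact h

theorem IsMonotonicityCone.isMonotoneFor_dual {F M : Set (JetBundle n X)} (hF : IsSubequation F)
    (hM : IsMonotonicityCone M F) {F₀ : Set (Jet n)} (hF₀ : IsConstSubequation F₀)
    (hjet : LocallyAffinelyJetEquivalent F F₀) : IsMonotoneFor M (dual F) where
  posNeg x := ⟨fun _ hj A hA => hF.dual_add_mem (fun k hk => (hF.posNeg x).1 k hk A hA) hj,
    fun _ hj r hr => hF.dual_add_mem (fun k hk => (hF.posNeg x).2 k hk r hr) hj⟩
  add_mem x _ hj m hm := hF.dual_add_mem (fun k hk => hM.add_mem x k hk m hm) hj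
  exists_interior x := by
    -- The negative of the complement of `F` is open and contained in the dual; a jet outside `F`
    -- makes it nonempty over `x`.
    obtain ⟨k, hk⟩ := (exists_mem_notMem_fibre hF₀ hjet x).2
    have hO : IsOpen {J : JetBundle n X | (⟨J.base, -J.fib⟩ : JetBundle n X) ∈ Fᶜ} := by
      have h := (isClosed_dual Fᶜ).isOpen_compl
      rw [dual, hF.isClosed.isOpen_compl.interior_eq] at h
      convert h using 1
      ext J
      simp
    refine ⟨-k, mem_interior.2 ⟨_, ?_, hO, ?_⟩⟩
    · intro J hJ hJ'
      exact hJ (interior_subset hJ')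
    · change (⟨x, - -k⟩ : JetBundle n X) ∈ Fᶜ
      rw [neg_neg]
      exact hk

/-- Write the scaled jet of `ψ` as `j` plus a remainder, with `j` interior to `G`. For large `t` the
remainder lies in the cone `M`, uniformly near each point; compactness does the rest. -/
theorem exists_smul_jetAt_mem {F M G : Set (JetBundle n X)} (hM : IsMonotonicityCone M F)
    (hG : IsMonotoneFor M G) {ψ : X → ℝ} (hψ : IsStrictlySubharmonic M ψ) {K : Set X}
    (hK : IsCompact K) : ∃ T : ℝ, 0 < T ∧ ∀ t ≥ T, ∀ x ∈ K, t • jetAt n x ψ ∈ fibre G x := by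
  refine hK.induction_on
    (p := fun K => ∃ T : ℝ, 0 < T ∧ ∀ t ≥ T, ∀ x ∈ K, t • jetAt n x ψ ∈ fibre G x)
    ⟨1, one_pos, by simp⟩ (fun s t hst ih => ?_) (fun s t hs ht => ?_) fun x hx => ?_
  · obtain ⟨T, hT, h⟩ := ih
    exact ⟨T, hT, fun t ht x hx => h t ht x (hst hx)⟩
  · obtain ⟨T, hT, h⟩ := hs
    obtain ⟨T', hT', h'⟩ := ht
    refine ⟨max T T', lt_max_of_lt_left hT, fun t ht x hx => ?_⟩
    exact hx.elim (h t ((le_max_left _ _).trans ht) x) (h' t ((le_max_right _ _).trans ht) x)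
  · set e := chartAt (Rn n) x with hedef
    have he : e ∈ IsManifold.maximalAtlas 𝓘(ℝ, Rn n) ∞ X := IsManifold.chart_mem_maximalAtlas x
    have hxe : x ∈ e.source := mem_chart_source (Rn n) x
    have hy : e x ∈ e.target := e.map_source hxe
    obtain ⟨j, hj⟩ := hG.exists_interior (e.symm (e x))
    obtain ⟨j, rfl⟩ := fibreMap_surjective he hy j
    rw [← ofChart_eq he hy] at hj
    obtain ⟨r, hr, -, hball⟩ := exists_ball_ofChart_mem he isOpen_interior hy hj
    obtain ⟨r', hr', -, hcone⟩ := exists_ball_cone hM hψ he hy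
    have hcont := continuousAt_jetF (contDiffAt_comp_symm he hy (f := ψ) hψ.1.contMDiffAt)
    have hev : ∀ᶠ y in 𝓝 (e x), ‖jetF (ψ ∘ e.symm) y - jetF (ψ ∘ e.symm) (e x)‖ < r' / 2 := by
      have h2 := Metric.tendsto_nhds.1 hcont (r' / 2) (by positivity)
      simpa only [dist_eq_norm] using h2
    have hall := (e.continuousAt hxe).eventually
      ((hev.and (Metric.ball_mem_nhds (e x) hr)).and (Metric.ball_mem_nhds (e x) hr'))
    refine ⟨_, mem_nhdsWithin_of_mem_nhds (hall.and (e.open_source.mem_nhds hxe)),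
      2 * ‖j‖ / r' + 1, by positivity, ?_⟩
    rintro t ht z ⟨⟨⟨h1, h2⟩, h3⟩, hz⟩
    have hzt : e z ∈ e.target := e.map_source hz
    have hsz : e.symm (e z) = z := e.left_inv hz
    have ht0 : 0 < t := lt_of_lt_of_le (by positivity) ht
    have hjt : ‖j‖ < t * (r' / 2) := by
      have h4 : 2 * ‖j‖ / r' < t := by linarith
      rw [div_lt_iff₀ hr'] at h4
      linarith
    have hm : ofChart e (e z) (t • jetF (ψ ∘ e.symm) (e z) - j) ∈ M := by
      refine hcone _ h3 t ht0 _ ?_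
      rw [show t • jetF (ψ ∘ e.symm) (e z) - j - t • jetF (ψ ∘ e.symm) (e x) =
        t • (jetF (ψ ∘ e.symm) (e z) - jetF (ψ ∘ e.symm) (e x)) - j by rw [smul_sub]; abel]
      refine (norm_sub_le _ _).trans_lt ?_
      rw [norm_smul, Real.norm_eq_abs, abs_of_pos ht0]
      have := mul_lt_mul_of_pos_left h1 ht0
      linarith
    have hjz : ofChart e (e z) j ∈ G := interior_subset (hball _ h2 j (by simpa using hr))
    rw [ofChart_mem he hzt] at hm hjz
    have hsum := hG.add_mem _ _ hjz _ hm
    rw [← map_add, add_sub_cancel, map_smul] at hsum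
    have h5 := ofChart_jetF he hzt (f := ψ) hψ.1.contMDiffAt
    rw [ofChart_eq he hzt, JetBundle.mk.injEq] at h5
    rw [h5.2, hsz] at hsum
    exact hsum

theorem exists_subsolution_le {F M G : Set (JetBundle n X)} (hM : IsMonotonicityCone M F)
    (hG : IsMonotoneFor M G) {ψ : X → ℝ} (hψ : IsStrictlySubharmonic M ψ) {K : Set X}
    (hK : IsCompact K) (c : ℝ) :
    ∃ w : X → ℝ, Continuous w ∧ (∀ x ∈ K, ViscAt G w x) ∧ ∀ x ∈ K, w x ≤ c := by
  obtain ⟨T, hT, h⟩ := exists_smul_jetAt_mem hM hG hψ hK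
  obtain ⟨b, hb⟩ := hK.bddAbove_image hψ.1.continuous.continuousOn
  have hTψ : ∀ x, ContMDiffAt 𝓘(ℝ, Rn n) 𝓘(ℝ, ℝ) 2 (fun z => T * ψ z) x := fun x =>
    contMDiffAt_const.mul hψ.1.contMDiffAt
  refine ⟨fun z => T * ψ z + -(max (T * b - c) 0), ?_, fun x hx => ?_, fun x hx => ?_⟩
  · have := hψ.1.continuous
    fun_prop
  · refine viscAt_of_contMDiffAt (hG.posNeg x) ((hTψ x).add contMDiffAt_const) ?_
    rw [jetAt_add_const (hTψ x), jetAt_mul hψ.1.contMDiffAt]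
    exact (hG.posNeg x).2 _ (h T le_rfl x hx) _ (by simp)
  · have h1 := mul_le_mul_of_nonneg_left (hb (mem_image_of_mem ψ hx)) hT.le
    have h2 := le_max_left (T * b - c) 0
    simp only
    linarith

/-- Barriers at a boundary point at which the boundary is strictly convex. -/
theorem exists_barrier [T2Space X] {G : Set (JetBundle n X)} (hG : ∀ x, PosNeg (fibre G x))
    {Ω : Set X} (hΩ : IsOpen Ω) (hconv : StrictlyConvexBoundary G Ω) {φ : X → ℝ}
    (hφ : ContinuousOn φ (frontier Ω)) {w₀ : X → ℝ} (hw₀ : Continuous w₀)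
    (hw₀G : ∀ x ∈ Ω, ViscAt G w₀ x) (hw₀φ : ∀ x ∈ frontier Ω, w₀ x ≤ φ x) {x₀ : X}
    (hx₀ : x₀ ∈ frontier Ω) {ε : ℝ} (hε : 0 < ε) :
    ∃ w : X → ℝ, UpperSemicontinuousOn w (closure Ω) ∧ (∀ x ∈ Ω, ViscAt G w x) ∧
      (∀ x ∈ frontier Ω, w x ≤ φ x) ∧ ∀ᶠ z in 𝓝[closure Ω] x₀, φ x₀ - 2 * ε ≤ w z := by
  obtain ⟨U, ρ, hxU, hρ, hρJ⟩ := hconv x₀ hx₀ (φ x₀)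
  obtain ⟨N, hN, t₀, ht₀, ht⟩ := hρJ x₀ hxU
  obtain ⟨N', hN', hNN'⟩ := (mem_nhds_induced _ _ _).1 hN
  obtain ⟨O, hON', hO, hJO⟩ := mem_nhds_iff.1 hN'
  have hρ0 : ρ x₀ = 0 := (hρ.frontier_iff x₀ hxU).1 hx₀
  have hJO' : (⟨x₀, jetAt n x₀ ρ⟩ : JetBundle n X) ∈ O := by
    have h1 : jetAt n x₀ ρ = (0, (jetAt n x₀ ρ).2) := Prod.ext hρ0 rfl
    rw [h1]
    exact hJO
  have hρs : ∀ z ∈ U, ContMDiffAt 𝓘(ℝ, Rn n) 𝓘(ℝ, ℝ) 2 ρ z := fun z hz =>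
    (hρ.smooth.contMDiffAt (hρ.isOpen.mem_nhds hz)).of_le (by norm_cast)
  have hρle : ∀ z ∈ U, z ∈ closure Ω → ρ z ≤ 0 := by
    intro z hzU hz
    by_cases hzΩ : z ∈ Ω
    · exact (hρ.neg z hzU hzΩ).le
    · exact ((hρ.frontier_iff z hzU).1 ⟨hz, fun h => hzΩ (interior_subset h)⟩).le
  obtain ⟨η, hη, hpert⟩ := exists_perturbation (hρs x₀ hxU) hO hJO'
  -- The added quadratic makes `q` strictly negative on the closure of `Ω` away from `x₀`, while
  -- small enough to keep the reduced jet in the asymptotic interior neighbourhood.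
  set q : X → ℝ := fun z => ρ z + (-η) * chartSq n x₀ z with hq
  have hqs : ∀ z ∈ U, z ∈ (chartAt (Rn n) x₀).source →
      ContMDiffAt 𝓘(ℝ, Rn n) 𝓘(ℝ, ℝ) 2 q z := by
    intro z hz hz'
    have h1 : ContMDiffAt 𝓘(ℝ, Rn n) 𝓘(ℝ, ℝ) 2 (fun w => (-η) * chartSq n x₀ w) z :=
      contMDiffAt_const.mul (contMDiffAt_chartSq hz')
    exact (hρs z hz).add h1
  have hq0 : q x₀ = 0 := by simp [hq, hρ0, chartSq_self]
  have hqc : ContinuousAt q x₀ := (hqs x₀ hxU (mem_chart_source (Rn n) x₀)).continuousAt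
  have hA1 : ∀ᶠ z in 𝓝 x₀, |q z| ≤ η := by
    have h1 : Tendsto (fun z => |q z|) (𝓝 x₀) (𝓝 0) := by
      have := hqc.tendsto.abs
      rwa [hq0, abs_zero] at this
    exact (h1.eventually (gt_mem_nhds hη)).mono fun z hz => hz.le
  have hA2 : ∀ᶠ z in 𝓝 x₀, z ∈ frontier Ω → φ x₀ - ε < φ z :=
    eventually_nhdsWithin_iff.1 ((hφ x₀ hx₀).eventually (lt_mem_nhds (by linarith)))
  obtain ⟨R, hR, hRc, hRz⟩ := hpert _ ((hA1.and hA2).and (hρ.isOpen.mem_nhds hxU))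
  obtain ⟨m, hm⟩ := (hRc R le_rfl).bddBelow_image hw₀.continuousOn
  -- On the outer shell `q ≤ -d`, so `t * d ≥ φ x₀ - m` pushes `w₁` below the minimum of `w₀` there;
  -- `t ≥ t₀` puts the scaled reduced jet in the slice.
  set d := η * (R / 2) ^ 2 with hd
  have hd0 : 0 < d := by positivity
  set t := max t₀ ((φ x₀ - m) / d) with htdef
  have ht0 : 0 < t := lt_max_of_lt_left ht₀
  have htd : φ x₀ - m ≤ t * d := (div_le_iff₀ hd0).1 (le_max_right _ _)
  set w₁ : X → ℝ := fun z => t * q z + (φ x₀ - ε) with hw₁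
  have hqle : ∀ z ∈ chartDisc n x₀ R, z ∈ closure Ω → q z ≤ -η * chartSq n x₀ z := by
    intro z hz hzΩ
    have := hρle z (hRz z hz).1.2 hzΩ
    simp only [hq]
    linarith
  have hqle0 : ∀ z ∈ chartDisc n x₀ R, z ∈ closure Ω → q z ≤ 0 := by
    intro z hz hzΩ
    have h1 := mul_nonneg hη.le (chartSq_nonneg (n := n) x₀ z)
    have := hqle z hz hzΩ
    linarith
  have hw₁s : ∀ z ∈ chartDisc n x₀ R, ContMDiffAt 𝓘(ℝ, Rn n) 𝓘(ℝ, ℝ) 2 w₁ z := by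
    intro z hz
    have h1 : ContMDiffAt 𝓘(ℝ, Rn n) 𝓘(ℝ, ℝ) 2 (fun w => t * q w) z :=
      contMDiffAt_const.mul (hqs z (hRz z hz).1.2 hz.1)
    exact h1.add contMDiffAt_const
  have hw₁G : ∀ z ∈ chartDisc n x₀ R, z ∈ closure Ω → ViscAt G w₁ z := by
    intro z hz hzΩ
    refine viscAt_of_contMDiffAt (hG z) (hw₁s z hz) ?_
    have hqz := hqs z (hRz z hz).1.2 hz.1
    have htq : ContMDiffAt 𝓘(ℝ, Rn n) 𝓘(ℝ, ℝ) 2 (fun w => t * q w) z := contMDiffAt_const.mul hqz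
    -- The constant `-q z` resets the value to `0`, since reduced jets carry the topology of the
    -- subbundle of jets with value `0`.
    have h1 := (hRz z hz).2.2 (-η) (-q z) (by rw [abs_neg, abs_of_pos hη])
      (by rw [abs_neg]; exact (hRz z hz).1.1.1)
    rw [jetAt_add_const (f := q) hqz] at h1
    have h2 : jetAt n z q + (-q z, 0, 0) = (0, (jetAt n z q).2) := by
      refine Prod.ext ?_ ?_
      · change q z + -q z = 0
        ring
      · exact add_zero _
    rw [h2] at h1
    have h3 : (⟨z, (jetAt n z q).2⟩ : RedJetBundle n X) ∈ N := hNN' (hON' h1)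
    have h4 : ((φ x₀, t • (jetAt n z q).2) : Jet n) ∈ fibre G z := ht t (le_max_left _ _) _ h3
    -- The slice is taken at the value `φ x₀`; as `q ≤ 0` on the closure, the value of `w₁` is
    -- smaller and (N) applies.
    have h5 := (hG z).2 _ h4 (t * q z - ε)
      (by linarith [mul_nonpos_of_nonneg_of_nonpos ht0.le (hqle0 z hz hzΩ)])
    rw [jetAt_add_const htq, jetAt_mul hqz]
    convert h5 using 1
    refine Prod.ext ?_ ?_
    · change t * q z + (φ x₀ - ε) = φ x₀ + (t * q z - ε)
      ring
    · rfl
  have hab : ∀ z ∈ closure Ω, z ∈ chartBall n x₀ R → z ∉ chartDisc n x₀ (R / 2) →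
      w₁ z < w₀ z := by
    intro z hzΩ hzR hzC
    have hz := chartBall_subset_chartDisc x₀ R hzR
    have h1 : (R / 2) ^ 2 ≤ chartSq n x₀ z := by
      have h2 : R / 2 < ‖chartAt (Rn n) x₀ z - chartAt (Rn n) x₀ x₀‖ :=
        not_le.1 fun h => hzC ⟨hz.1, h⟩
      exact pow_le_pow_left₀ (by positivity) h2.le 2
    have h2 := hqle z hz hzΩ
    have h3 := mul_le_mul_of_nonneg_left h1 hη.le
    have h4 : t * q z ≤ t * (-d) := mul_le_mul_of_nonneg_left (by linarith) ht0.le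
    have h5 := hm (mem_image_of_mem w₀ hz)
    simp only [hw₁]
    linarith
  have hC : IsClosed (chartDisc n x₀ (R / 2)) := (hRc _ (by linarith)).isClosed
  have hCW : chartDisc n x₀ (R / 2) ⊆ chartBall n x₀ R := fun z hz =>
    ⟨hz.1, hz.2.trans_lt (by linarith)⟩
  have hBD := chartBall_subset_chartDisc (n := n) x₀ R
  refine ⟨glue (chartBall n x₀ R) w₁ w₀,
    upperSemicontinuousOn_glue (isOpen_chartBall x₀ R) hC hCW hab
      (fun z hz => (hw₁s z (hBD hz)).continuousAt.continuousWithinAt)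
      (hw₀.upperSemicontinuous.upperSemicontinuousOn _),
    ViscAt.glue hΩ (isOpen_chartBall x₀ R) hC hCW (fun z hz => hab z (subset_closure hz))
      (fun z hz hzW => hw₁G z (hBD hzW) (subset_closure hz)) hw₀G, fun z hz => ?_, ?_⟩
  · by_cases hzW : z ∈ chartBall n x₀ R
    · rw [glue_of_mem hzW]
      refine max_le ?_ (hw₀φ z hz)
      have h1 := (hRz z (hBD hzW)).1.1.2 hz
      have h2 := mul_nonpos_of_nonneg_of_nonpos ht0.le
        (hqle0 z (hBD hzW) (frontier_subset_closure hz))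
      simp only [hw₁]
      linarith
    · rw [glue, if_neg hzW]
      exact hw₀φ z hz
  · have h1 : Tendsto w₁ (𝓝 x₀) (𝓝 (φ x₀ - ε)) := by
      have h2 := (hqc.tendsto.const_mul t).add_const (φ x₀ - ε)
      rwa [hq0, mul_zero, zero_add] at h2
    refine mem_nhdsWithin_of_mem_nhds ?_
    filter_upwards [h1.eventually (lt_mem_nhds (show φ x₀ - 2 * ε < φ x₀ - ε by linarith)),
      (isOpen_chartBall (n := n) x₀ R).mem_nhds (mem_chartBall_self x₀ hR)] with z hz hzW
    rw [glue_of_mem hzW]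
    exact hz.le.trans (le_max_left _ _)

end Subsolutions

/-! ### Perron's method -/

section Perron

variable {n : ℕ} {X : Type*} [TopologicalSpace X] [ChartedSpace (Rn n) X]
  [IsManifold 𝓘(ℝ, Rn n) ∞ X]

/-- The upper semicontinuous envelope of the supremum of a bounded family of subsolutions is a
subsolution. -/
theorem viscAt_uscEnv_iSup {G : Set (JetBundle n X)} (hG : IsClosed G) {S Ω : Set X}
    (hΩ : IsOpen Ω) (hΩS : Ω ⊆ S) {𝓕 : Set (X → ℝ)} (hne : 𝓕.Nonempty)
    (husc : ∀ u ∈ 𝓕, UpperSemicontinuousOn u S) (hvisc : ∀ u ∈ 𝓕, ∀ x ∈ Ω, ViscAt G u x)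
    {b : ℝ} (hb : ∀ u ∈ 𝓕, ∀ x ∈ S, u x ≤ b) :
    ∀ x ∈ Ω, ViscAt G (uscEnv S fun z => ⨆ u : 𝓕, u.1 z) x := by
  intro x hx φ hφ hle heq
  set U : X → ℝ := fun z => ⨆ u : 𝓕, u.1 z with hU
  have : Nonempty 𝓕 := hne.to_subtype
  have hbdd : ∀ z ∈ S, BddAbove (range fun u : 𝓕 => u.1 z) := fun z hz =>
    ⟨b, by rintro _ ⟨u, rfl⟩; exact hb u.1 u.2 z hz⟩
  have huU : ∀ u ∈ 𝓕, ∀ z ∈ S, u z ≤ U z := fun u hu z hz => le_ciSup (hbdd z hz) ⟨u, hu⟩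
  have hUb : BddAbove (U '' S) := ⟨b, by
    rintro _ ⟨z, hz, rfl⟩
    exact ciSup_le fun u => hb u.1 u.2 z hz⟩
  by_contra hcon
  obtain ⟨η, hη, hpert⟩ := exists_perturbation hφ hG.isOpen_compl hcon
  obtain ⟨R, hR, hRc, hRz⟩ := hpert _ ((hΩ.eventually_mem hx).and hle)
  -- The raised test function touches a member of the family after a shift `κ` with `-δ < κ ≤ 0`.
  -- The first bound keeps `κ` admissible for `hpert`, the second keeps the contact point off the
  -- edge of the disc.
  set δ := min η (η * R ^ 2) with hδ
  have hδ0 : 0 < δ := lt_min hη (by positivity)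
  have hφc : ∀ z ∈ chartDisc n x R, ContMDiffAt 𝓘(ℝ, Rn n) 𝓘(ℝ, ℝ) 2
      (fun w => φ w + η * chartSq n x w) z := by
    intro z hz
    have h1 : ContMDiffAt 𝓘(ℝ, Rn n) 𝓘(ℝ, ℝ) 2 (fun w => η * chartSq n x w) z :=
      contMDiffAt_const.mul (contMDiffAt_chartSq hz.1)
    exact (hRz z hz).2.1.add h1
  have hxD : x ∈ chartDisc n x R :=
    chartBall_subset_chartDisc x R (mem_chartBall_self x hR)
  have hev : ∀ᶠ z in 𝓝 x, φ z + η * chartSq n x z - δ < φ x - δ / 2 := by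
    have h1 : Tendsto (fun z => φ z + η * chartSq n x z - δ) (𝓝 x) (𝓝 (φ x - δ)) := by
      have h2 := (hφc x hxD).continuousAt.tendsto.sub_const δ
      simpa [chartSq_self] using h2
    exact h1.eventually (gt_mem_nhds (by linarith))
  have hfreq := frequently_lt_of_lt_uscEnv (hΩS hx)
    (show φ x - δ / 2 < uscEnv S U x by rw [heq]; linarith)
  obtain ⟨z₀, hz₀, hz₀', hz₀B⟩ := (hfreq.and_eventually (mem_nhdsWithin_of_mem_nhds
    (hev.and ((isOpen_chartBall x R).eventually_mem (mem_chartBall_self (n := n) x hR))))).exists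
  obtain ⟨⟨u, hu⟩, huz⟩ := exists_lt_of_lt_ciSup hz₀
  have hDS : chartDisc n x R ⊆ S := fun z hz => hΩS (hRz z hz).1.1
  have huφ : ∀ z ∈ chartDisc n x R, u z ≤ φ z := fun z hz =>
    ((huU u hu z (hDS hz)).trans (le_uscEnv hUb (hDS hz))).trans (hRz z hz).1.2
  have hz₀D := chartBall_subset_chartDisc x R hz₀B
  obtain ⟨z₁, hz₁, hz₁max⟩ := UpperSemicontinuousOn.exists_isMaxOn ⟨z₀, hz₀D⟩ (hRc R le_rfl)
    (f := fun z => u z + -(φ z + η * chartSq n x z))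
    (((husc u hu).mono hDS).add (fun z hz =>
      (hφc z hz).continuousAt.neg.continuousWithinAt.upperSemicontinuousWithinAt))
  set κ := u z₁ + -(φ z₁ + η * chartSq n x z₁) with hκ
  have hκlt : -δ < κ := by
    have h1 : u z₀ + -(φ z₀ + η * chartSq n x z₀) ≤ κ := hz₁max hz₀D
    simp only at huz
    linarith
  have hq0 := chartSq_nonneg (n := n) x z₁
  have hκ0 : κ ≤ 0 := by
    have h1 := huφ z₁ hz₁
    have h2 := mul_nonneg hη.le hq0
    linarith
  have hz₁B : z₁ ∈ chartBall n x R := by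
    refine ⟨hz₁.1, ?_⟩
    have h1 := huφ z₁ hz₁
    have h2 : η * chartSq n x z₁ < η * R ^ 2 := by
      have := min_le_right η (η * R ^ 2)
      linarith
    exact lt_of_pow_lt_pow_left₀ 2 hR.le (lt_of_mul_lt_mul_left h2 hη.le)
  refine (hRz z₁ hz₁).2.2 η κ (abs_of_pos hη).le
    (abs_le.2 ⟨by linarith [min_le_left η (η * R ^ 2)], by linarith⟩) ?_
  refine hvisc u hu z₁ (hRz z₁ hz₁).1.1 _ ((hφc z₁ hz₁).add contMDiffAt_const) ?_ (by rw [hκ]; ring)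
  filter_upwards [(isOpen_chartBall x R).mem_nhds hz₁B] with z hz
  have h1 : u z + -(φ z + η * chartSq n x z) ≤ κ := hz₁max (chartBall_subset_chartDisc x R hz)
  linarith

/-- A maximal subsolution is a supersolution. -/
theorem viscAt_dual_of_maximal [T2Space X] {F : Set (JetBundle n X)} (hF : IsSubequation F)
    {S Ω : Set X} (hΩ : IsOpen Ω) (hΩS : Ω ⊆ S) {U : X → ℝ} (hU : UpperSemicontinuousOn U S)
    (hUF : ∀ x ∈ Ω, ViscAt F U x) (hUb : BddAbove ((fun z => -U z) '' S))
    (hmax : ∀ v : X → ℝ, UpperSemicontinuousOn v S → (∀ x ∈ Ω, ViscAt F v x) →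
      (∀ x ∉ Ω, v x = U x) → ∀ x ∈ S, v x ≤ U x) :
    ∀ x ∈ Ω, ViscAt (dual F) (uscEnv S fun z => -U z) x := by
  intro x hx φ hφ hle heq
  rw [hF.mem_fibre_dual, hF.interior_fibre]
  intro hcon
  have hθ : ContMDiffAt 𝓘(ℝ, Rn n) 𝓘(ℝ, ℝ) 2 (fun z => (-1) * φ z) x := contMDiffAt_const.mul hφ
  have hcon' : (⟨x, jetAt n x (fun z => (-1) * φ z)⟩ : JetBundle n X) ∈ interior F := by
    rw [jetAt_mul hφ, neg_one_smul ℝ (jetAt n x φ)]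
    exact hcon
  obtain ⟨η, hη, hpert⟩ := exists_perturbation hθ isOpen_interior hcon'
  obtain ⟨R, hR, hRc, hRz⟩ := hpert _ ((hΩ.eventually_mem hx).and hle)
  -- The bump `w` is `-φ` raised by `δ` at `x` and bent down so that it drops below `U` outside the
  -- half-size disc; its jets remain in `F`.
  set δ := min η (η * (R / 2) ^ 2) with hδ
  have hδ0 : 0 < δ := lt_min hη (by positivity)
  set w : X → ℝ := fun z => (-1) * φ z + (-η) * chartSq n x z + δ with hw
  have hws : ∀ z ∈ chartDisc n x R, ContMDiffAt 𝓘(ℝ, Rn n) 𝓘(ℝ, ℝ) 2 w z := by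
    intro z hz
    have h1 : ContMDiffAt 𝓘(ℝ, Rn n) 𝓘(ℝ, ℝ) 2 (fun w => (-η) * chartSq n x w) z :=
      contMDiffAt_const.mul (contMDiffAt_chartSq hz.1)
    exact ((hRz z hz).2.1.add h1).add contMDiffAt_const
  have hBD := chartBall_subset_chartDisc (n := n) x R
  have hwF : ∀ z ∈ chartBall n x R, ViscAt F w z := by
    intro z hz
    refine viscAt_of_contMDiffAt (hF.posNeg z) (hws z (hBD hz)) ?_
    exact interior_subset (s := F) ((hRz z (hBD hz)).2.2 (-η) δ (by rw [abs_neg, abs_of_pos hη])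
      (by rw [abs_of_pos hδ0]; exact min_le_left _ _))
  have hφU : ∀ z ∈ chartDisc n x R, -φ z ≤ U z := by
    intro z hz
    have h1 := (hRz z hz).1.2
    have h2 := le_uscEnv hUb (hΩS (hRz z hz).1.1)
    linarith
  have hab : ∀ z ∈ chartBall n x R, z ∉ chartDisc n x (R / 2) → w z < U z := by
    intro z hzR hzC
    have h1 : R / 2 < ‖chartAt (Rn n) x z - chartAt (Rn n) x x‖ :=
      not_le.1 fun h => hzC ⟨hzR.1, h⟩
    have h2 : (R / 2) ^ 2 < chartSq n x z := pow_lt_pow_left₀ h1 (by positivity) two_ne_zero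
    have h3 := mul_lt_mul_of_pos_left h2 hη
    have h4 := min_le_right η (η * (R / 2) ^ 2)
    have h5 := hφU z (hBD hzR)
    simp only [hw]
    linarith
  have hC : IsClosed (chartDisc n x (R / 2)) := (hRc _ (by linarith)).isClosed
  have hCW : chartDisc n x (R / 2) ⊆ chartBall n x R := fun z hz =>
    ⟨hz.1, hz.2.trans_lt (by linarith)⟩
  have hglue := hmax (glue (chartBall n x R) w U)
    (upperSemicontinuousOn_glue (isOpen_chartBall x R) hC hCW (fun z _ => hab z)
      (fun z hz => (hws z (hBD hz)).continuousAt.continuousWithinAt) hU)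
    (ViscAt.glue hΩ (isOpen_chartBall x R) hC hCW (fun z _ => hab z) (fun z _ => hwF z) hUF)
    (fun z hz => if_neg fun hzW => hz (hRz z (hBD hzW)).1.1)
  have hev : ∀ᶠ z in 𝓝 x, -φ x + δ / 2 < w z := by
    have h1 := (hws x (hBD (mem_chartBall_self x hR))).continuousAt.tendsto
    refine h1.eventually (lt_mem_nhds ?_)
    simp only [hw, chartSq_self]
    linarith
  -- Where `-U` nearly attains its upper envelope near `x`, the bump exceeds `U`, contradicting
  -- maximality of `U`.
  have hfreq := frequently_lt_of_lt_uscEnv (hΩS hx)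
    (show φ x - δ / 2 < uscEnv S (fun z => -U z) x by rw [heq]; linarith)
  obtain ⟨z, hz, hzw, hzB⟩ := (hfreq.and_eventually (mem_nhdsWithin_of_mem_nhds
    (hev.and ((isOpen_chartBall x R).eventually_mem (mem_chartBall_self (n := n) x hR))))).exists
  have h1 := hglue z (hΩS (hRz z (hBD hzB)).1.1)
  rw [glue_of_mem hzB] at h1
  have h2 := (le_max_left _ _).trans h1
  linarith

/-- Existence for the Dirichlet problem by Perron's method. -/
theorem exists_solution [T2Space X] {F M : Set (JetBundle n X)} (hF : IsSubequation F)
    (hM : IsMonotonicityCone M F) {F₀ : Set (Jet n)} (hF₀ : IsConstSubequation F₀)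
    (hjet : LocallyAffinelyJetEquivalent F F₀) {ψ : X → ℝ} (hψ : IsStrictlySubharmonic M ψ)
    {Ω : Set X} (hΩ : IsOpen Ω) (hΩc : IsCompact (closure Ω))
    (hconv : StrictlyConvexBoundary F Ω) (hconv' : StrictlyConvexBoundary (dual F) Ω)
    {φ : X → ℝ} (hφ : ContinuousOn φ (frontier Ω)) :
    ∃ u : X → ℝ, ContinuousOn u (closure Ω) ∧ (∀ x ∈ Ω, ViscAt F u x) ∧
      (∀ x ∈ Ω, ViscAt (dual F) (fun z => -u z) x) ∧ ∀ x ∈ frontier Ω, u x = φ x := by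
  have hGF := hM.isMonotoneFor hF hF₀ hjet
  have hGD := hM.isMonotoneFor_dual hF hF₀ hjet
  have hfc : IsCompact (frontier Ω) := hΩc.of_isClosed_subset isClosed_frontier
    frontier_subset_closure
  have hfS : frontier Ω ⊆ closure Ω := frontier_subset_closure
  have hΩS : Ω ⊆ closure Ω := subset_closure
  obtain ⟨c, hc⟩ := hfc.bddBelow_image hφ
  obtain ⟨c', hc'⟩ := hfc.bddAbove_image hφ
  obtain ⟨w, hw, hwF, hwc⟩ := exists_subsolution_le hM hGF hψ hΩc c
  obtain ⟨w', hw', hwD, hwc'⟩ := exists_subsolution_le hM hGD hψ hΩc (-c')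
  have hwφ : ∀ x ∈ frontier Ω, w x ≤ φ x := fun x hx =>
    (hwc x (hfS hx)).trans (hc (mem_image_of_mem φ hx))
  have hwφ' : ∀ x ∈ frontier Ω, w' x ≤ -φ x := fun x hx =>
    (hwc' x (hfS hx)).trans (neg_le_neg (hc' (mem_image_of_mem φ hx)))
  set 𝓕 : Set (X → ℝ) := {u | UpperSemicontinuousOn u (closure Ω) ∧ (∀ x ∈ Ω, ViscAt F u x) ∧
    ∀ x ∈ frontier Ω, u x ≤ φ x} with h𝓕
  have hw𝓕 : w ∈ 𝓕 := ⟨hw.upperSemicontinuous.upperSemicontinuousOn _,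
    fun x hx => hwF x (hΩS hx), hwφ⟩
  have hcomp : ∀ u ∈ 𝓕, ∀ v : X → ℝ, UpperSemicontinuousOn v (closure Ω) →
      (∀ x ∈ Ω, ViscAt (dual F) v x) → (∀ x ∈ frontier Ω, v x ≤ -φ x) →
      ∀ x ∈ closure Ω, u x + v x ≤ 0 := fun u hu v hv hvD hvφ =>
    comparison hF hM hF₀ hjet hψ hΩ hΩc hu.1 hv hu.2.1 hvD
      fun x hx => by linarith [hu.2.2 x hx, hvφ x hx]
  obtain ⟨b, hb⟩ := hΩc.bddBelow_image hw'.continuousOn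
  have hub : ∀ u ∈ 𝓕, ∀ x ∈ closure Ω, u x ≤ -b := by
    intro u hu x hx
    have h1 := hcomp u hu w' (hw'.upperSemicontinuous.upperSemicontinuousOn _)
      (fun x hx => hwD x (hΩS hx)) hwφ' x hx
    have h2 := hb (mem_image_of_mem w' hx)
    linarith
  have hne : Nonempty 𝓕 := ⟨⟨w, hw𝓕⟩⟩
  set U₀ : X → ℝ := fun z => ⨆ u : 𝓕, u.1 z with hU₀
  have huU₀ : ∀ u ∈ 𝓕, ∀ z ∈ closure Ω, u z ≤ U₀ z := fun u hu z hz =>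
    le_ciSup (f := fun u : 𝓕 => u.1 z)
      ⟨-b, by rintro _ ⟨v, rfl⟩; exact hub v.1 v.2 z hz⟩ ⟨u, hu⟩
  have hU₀b : BddAbove (U₀ '' closure Ω) := ⟨-b, by
    rintro _ ⟨z, hz, rfl⟩
    exact ciSup_le fun u => hub u.1 u.2 z hz⟩
  set U := uscEnv (closure Ω) U₀ with hU
  have huU : ∀ u ∈ 𝓕, ∀ z ∈ closure Ω, u z ≤ U z := fun u hu z hz =>
    (huU₀ u hu z hz).trans (le_uscEnv hU₀b hz)
  have hUφ : ∀ x ∈ frontier Ω, U x ≤ φ x := by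
    intro x hx
    refine le_of_forall_pos_le_add fun ε hε => ?_
    -- A dual barrier `v` is close to `-φ` near `x`; comparison then bounds every competitor there
    -- by `-v`, uniformly, so the bound passes to the envelope.
    obtain ⟨v, hv, hvD, hvφ, hvx⟩ := exists_barrier hGD.posNeg hΩ hconv'
      (φ := fun z => -φ z) hφ.neg hw'
      (fun x hx => hwD x (hΩS hx)) hwφ' hx (half_pos hε)
    refine uscEnv_le (hfS hx) ?_
    filter_upwards [hvx, self_mem_nhdsWithin] with z hz hzS
    refine ciSup_le fun u => ?_
    have h1 := hcomp u.1 u.2 v hv hvD hvφ z hzS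
    linarith
  have hU𝓕 : U ∈ 𝓕 := ⟨upperSemicontinuousOn_uscEnv hU₀b,
    viscAt_uscEnv_iSup hF.isClosed hΩ hΩS ⟨w, hw𝓕⟩ (fun u hu => hu.1) (fun u hu => hu.2.1) hub,
    hUφ⟩
  have hUb : BddAbove ((fun z => -U z) '' closure Ω) := by
    obtain ⟨m, hm⟩ := hΩc.bddBelow_image hw.continuousOn
    refine ⟨-m, ?_⟩
    rintro _ ⟨z, hz, rfl⟩
    exact neg_le_neg ((hm (mem_image_of_mem w hz)).trans (huU w hw𝓕 z hz))
  set V := uscEnv (closure Ω) (fun z => -U z) with hV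
  have hVusc : UpperSemicontinuousOn V (closure Ω) := upperSemicontinuousOn_uscEnv hUb
  have hVD : ∀ x ∈ Ω, ViscAt (dual F) V x :=
    viscAt_dual_of_maximal hF hΩ hΩS hU𝓕.1 hU𝓕.2.1 hUb fun v hv hvF hvU =>
      huU v ⟨hv, hvF, fun x hx => by
        rw [hvU x fun hxΩ => (hΩ.frontier_eq ▸ hx).2 hxΩ]
        exact hUφ x hx⟩
  have hVφ : ∀ x ∈ frontier Ω, V x ≤ -φ x := by
    intro x hx
    refine le_of_forall_pos_le_add fun ε hε => ?_
    -- Here the barrier is itself a competitor, so it bounds `U` from below near the boundary point.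
    obtain ⟨v, hv, hvF, hvφ, hvx⟩ := exists_barrier hGF.posNeg hΩ hconv hφ hw
      (fun x hx => hwF x (hΩS hx)) hwφ hx (half_pos hε)
    refine uscEnv_le (hfS hx) ?_
    filter_upwards [hvx, self_mem_nhdsWithin] with z hz hzS
    have h1 := huU v ⟨hv, hvF, hvφ⟩ z hzS
    linarith
  have hUV := hcomp U hU𝓕 V hVusc hVD hVφ
  have hVU : ∀ x ∈ closure Ω, -U x = V x := fun x hx =>
    le_antisymm (le_uscEnv hUb hx) (by linarith [hUV x hx])
  refine ⟨U, ?_, hU𝓕.2.1, fun x hx => (hVD x hx).congr ?_, fun x hx => ?_⟩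
  -- Lower semicontinuity of `U` is upper semicontinuity of `V = -U`.
  · refine continuousOn_iff_lower_upperSemicontinuousOn.2 ⟨fun x hx y hy => ?_, hU𝓕.1⟩
    have h1 := hVusc x hx (-y) (by simpa only [← hVU x hx] using neg_lt_neg hy)
    filter_upwards [h1, self_mem_nhdsWithin] with z hz hzS
    simp only [← hVU z hzS] at hz
    exact neg_lt_neg_iff.1 hz
  · filter_upwards [hΩ.mem_nhds hx] with z hz
    exact (hVU z (hΩS hz)).symm
  · refine le_antisymm (hUφ x hx) ?_
    have h1 := hVφ x hx
    rw [← hVU x (hfS hx)] at h1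
    linarith

end Perron

/-! ### From real-valued viscosity conditions to the Dirichlet problem -/

section Bridge

variable {n : ℕ} {X : Type*} [TopologicalSpace X] [ChartedSpace (Rn n) X]

/-- As `Ω` is open, neighbourhoods in `Ω` and in `X` give the same germs of test inequalities;
continuity supplies the semicontinuity clause. -/
theorem isSubharmonic_coe_iff {G : Set (JetBundle n X)} {Ω : Set X} (hΩ : IsOpen Ω) {u : X → ℝ}
    (hu : ContinuousOn u Ω) :
    IsSubharmonic G Ω (fun x => (u x : EReal)) ↔ ∀ x ∈ Ω, ViscAt G u x := by
  have hnhds : ∀ (x : Ω) (φ : X → ℝ), (∀ᶠ y : Ω in 𝓝 x, (u y : EReal) ≤ (φ y : EReal)) ↔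
      ∀ᶠ z in 𝓝 (x : X), u z ≤ φ z := by
    intro x φ
    rw [← hΩ.isOpenEmbedding_subtypeVal.map_nhds_eq x, eventually_map]
    simp only [EReal.coe_le_coe_iff]
  constructor
  · intro h x hx φ hφ hle heq
    exact h.2.2 ⟨x, hx⟩ φ hφ ((hnhds ⟨x, hx⟩ φ).2 hle) (by simp [heq])
  · intro h
    refine ⟨?_, fun x => EReal.coe_lt_top _, fun x φ hφ hle heq => ?_⟩
    · have h1 : Continuous fun x : Ω => (u x : EReal) :=
        continuous_coe_real_ereal.comp (continuousOn_iff_continuous_domRestrict.1 hu)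
      exact h1.upperSemicontinuous
    · exact h x x.2 φ hφ ((hnhds x φ).1 hle) (by simpa using heq)

open Classical in
/-- Extension of a function on a subset by zero. -/
def extendZero {X : Type*} {S : Set X} (u : S → ℝ) (x : X) : ℝ := if h : x ∈ S then u ⟨x, h⟩ else 0

theorem extendZero_of_mem {X : Type*} {S : Set X} (u : S → ℝ) {x : X} (h : x ∈ S) :
    extendZero u x = u ⟨x, h⟩ := dif_pos h

theorem continuousOn_extendZero {X : Type*} [TopologicalSpace X] {S : Set X} (u : C(S, ℝ)) :
    ContinuousOn (extendZero u) S := by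
  rw [continuousOn_iff_continuous_domRestrict]
  convert u.continuous using 1
  ext x
  exact extendZero_of_mem u x.2

theorem solvesDirichlet_iff {F : Set (JetBundle n X)} {Ω : Set X} (hΩ : IsOpen Ω)
    {φ : C(frontier Ω, ℝ)} {u : C(closure Ω, ℝ)} {v : X → ℝ}
    (hv : ∀ x (hx : x ∈ closure Ω), v x = u ⟨x, hx⟩) :
    SolvesDirichlet F Ω φ u ↔ (∀ x ∈ Ω, ViscAt F v x) ∧
      (∀ x ∈ Ω, ViscAt (dual F) (fun z => -v z) x) ∧
      ∀ x ∈ frontier Ω, v x = extendZero φ x := by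
  have hvc : ContinuousOn v (closure Ω) := by
    rw [continuousOn_iff_continuous_domRestrict]
    convert u.continuous using 1
    ext x
    exact hv x x.2
  have hvΩ := hvc.mono (subset_closure (s := Ω))
  have e1 : (fun x : Ω => ((u ⟨x, subset_closure x.2⟩ : ℝ) : EReal)) =
      fun x : Ω => ((v x : ℝ) : EReal) := by
    ext x
    rw [hv x (subset_closure x.2)]
  rw [SolvesDirichlet, IsHarmonic, e1, isSubharmonic_coe_iff hΩ hvΩ, and_assoc]
  refine and_congr Iff.rfl (and_congr ?_ ?_)
  · have h1 := isSubharmonic_coe_iff (G := dual F) hΩ (u := fun z => -v z) hvΩ.neg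
    simp only [EReal.coe_neg] at h1
    rw [← h1]
    exact iff_of_eq (congrArg _ (funext fun x => congrArg Neg.neg (congrFun e1 x)))
  · constructor
    · intro h x hx
      rw [hv x (frontier_subset_closure hx), extendZero_of_mem _ hx]
      exact h ⟨x, hx⟩
    · intro h x
      have h1 := h x x.2
      rwa [hv x (frontier_subset_closure x.2), extendZero_of_mem _ x.2] at h1

end Bridge

end

end DirichletDuality

/-! ### Existence and uniqueness -/

open scoped Manifold ContDiff in
open DirichletDuality in
theorem theorem8p1p2 {n : ℕ} {X : Type*} [TopologicalSpace X] [T2Space X]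
    [SecondCountableTopology X] [ChartedSpace (Rn n) X] [IsManifold 𝓘(ℝ, Rn n) ∞ X]
    (F M : Set (JetBundle n X)) (hF : IsSubequation F) (hM : IsMonotonicityCone M F)
    (hjet : ∃ F₀ : Set (Jet n), IsConstSubequation F₀ ∧ LocallyAffinelyJetEquivalent F F₀)
    (hψ : ∃ ψ : X → ℝ, IsStrictlySubharmonic M ψ)
    (Ω : Set X) (hΩ : IsOpen Ω) (hΩc : IsCompact (closure Ω)) (hΩb : HasSmoothBoundary n Ω)
    (hconv : StrictlyConvexBoundary F Ω) (hconv' : StrictlyConvexBoundary (dual F) Ω) :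
    ∀ φ : C(frontier Ω, ℝ), ∃! u : C(closure Ω, ℝ), SolvesDirichlet F Ω φ u := by
  intro φ
  obtain ⟨F₀, hF₀, hjet⟩ := hjet
  obtain ⟨ψ, hψ⟩ := hψ
  obtain ⟨u, hu, huF, huD, huφ⟩ := exists_solution hF hM hF₀ hjet hψ hΩ hΩc hconv hconv'
    (continuousOn_extendZero φ)
  refine ⟨⟨(closure Ω).domRestrict u, continuousOn_iff_continuous_domRestrict.1 hu⟩,
    (solvesDirichlet_iff hΩ fun x hx => rfl).2 ⟨huF, huD, huφ⟩, fun v hv => ?_⟩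
  obtain ⟨hvF, hvD, hvφ⟩ := (solvesDirichlet_iff hΩ fun x hx => extendZero_of_mem v hx).1 hv
  have hvc := continuousOn_extendZero v
  -- For two solutions, each is compared with the negative of the other, which is a subsolution for
  -- the dual; the boundary sums vanish.
  have h1 := comparison hF hM hF₀ hjet hψ hΩ hΩc (v := fun z => -extendZero v z)
    hu.upperSemicontinuousOn hvc.neg.upperSemicontinuousOn huF hvD
    fun x hx => by rw [huφ x hx, hvφ x hx, add_neg_cancel]
  have h2 := comparison hF hM hF₀ hjet hψ hΩ hΩc (v := fun z => -u z)
    hvc.upperSemicontinuousOn hu.neg.upperSemicontinuousOn hvF huD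
    fun x hx => by rw [huφ x hx, hvφ x hx, add_neg_cancel]
  ext ⟨x, hx⟩
  have h3 := h1 x hx
  have h4 := h2 x hx
  rw [extendZero_of_mem v hx] at h3 h4
  change v ⟨x, hx⟩ = u x
  linarith
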